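/- **Conventions.** Operads are planar, in sets, with one colour; $\langle n\rangle=\{1<\dots<n\}$; $\mathfrak S$ is the operad of symmetric groups with $\gamma(\sigma;\sigma_1,\dots,\sigma_n)$ the permutation that first permutes the $i$-th block by $\sigma_i$ and then moves the $i$-th block to the $\sigma(i)$-th place. A *group operad* is an operad $\mathcal G$ with a group structure (unit $e_n$) on each $\mathcal G(n)$ and a map of operads $\mathcal G\to\mathfrak S$ that is a group homomorphism in each arity (so $\mathcal G(n)$ acts on $\langle n\rangle$), such that $\gamma(xy;x_1y_1,\dots,x_ny_n)=\gamma(x;x_{y^{-1}(1)},\dots,x_{y^{-1}(n)})\,\gamma(y;y_1,\dots,y_n)$. For a (planar) multicategory $\mathcal M$, the multicategory $\mathcal M\rtimes\mathcal G$ has the objects of $\mathcal M$; its multimorphisms $a_1\cdots a_n\to a$ are the pairs $(f,x)$ with $x\in\mathcal G(n)$ and $f\in\mathcal M(a_{x^{-1}(1)}\cdots a_{x^{-1}(n)};a)$, and composition is $\gamma((f,x);(f_1,x_1),\dots,(f_n,x_n))=(\gamma(f;f_{x^{-1}(1)},\dots,f_{x^{-1}(n)}),\gamma(x;x_1,\dots,x_n))$.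 A *$\mathcal G$-symmetric structure* on $\mathcal M$ is an identity-on-objects multifunctor $\mathtt{sym}:\mathcal M\rtimes\mathcal G\to\mathcal M$ with $\mathtt{sym}(f,e_n)=f$ and $\mathtt{sym}(\mathtt{sym}(f,x),y)=\mathtt{sym}(f,xy)$. A multifunctor $F$ between $\mathcal G$-symmetric multicategories is *$\mathcal G$-symmetric* if $F(\mathtt{sym}(f,x))=\mathtt{sym}(F(f),x)$. Let $\mathbf{MultCat}(\mathcal M,\mathcal N)$ be the category of multifunctors and multinatural transformations, and $\mathbf{MultCat}_{\mathcal G}(\mathcal M,\mathcal N)$ its full subcategory of $\mathcal G$-symmetric multifunctors. The one-object multicategory $\mathcal G$ is $\mathcal G$-symmetric by $\mathtt{sym}(y,x)=yx$. For a monoidal category $\mathcal C$ let $\mathcal C^\otimes$ be the multicategory with $\mathcal C^\otimes(X_1\cdots X_n;X)=\mathcal C(X_1\otimes\cdots\otimes X_n,X)$. A *$\mathcal G$-symmetric monoidal category* is a monoidal category $\mathcal C$ with a $\mathcal G$-symmetric structure on $\mathcal C^\otimes$, and a *$\mathcal G$-symmetric monoidal functor* is a (strong) monoidal functor $F$ whose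 multifunctor $F^\otimes$ is $\mathcal G$-symmetric; with monoidal natural transformations these form the categories $\mathbf{MonCat}_{\mathcal G}(\mathcal C,\mathcal D)$. Put $\mathbf{Alg}(\mathcal C):=\mathbf{MultCat}(\ast,\mathcal C^\otimes)$, with $\ast$ the terminal operad (the category of monoids in $\mathcal C$). Let $\widetilde\Delta$ be the category of the ordinals $\langle n\rangle$, $n\ge 0$, and order-preserving maps, with the join $\star$. For $\varphi:\langle m\rangle\to\langle n\rangle$ put $k_j=\#\varphi^{-1}(j)$ and, for $x\in\mathcal G(n)$, put $\varphi^*(x)=\gamma(x;e_{k_1},\dots,e_{k_n})\in\mathcal G(m)$, and let $\varphi^x:\langle m\rangle\to\langle n\rangle$ be the order-preserving map whose fibres have $k_{x^{-1}(1)},\dots,k_{x^{-1}(n)}$ elements. This makes $\langle n\rangle\mapsto\mathcal G(n)$ a crossed $\widetilde\Delta$-group $\mathfrak J^\natural\mathcal G$. Its total category $\widetilde\Delta_{\mathfrak J^\natural\mathcal G}$ has the objects $\langle n\rangle$; its morphisms $\langle m\rangle\to\langle n\rangle$ are the pairs $(\varphi,x)$ with $\varphi:\langle m\rangle\to\langle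 n\rangle$ in $\widetilde\Delta$ and $x\in\mathcal G(m)$, and $(\varphi,x)\circ(\psi,y)=(\varphi\psi^x,\psi^*(x)y)$. It is strict monoidal with $\langle m\rangle\star\langle n\rangle=\langle m+n\rangle$ and $(\varphi_1,x_1)\star(\varphi_2,x_2)=(\varphi_1\star\varphi_2,\gamma(e_2;x_1,x_2))$, and $\mathcal G$-symmetric with $\mathtt{sym}((\varphi,x),u)=(\varphi,x\,\gamma(u;e_{k_1},\dots,e_{k_n}))$ on multimorphisms with source $\langle k_1\rangle\cdots\langle k_n\rangle$. Let $M_{\mathcal G}:\mathcal G\to\widetilde\Delta_{\mathfrak J^\natural\mathcal G}^\otimes$ be the $\mathcal G$-symmetric multifunctor with $M_{\mathcal G}(\ast)=\langle 1\rangle$ and $M_{\mathcal G}(x)=(\mu_n,x)$ for $x\in\mathcal G(n)$, where $\mu_n:\langle n\rangle\to\langle 1\rangle$ is the unique map. **Proposition.** Let $\mathcal G$ be a group operad and $\mathcal C$ a $\mathcal G$-symmetric monoidal category. Then the composite $$\mathbf{MonCat}_{\mathcal G}(\widetilde\Delta_{\mathfrak J^\natural\mathcal G},\mathcal C)\xrightarrow{(-)^\otimes}\mathbf{MultCat}_{\mathcal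 G}(\widetilde\Delta_{\mathfrak J^\natural\mathcal G}^\otimes,\mathcal C^\otimes)\xrightarrow{M_{\mathcal G}^*}\mathbf{MultCat}_{\mathcal G}(\mathcal G,\mathcal C^\otimes)\cong\mathbf{Alg}(\mathcal C)$$ is an equivalence of categories. Here the last functor, restriction along the map $\ast\to\mathcal G$ given by the units $e_n$, is an isomorphism of categories. -/

import Mathlib

universe w w' u v u' v' u'' v''

open CategoryTheory MonoidalCategory

namespace GrpOpd

/-- The total arity `k 0 + k 1 + ⋯ + k (n - 1)` of a sequence of arities. -/
def arity : ∀ {n : ℕ}, (Fin n → ℕ) → ℕ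
  | 0, _ => 0
  | _ + 1, k => arity (fun i => k i.succ) + k 0

theorem arity_eq_sum : ∀ {n : ℕ} (k : Fin n → ℕ), arity k = ∑ i, k i
  | 0, _ => rfl
  | n + 1, k => by
    rw [arity, arity_eq_sum, Fin.sum_univ_succ, add_comm]

theorem arity_perm {n : ℕ} (k : Fin n → ℕ) (σ : Equiv.Perm (Fin n)) :
    arity (fun i => k (σ i)) = arity k := by
  rw [arity_eq_sum, arity_eq_sum]
  exact Equiv.sum_comp σ k

/-- The `s`-th element of the first block in `p` elements followed by `q` elements. -/
def lft {p : ℕ} (q : ℕ) (s : Fin p) : Fin (q + p) := ⟨s, by omega⟩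

/-- The position of the `s`-th element of the `i`-th block in the concatenation of blocks of lengths
`k 0, k 1, …`. -/
def pos : ∀ {n : ℕ} (k : Fin n → ℕ) (i : Fin n), Fin (k i) → Fin (arity k)
  | 0, _ => fun i => i.elim0
  | _ + 1, k => Fin.cases (fun s => lft _ s) (fun i s => (pos (fun j => k j.succ) i s).addNat (k 0))

theorem pos_val : ∀ {n : ℕ} (k : Fin n → ℕ) (i : Fin n) (s : Fin (k i)),
    (pos k i s : ℕ) = arity (fun j : Fin i => k (j.castLE i.2.le)) + s
  | 0, _ => fun i => i.elim0
  | n + 1, k => by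
    intro i
    refine Fin.cases ?_ ?_ i
    · intro s
      change (s : ℕ) = 0 + s
      omega
    · intro i s
      change (pos (fun j => k j.succ) i s : ℕ) + k 0 = arity (fun j : Fin i => k (j.castLE i.2.le).succ) + k 0 + s
      rw [pos_val]
      omega

/-- `pos`, with the total arity replaced by any number equal to it. -/
def blk {n m : ℕ} {k : Fin n → ℕ} (h : arity k = m) (i : Fin n) (s : Fin (k i)) : Fin m :=
  (pos k i s).cast h

theorem pos_surj : ∀ {n : ℕ} (k : Fin n → ℕ) (p : Fin (arity k)), ∃ i s, pos k i s = p
  | 0, _, p => p.elim0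
  | n + 1, k, p => by
    by_cases hp : (p : ℕ) < k 0
    · exact ⟨0, ⟨p, hp⟩, rfl⟩
    · have hp2 : (p : ℕ) < arity (fun i => k i.succ) + k 0 := p.2
      obtain ⟨i, s, h⟩ := pos_surj (fun i => k i.succ) ⟨p - k 0, by omega⟩
      refine ⟨i.succ, s, Fin.ext ?_⟩
      have h2 := congrArg Fin.val h
      change (pos (fun i => k i.succ) i s : ℕ) + k 0 = p
      simp only at h2
      omega

theorem pos_lt {n : ℕ} (k : Fin n → ℕ) (i j : Fin n) (s : Fin (k i)) (t : Fin (k j)) (h : i < j) :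
    pos k i s < pos k j t := by
  induction n with
  | zero => exact i.elim0
  | succ n ih =>
    revert s t h
    refine Fin.cases ?_ ?_ j
    · intro s t h
      exact absurd h (by simp)
    · intro j
      refine Fin.cases ?_ ?_ i
      · intro s t _
        change (s : ℕ) < (pos (fun j => k j.succ) j t : ℕ) + k 0
        have := s.2
        omega
      · intro i s t h
        have := ih (fun j => k j.succ) i j s t (by simpa using h)
        change (pos (fun j => k j.succ) i s : ℕ) + k 0 < (pos (fun j => k j.succ) j t : ℕ) + k 0
        have : (pos (fun j => k j.succ) i s : ℕ) < (pos (fun j => k j.succ) j t : ℕ) := this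
        omega

theorem blk_lt {n m : ℕ} {k : Fin n → ℕ} (h : arity k = m) {i j : Fin n} (s : Fin (k i)) (t : Fin (k j))
    (hij : i < j) : blk h i s < blk h j t := by
  subst h; exact pos_lt k _ _ s t hij

theorem blk_surj {n m : ℕ} {k : Fin n → ℕ} (h : arity k = m) (p : Fin m) : ∃ i s, blk h i s = p := by
  subst h; exact pos_surj k p

theorem blk_inj {n m : ℕ} {k : Fin n → ℕ} (h : arity k = m) :
    Function.Injective (fun x : (i : Fin n) × Fin (k i) => blk h x.1 x.2) := by
  subst h
  rintro ⟨i, s⟩ ⟨j, t⟩ hh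
  have hh : pos k i s = pos k j t := hh
  rcases lt_trichotomy i j with hij | hij | hij
  · exact absurd hh (pos_lt k _ _ s t hij).ne
  · subst hij
    have h2 := congrArg Fin.val hh
    rw [pos_val, pos_val] at h2
    simp only [add_right_inj] at h2
    rw [Fin.ext h2]
  · exact absurd hh (pos_lt k _ _ t s hij).ne.symm

/-- Positions in a concatenation are pairs of a block and a position in this block. -/
noncomputable def blkEquiv {n m : ℕ} {k : Fin n → ℕ} (h : arity k = m) : (i : Fin n) × Fin (k i) ≃ Fin m :=
  Equiv.ofBijective (fun x => blk h x.1 x.2)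
    ⟨blk_inj h, fun p => by obtain ⟨i, s, hh⟩ := blk_surj h p; exact ⟨⟨i, s⟩, hh⟩⟩

@[simp] theorem blkEquiv_symm_blk {n m : ℕ} {k : Fin n → ℕ} (h : arity k = m) (i : Fin n) (s : Fin (k i)) :
    (blkEquiv h).symm (blk h i s) = ⟨i, s⟩ := (blkEquiv h).symm_apply_apply ⟨i, s⟩

theorem blk_lt_iff {n m : ℕ} {k : Fin n → ℕ} (h : arity k = m) {i j : Fin n} (s : Fin (k i))
    (t : Fin (k j)) : blk h i s < blk h j t ↔ i < j ∨ ∃ e : i = j, Fin.cast (congrArg k e) s < t := by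
  rcases lt_trichotomy i j with hij | rfl | hij
  · simp [hij, blk_lt h s t hij]
  · subst h
    have : pos k i s < pos k i t ↔ s < t := by
      rw [Fin.lt_def, Fin.lt_def, pos_val, pos_val]
      omega
    simpa [blk] using this
  · have := blk_lt h t s hij
    simp [hij.not_gt, this.le, hij.ne.symm]

/-- Concatenating in one step or in two steps. -/
theorem arity_assoc {n m : ℕ} {k : Fin n → ℕ} (hm : arity k = m) (l : Fin m → ℕ) :
    arity (fun i => arity fun s => l (blk hm i s)) = arity l := by
  simp only [arity_eq_sum]
  rw [Finset.sum_sigma', Finset.univ_sigma_univ]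
  exact Equiv.sum_comp (blkEquiv hm) l

theorem eq_of_strictMono_comp {α : Type} {q : ℕ} (f g : α → Fin q) (hf : Function.Bijective f)
    (h : ∀ x y, f x < f y → g x < g y) : f = g := by
  let e := Equiv.ofBijective f hf
  have hm : StrictMono (g ∘ e.symm) := fun p p' hp =>
    h _ _ (by
      change e (e.symm p) < e (e.symm p')
      simpa using hp)
  have hs : Function.Surjective (g ∘ e.symm) := Finite.surjective_of_injective hm.injective
  have h2 : hm.orderIsoOfSurjective _ hs = OrderIso.refl _ := Subsingleton.elim _ _
  funext x
  have h3 : g (e.symm (e x)) = e x := congrArg (fun o : Fin q ≃o Fin q => o (e x)) h2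
  rw [e.symm_apply_apply] at h3
  exact h3.symm

/-- Positions in an iterated concatenation. -/
theorem blk_assoc {n m q : ℕ} {k : Fin n → ℕ} (hm : arity k = m) {l : Fin m → ℕ} (hl : arity l = q)
    {r : Fin n → ℕ} (hr : ∀ i, arity (fun s => l (blk hm i s)) = r i) (hq : arity r = q)
    (i : Fin n) (s : Fin (k i)) (t : Fin (l (blk hm i s))) :
    blk hq i (blk (hr i) s t) = blk hl (blk hm i s) t := by
  have := eq_of_strictMono_comp
    (fun x : (i : Fin n) × (s : Fin (k i)) × Fin (l (blk hm i s)) => blk hl (blk hm x.1 x.2.1) x.2.2)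
    (fun x => blk hq x.1 (blk (hr x.1) x.2.1 x.2.2)) ?_ ?_
  · exact (congrFun this ⟨i, s, t⟩).symm
  · refine ⟨?_, fun p => ?_⟩
    · rintro ⟨i, s, t⟩ ⟨i', s', t'⟩ h
      have h1 := blk_inj hl (a₁ := ⟨blk hm i s, t⟩) (a₂ := ⟨blk hm i' s', t'⟩) h
      have h2 := blk_inj hm (a₁ := ⟨i, s⟩) (a₂ := ⟨i', s'⟩) (congrArg Sigma.fst h1)
      cases h2
      cases h1
      rfl
    obtain ⟨p, t, rfl⟩ := blk_surj hl p
    obtain ⟨i, s, rfl⟩ := blk_surj hm p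
    exact ⟨⟨i, s, t⟩, rfl⟩
  · rintro ⟨i, s, t⟩ ⟨i', s', t'⟩ h
    simp only at h ⊢
    rcases lt_trichotomy i i' with hi | rfl | hi
    · exact blk_lt _ _ _ hi
    · rw [blk_lt_iff]
      refine Or.inr ⟨rfl, ?_⟩
      rcases lt_trichotomy s s' with hs | rfl | hs
      · exact blk_lt _ _ _ hs
      · simp only [blk_lt_iff, lt_irrefl, false_or, exists_true_left, Fin.cast_eq_self] at h ⊢
        exact h
      · exact absurd (blk_lt hl t' t ((blk_lt_iff hm s' s).2 (Or.inr ⟨rfl, hs⟩))) h.not_gt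
    · exact absurd (blk_lt hl t' t (blk_lt hm s' s hi)) h.not_gt


/-! ### Operads and group operads -/

/-- A planar operad in sets. The composite `γ h x y` is the usual `γ(x; y_1, …, y_n)`, regarded as
an operation of arity `m` for any number `m` equal to the sum of the arities of the `y_i`. -/
structure Operad where
  Op : ℕ → Type w
  γ : ∀ {n m : ℕ} {k : Fin n → ℕ}, arity k = m → Op n → (∀ i, Op (k i)) → Op m
  one : Op 1
  one_γ : ∀ {n : ℕ} (h : arity (fun _ : Fin 1 => n) = n) (x : Op n), γ h one (fun _ => x) = x
  γ_one : ∀ {n : ℕ} (h : arity (fun _ : Fin n => 1) = n) (x : Op n), γ h x (fun _ => one) = x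
  assoc : ∀ {n m q : ℕ} {k : Fin n → ℕ} (hm : arity k = m) {l : Fin m → ℕ} (hl : arity l = q)
    {r : Fin n → ℕ} (hr : ∀ i, arity (fun s => l (blk hm i s)) = r i) (hq : arity r = q)
    (x : Op n) (y : ∀ i, Op (k i)) (z : ∀ p, Op (l p)),
    γ hl (γ hm x y) z = γ hq x (fun i => γ (hr i) (y i) (fun s => z (blk hm i s)))

/-- The inverse of the block permutation `γ(σ; τ_1, …, τ_n)`: the `s`-th place of the `i`-th block
of the permuted concatenation is filled by the `τ⁻¹ s`-th element of the block `σ⁻¹ i`. -/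
noncomputable def blockPermInv {n m : ℕ} {k : Fin n → ℕ} (h : arity k = m) (σ : Equiv.Perm (Fin n))
    (τ : ∀ i, Equiv.Perm (Fin (k i))) : Equiv.Perm (Fin m) :=
  (blkEquiv (k := fun i => k (σ⁻¹ i)) ((arity_perm k σ⁻¹).trans h)).symm.trans
    (((Equiv.sigmaCongrLeft (β := fun i => Fin (k i)) σ⁻¹).trans
      (Equiv.sigmaCongrRight fun i => (τ i)⁻¹)).trans (blkEquiv h))

/-- The block permutation `γ(σ; τ_1, …, τ_n)`: first permute the `i`-th block by `τ_i`,
then move the `i`-th block to the `σ i`-th place. -/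
noncomputable def blockPerm {n m : ℕ} {k : Fin n → ℕ} (h : arity k = m) (σ : Equiv.Perm (Fin n))
    (τ : ∀ i, Equiv.Perm (Fin (k i))) : Equiv.Perm (Fin m) :=
  (blockPermInv h σ τ)⁻¹

theorem blockPerm_inv_blk {n m : ℕ} {k : Fin n → ℕ} (h : arity k = m) (σ : Equiv.Perm (Fin n))
    (τ : ∀ i, Equiv.Perm (Fin (k i))) (h' : arity (fun i => k (σ⁻¹ i)) = m) (i : Fin n)
    (s : Fin (k (σ⁻¹ i))) :
    (blockPerm h σ τ)⁻¹ (blk h' i s) = blk h (σ⁻¹ i) ((τ (σ⁻¹ i))⁻¹ s) := by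
  rw [blockPerm, inv_inv]
  simp only [blockPermInv, Equiv.trans_apply, blkEquiv_symm_blk]
  rfl

theorem perm_eq_of_inv_blk {n m : ℕ} {k : Fin n → ℕ} (h : arity k = m) (α β : Equiv.Perm (Fin m))
    (H : ∀ i s, α⁻¹ (blk h i s) = β⁻¹ (blk h i s)) : α = β := by
  apply inv_injective
  ext p
  obtain ⟨i, s, rfl⟩ := blk_surj h p
  rw [H]

theorem blk_congr {n m : ℕ} {k : Fin n → ℕ} (h : arity k = m) {k' : Fin n → ℕ} (h' : arity k' = m)
    (hk : ∀ i, k i = k' i) {i j : Fin n} (hij : i = j) (s : Fin (k i)) (t : Fin (k' j))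
    (hst : (s : ℕ) = t) : blk h i s = blk h' j t := by
  obtain rfl : k = k' := funext hk
  subst hij
  rw [Fin.ext hst]

theorem perm_val_congr {m : ℕ} {l : Fin m → ℕ} (z : ∀ p, Equiv.Perm (Fin (l p))) {p p' : Fin m}
    (h : p = p') (t : Fin (l p)) :
    (((z p)⁻¹ t : Fin (l p)) : ℕ) = ((z p')⁻¹ (t.cast (congrArg l h)) : Fin (l p')) := by
  subst h; rfl

/-- The operad of symmetric groups. -/
noncomputable def symOperad : Operad.{0} where
  Op n := Equiv.Perm (Fin n)
  γ h σ τ := blockPerm h σ τ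
  one := 1
  one_γ {n} h x := by
    apply perm_eq_of_inv_blk h
    intro i s
    rw [blockPerm_inv_blk h 1 (fun _ => x) h i s]
    have key : ∀ i s, blk h i s = s := by
      intro i s
      apply Fin.ext
      simp [blk, pos_val, Subsingleton.elim i 0, arity_eq_sum]
    simp only [key]
  γ_one {n} h x := by
    apply perm_eq_of_inv_blk h
    intro i s
    rw [blockPerm_inv_blk h x (fun _ => 1) h i s]
    have key : ∀ i s, blk h i s = i := by
      intro i s
      apply Fin.ext
      have := s.2
      simp [blk, pos_val, arity_eq_sum]
    simp only [key]
  assoc {n m q k} hm {l} hl {r} hr hq x y z := by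
    have hm' := (arity_perm k x⁻¹).trans hm
    have hl' := (arity_perm l (blockPerm hm x y)⁻¹).trans hl
    have hq' := (arity_perm r x⁻¹).trans hq
    apply perm_eq_of_inv_blk hl'
    intro p t
    obtain ⟨i, s, rfl⟩ := blk_surj hm' p
    rw [blockPerm_inv_blk hl _ z hl']
    have hP := blockPerm_inv_blk hm x y hm' i s
    have hr1 : arity (fun s => l (blk hm (x⁻¹ i) ((y (x⁻¹ i))⁻¹ s))) = r (x⁻¹ i) :=
      (arity_perm (fun s => l (blk hm (x⁻¹ i) s)) (y (x⁻¹ i))⁻¹).trans (hr _)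
    have hr2 : ∀ i, arity (fun s => l ((blockPerm hm x y)⁻¹ (blk hm' i s))) = r (x⁻¹ i) := by
      intro i
      rw [← hr, ← arity_perm (fun s => l (blk hm (x⁻¹ i) s)) (y (x⁻¹ i))⁻¹]
      congr 1
      funext s
      rw [blockPerm_inv_blk hm x y hm' i s]
    rw [← blk_assoc (k := fun i => k (x⁻¹ i)) hm' (l := fun p => l ((blockPerm hm x y)⁻¹ p)) hl'
      (r := fun i => r (x⁻¹ i)) hr2 hq' i s t, blockPerm_inv_blk hq x _ hq' i,
      blk_congr (hr2 i) hr1 (fun s => congrArg l (blockPerm_inv_blk hm x y hm' i s)) rfl t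
        (t.cast (congrArg l hP)) rfl,
      blockPerm_inv_blk (hr (x⁻¹ i)) (y (x⁻¹ i)) _ hr1, blk_assoc hm hl hr hq]
    refine blk_congr _ _ (fun _ => rfl) hP _ _ ?_
    exact perm_val_congr z hP t

/-- A map of operads. -/
structure OperadHom (O : Operad.{w}) (P : Operad.{w'}) where
  toFun : ∀ {n : ℕ}, O.Op n → P.Op n
  map_one : toFun O.one = P.one
  map_γ : ∀ {n m : ℕ} {k : Fin n → ℕ} (h : arity k = m) (x : O.Op n) (y : ∀ i, O.Op (k i)),
    toFun (O.γ h x y) = P.γ h (toFun x) (fun i => toFun (y i))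

/-- The permutation of `{1, …, n}` given by an operation of arity `n` of an operad over the operad
of symmetric groups. -/
def OperadHom.perm {O : Operad.{w}} (ρ : OperadHom O symOperad) {n : ℕ} (x : O.Op n) :
    Equiv.Perm (Fin n) := ρ.toFun x

/-- A group operad: an operad `G` with a group structure on each `G(n)` and a map of operads
`ρ` from `G` to the operad of symmetric groups which is a group homomorphism in each arity, such
that `γ(xy; x_1y_1, …, x_ny_n) = γ(x; x_{y⁻¹(1)}, …, x_{y⁻¹(n)}) γ(y; y_1, …, y_n)`. -/
structure GroupOperad extends Operad.{w} where
  group : ∀ n, Group (Op n)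
  ρ : OperadHom toOperad symOperad
  ρ_mul : ∀ {n : ℕ} (x y : Op n), ρ.perm (x * y) = ρ.perm x * ρ.perm y
  interchange : ∀ {n m : ℕ} {k : Fin n → ℕ} (h : arity k = m) (x y : Op n) (x' y' : ∀ i, Op (k i))
    (h' : arity (fun i => k ((ρ.perm y)⁻¹ i)) = m),
    γ h (x * y) (fun i => x' i * y' i) =
      γ h' x (fun i => x' ((ρ.perm y)⁻¹ i)) * γ h y y'

attribute [instance] GroupOperad.group

namespace GroupOperad

variable (G : GroupOperad.{w})

/-- The permutation of `{1, …, n}` underlying an element of `G(n)`. -/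
def perm {n : ℕ} (x : G.Op n) : Equiv.Perm (Fin n) := G.ρ.perm x

theorem perm_mul {n : ℕ} (x y : G.Op n) : G.perm (x * y) = G.perm x * G.perm y := G.ρ_mul x y

@[simp] theorem perm_one {n : ℕ} : G.perm (1 : G.Op n) = 1 := by
  have := G.perm_mul (1 : G.Op n) 1
  simpa using this

theorem perm_inv_γ {n m : ℕ} {k : Fin n → ℕ} (h : arity k = m) (x : G.Op n) (y : ∀ i, G.Op (k i))
    (h' : arity (fun i => k ((G.perm x)⁻¹ i)) = m) (i : Fin n) (s : Fin (k ((G.perm x)⁻¹ i))) :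
    (G.perm (G.γ h x y))⁻¹ (blk h' i s) =
      blk h ((G.perm x)⁻¹ i) ((G.perm (y ((G.perm x)⁻¹ i)))⁻¹ s) := by
  have : G.perm (G.γ h x y) = blockPerm h (G.perm x) (fun i => G.perm (y i)) := G.ρ.map_γ h x y
  rw [this]
  exact blockPerm_inv_blk h _ _ h' i s

theorem γ_congr {n m : ℕ} {k : Fin n → ℕ} (h : arity k = m) {k' : Fin n → ℕ} (h' : arity k' = m)
    (hk : ∀ i, k i = k' i) {x x' : G.Op n} (hx : x = x') (y : ∀ i, G.Op (k i)) (y' : ∀ i, G.Op (k' i))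
    (hy : ∀ i, y i ≍ y' i) : G.γ h x y = G.γ h' x' y' := by
  obtain rfl : k = k' := funext hk
  obtain rfl : y = y' := funext fun i => eq_of_heq (hy i)
  rw [hx]

theorem mul_γ {n m : ℕ} {k : Fin n → ℕ} (h : arity k = m) (x y : G.Op n) (x' y' : ∀ i, G.Op (k i))
    (h' : arity (fun i => k ((G.perm y)⁻¹ i)) = m) :
    G.γ h (x * y) (fun i => x' i * y' i) =
      G.γ h' x (fun i => x' ((G.perm y)⁻¹ i)) * G.γ h y y' :=
  G.interchange h x y x' y' h'

theorem mul_γ_one {n m : ℕ} {k : Fin n → ℕ} (h : arity k = m) (x : G.Op n) (x' y' : ∀ i, G.Op (k i)) :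
    G.γ h x (fun i => x' i * y' i) = G.γ h x x' * G.γ h 1 y' := by
  have h' : arity (fun i => k ((G.perm (1 : G.Op n))⁻¹ i)) = m := by simpa using h
  have h1 := G.mul_γ h x 1 x' y' h'
  rw [mul_one] at h1
  rw [h1]
  congr 1
  exact G.γ_congr _ _ (by simp) rfl _ _ (fun i => by rw [perm_one]; rfl)

theorem γ_one_one {n m : ℕ} {k : Fin n → ℕ} (h : arity k = m) :
    G.γ h 1 (fun i => (1 : G.Op (k i))) = 1 := by
  have := G.mul_γ_one h (1 : G.Op n) (fun i => (1 : G.Op (k i))) (fun _ => 1)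
  simpa using this

theorem one_eq : G.one = 1 := by
  have h : arity (fun _ : Fin 1 => 1) = 1 := rfl
  have h1 := G.mul_γ h G.one (1 : G.Op 1) (fun _ => 1) (fun _ => G.one) rfl
  have e1 : G.γ h (G.one * 1) (fun _ => 1 * G.one) = G.one := by
    rw [mul_one, one_mul]; exact G.one_γ h _
  have e2 : G.γ h G.one (fun _ => (1 : G.Op 1)) = 1 := G.one_γ h _
  have e3 : G.γ h 1 (fun _ => G.one) = 1 := G.γ_one h _
  exact e1.symm.trans (h1.trans (by rw [e2, e3, mul_one]))

end GroupOperad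


/-! ### Multicategories -/

theorem arity_const_one : ∀ n : ℕ, arity (fun _ : Fin n => 1) = n
  | 0 => rfl
  | n + 1 => congrArg (· + 1) (arity_const_one n)

theorem arity_one_const (n : ℕ) : arity (fun _ : Fin 1 => n) = n := Nat.zero_add n

theorem blk_const_one {n : ℕ} (h : arity (fun _ : Fin n => 1) = n) (i : Fin n) (s : Fin 1) :
    blk h i s = i := by
  apply Fin.ext
  simp [blk, pos_val, arity_eq_sum]

theorem blk_one_const {n : ℕ} (h : arity (fun _ : Fin 1 => n) = n) (i : Fin 1) (s : Fin n) :
    blk h i s = s := by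
  apply Fin.ext
  simp [blk, pos_val, Subsingleton.elim i 0, arity_eq_sum]

/-- A (planar) multicategory. `Hom a b` is the set of multimorphisms from the sequence
`a 0, …, a (n - 1)` to `b`. In the composite `comp h hd f g` of `f` with the `g i`, the source `d`
is the concatenation of the sources `c i` of the `g i`. -/
structure Multicategory where
  Ob : Type u
  Hom : ∀ {n : ℕ}, (Fin n → Ob) → Ob → Type v
  id : ∀ a : Ob, Hom (fun _ : Fin 1 => a) a
  comp : ∀ {n m : ℕ} {k : Fin n → ℕ} (h : arity k = m) {a : Fin n → Ob} {b : Ob}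
    {c : ∀ i, Fin (k i) → Ob} {d : Fin m → Ob}, (∀ i s, d (blk h i s) = c i s) →
    Hom a b → (∀ i, Hom (c i) (a i)) → Hom d b
  id_comp : ∀ {n : ℕ} (h : arity (fun _ : Fin 1 => n) = n) {a : Fin n → Ob} {b : Ob}
    (ha : ∀ i s, a (blk h i s) = a s) (f : Hom a b), comp h ha (id b) (fun _ => f) = f
  comp_id : ∀ {n : ℕ} (h : arity (fun _ : Fin n => 1) = n) {a : Fin n → Ob} {b : Ob}
    (ha : ∀ i s, a (blk h i s) = a i) (f : Hom a b), comp h ha f (fun i => id (a i)) = f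
  assoc : ∀ {n m q : ℕ} {k : Fin n → ℕ} (hm : arity k = m) {l : Fin m → ℕ} (hl : arity l = q)
    {r : Fin n → ℕ} (hr : ∀ i, arity (fun s => l (blk hm i s)) = r i) (hq : arity r = q)
    {a : Fin n → Ob} {b : Ob} {c : Fin m → Ob} {e : ∀ p, Fin (l p) → Ob} {e' : ∀ i, Fin (r i) → Ob}
    {d : Fin q → Ob} (hd : ∀ p t, d (blk hl p t) = e p t)
    (he' : ∀ i s t, e' i (blk (hr i) s t) = e (blk hm i s) t) (hd' : ∀ i u, d (blk hq i u) = e' i u)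
    (f : Hom a b) (g : ∀ i, Hom (fun s => c (blk hm i s)) (a i)) (g' : ∀ p, Hom (e p) (c p)),
    comp hl hd (comp hm (fun _ _ => rfl) f g) g' =
      comp hq hd' f (fun i => comp (hr i) (he' i) (g i) (fun s => g' (blk hm i s)))

namespace Multicategory

theorem comp_heq (M : Multicategory.{u, v}) {n m : ℕ} {k k' : Fin n → ℕ} {h : arity k = m}
    {h' : arity k' = m} {a a' : Fin n → M.Ob} {b : M.Ob} {c : ∀ i, Fin (k i) → M.Ob}
    {c' : ∀ i, Fin (k' i) → M.Ob} {d d' : Fin m → M.Ob} {hd : ∀ i s, d (blk h i s) = c i s}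
    {hd' : ∀ i s, d' (blk h' i s) = c' i s} {f : M.Hom a b} {f' : M.Hom a' b}
    {g : ∀ i, M.Hom (c i) (a i)} {g' : ∀ i, M.Hom (c' i) (a' i)} (hk : k = k') (ha : a = a')
    (hc : ∀ i, c i ≍ c' i) (hdd : d = d') (hf : f ≍ f') (hg : ∀ i, g i ≍ g' i) :
    M.comp h hd f g ≍ M.comp h' hd' f' g' := by
  subst hk ha hdd
  obtain rfl : c = c' := funext fun i => eq_of_heq (hc i)
  obtain rfl := eq_of_heq hf
  obtain rfl : g = g' := funext fun i => eq_of_heq (hg i)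
  rfl

theorem assoc' (M : Multicategory.{u, v}) {n m q : ℕ} {k : Fin n → ℕ} (hm : arity k = m)
    {l : Fin m → ℕ} (hl : arity l = q)
    {l' : ∀ i, Fin (k i) → ℕ} (hll : ∀ i s, l (blk hm i s) = l' i s)
    {r : Fin n → ℕ} (hr : ∀ i, arity (l' i) = r i) (hq : arity r = q)
    {a : Fin n → M.Ob} {b : M.Ob} {c : Fin m → M.Ob} {c' : ∀ i, Fin (k i) → M.Ob}
    (hc : ∀ i s, c (blk hm i s) = c' i s)
    {e : ∀ p, Fin (l p) → M.Ob} {e₂ : ∀ i s, Fin (l' i s) → M.Ob}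
    (he : ∀ i s, e (blk hm i s) ≍ e₂ i s) {e' : ∀ i, Fin (r i) → M.Ob}
    {d : Fin q → M.Ob} (hd : ∀ p t, d (blk hl p t) = e p t)
    (he' : ∀ i s t, e' i (blk (hr i) s t) = e₂ i s t) (hd' : ∀ i u, d (blk hq i u) = e' i u)
    (f : M.Hom a b) (g : ∀ i, M.Hom (c' i) (a i)) (g' : ∀ p, M.Hom (e p) (c p))
    (g₂ : ∀ i s, M.Hom (e₂ i s) (c' i s)) (hg : ∀ i s, g' (blk hm i s) ≍ g₂ i s) :
    M.comp hl hd (M.comp hm hc f g) g' =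
      M.comp hq hd' f (fun i => M.comp (hr i) (he' i) (g i) (g₂ i)) := by
  obtain rfl : (fun i s => l (blk hm i s)) = l' := funext fun i => funext fun s => hll i s
  obtain rfl : (fun i s => c (blk hm i s)) = c' := funext fun i => funext fun s => hc i s
  obtain rfl : (fun i s => e (blk hm i s)) = e₂ :=
    funext fun i => funext fun s => eq_of_heq (he i s)
  obtain rfl : (fun i s => g' (blk hm i s)) = g₂ :=
    funext fun i => funext fun s => eq_of_heq (hg i s)
  exact (M.assoc hm hl hr hq hd he' hd' _ _ _).trans rfl

/-- The composite `g ∘ f` with a unary multimorphism `g`. -/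
def post (M : Multicategory.{u, v}) {n : ℕ} {a : Fin n → M.Ob} {b c : M.Ob}
    (g : M.Hom (fun _ : Fin 1 => b) c) (f : M.Hom a b) : M.Hom a c :=
  M.comp (c := fun _ s => a s) (arity_one_const n) (fun _ _ => by rw [blk_one_const]) g (fun _ => f)

/-- The composite `f ∘ (g 0, …, g (n - 1))` with unary multimorphisms `g i`. -/
def pre (M : Multicategory.{u, v}) {n : ℕ} {a a' : Fin n → M.Ob} {b : M.Ob}
    (f : M.Hom a b) (g : ∀ i, M.Hom (fun _ : Fin 1 => a' i) (a i)) : M.Hom a' b :=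
  M.comp (c := fun i _ => a' i) (arity_const_one n) (fun _ _ => by rw [blk_const_one]) f g

theorem post_id (M : Multicategory.{u, v}) {n : ℕ} {a : Fin n → M.Ob} {b : M.Ob} (f : M.Hom a b) :
    M.post (M.id b) f = f := M.id_comp _ _ f

theorem pre_id (M : Multicategory.{u, v}) {n : ℕ} {a : Fin n → M.Ob} {b : M.Ob} (f : M.Hom a b) :
    M.pre f (fun i => M.id (a i)) = f := M.comp_id _ _ f

theorem post_post (M : Multicategory.{u, v}) {n : ℕ} {a : Fin n → M.Ob} {b c d : M.Ob}
    (g : M.Hom (fun _ : Fin 1 => c) d) (g' : M.Hom (fun _ : Fin 1 => b) c) (f : M.Hom a b) :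
    M.post (M.post g g') f = M.post g (M.post g' f) :=
  M.assoc' _ _ (l' := fun _ _ => n) (fun _ _ => rfl) (fun _ => arity_one_const n) _ _
    (e₂ := fun _ _ => a) (fun _ _ => HEq.rfl) _ (fun _ _ _ => by rw [blk_one_const]) _ _ _ _
    (fun _ _ => f) (fun _ _ => HEq.rfl)

theorem pre_post (M : Multicategory.{u, v}) {n : ℕ} {a a' : Fin n → M.Ob} {b c : M.Ob}
    (g : M.Hom (fun _ : Fin 1 => b) c) (f : M.Hom a b)
    (f' : ∀ i, M.Hom (fun _ : Fin 1 => a' i) (a i)) :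
    M.pre (M.post g f) f' = M.post g (M.pre f f') :=
  M.assoc' _ _ (l' := fun _ _ => 1) (fun _ _ => rfl) (fun _ => arity_const_one n) _ _
    (e₂ := fun _ i _ => a' i) (fun _ _ => by rw [blk_one_const]) _
    (fun _ _ _ => by rw [blk_const_one]) _ _ _ _
    (fun _ i => f' i) (fun _ _ => by rw [blk_one_const])

theorem pre_pre (M : Multicategory.{u, v}) {n : ℕ} {a a' a'' : Fin n → M.Ob} {b : M.Ob}
    (f : M.Hom a b) (g : ∀ i, M.Hom (fun _ : Fin 1 => a' i) (a i))
    (g' : ∀ i, M.Hom (fun _ : Fin 1 => a'' i) (a' i)) :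
    M.pre (M.pre f g) g' = M.pre f (fun i => M.post (g i) (g' i)) :=
  M.assoc' _ _ (l' := fun _ _ => 1) (fun _ _ => rfl) (fun _ => rfl) _ _
    (e₂ := fun i _ _ => a'' i) (fun _ _ => by rw [blk_const_one]) _
    (fun _ _ _ => rfl) _ _ _ _
    (fun i _ => g' i) (fun _ _ => by rw [blk_const_one])

end Multicategory

/-- An operad, as a multicategory with a single object. -/
def Operad.toMulticategory (O : Operad.{w}) : Multicategory.{0, w} where
  Ob := PUnit
  Hom {n} _ _ := O.Op n
  id _ := O.one
  comp h _ _ _ _ _ x y := O.γ h x y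
  id_comp h _ _ _ x := O.one_γ h x
  comp_id h _ _ _ x := O.γ_one h x
  assoc hm _ hl _ hr hq _ _ _ _ _ _ _ _ _ x y z := O.assoc hm hl hr hq x y z

/-- The terminal operad, with a single operation in each arity. -/
def trivialOperad : Operad.{0} where
  Op _ := PUnit
  γ _ _ _ := PUnit.unit
  one := PUnit.unit
  one_γ _ _ := rfl
  γ_one _ _ := rfl
  assoc := by intros; rfl

/-- A multifunctor. -/
@[ext]
structure Multifunctor (M : Multicategory.{u, v}) (N : Multicategory.{u', v'}) where
  obj : M.Ob → N.Ob
  map : ∀ {n : ℕ} {a : Fin n → M.Ob} {b : M.Ob}, M.Hom a b → N.Hom (fun i => obj (a i)) (obj b)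
  map_id : ∀ a, map (M.id a) = N.id (obj a)
  map_comp : ∀ {n m : ℕ} {k : Fin n → ℕ} (h : arity k = m) {a : Fin n → M.Ob} {b : M.Ob}
    {c : ∀ i, Fin (k i) → M.Ob} {d : Fin m → M.Ob} (hd : ∀ i s, d (blk h i s) = c i s)
    (f : M.Hom a b) (g : ∀ i, M.Hom (c i) (a i)),
    map (M.comp h hd f g) = N.comp h (fun i s => congrArg obj (hd i s)) (map f) (fun i => map (g i))

/-- The composite of two multifunctors. -/
def Multifunctor.comp {M : Multicategory.{u, v}} {N : Multicategory.{u', v'}}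
    {P : Multicategory.{u'', v''}} (F : Multifunctor M N) (H : Multifunctor N P) :
    Multifunctor M P where
  obj a := H.obj (F.obj a)
  map f := H.map (F.map f)
  map_id a := by rw [F.map_id, H.map_id]
  map_comp h _ _ _ _ hd f g := by rw [F.map_comp, H.map_comp]

/-- A multinatural transformation: unary multimorphisms `app a` from `F a` to `H a` such that
`app b ∘ F f = H f ∘ (app (a 0), …, app (a (n - 1)))` for each `f` from `a` to `b`. -/
@[ext]
structure MultiNatTrans {M : Multicategory.{u, v}} {N : Multicategory.{u', v'}}
    (F H : Multifunctor M N) where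
  app : ∀ a, N.Hom (fun _ : Fin 1 => F.obj a) (H.obj a)
  naturality : ∀ {n : ℕ} {a : Fin n → M.Ob} {b : M.Ob} (f : M.Hom a b),
    N.post (app b) (F.map f) = N.pre (H.map f) (fun i => app (a i))

/-- Multifunctors and multinatural transformations form a category. -/
instance {M : Multicategory.{u, v}} {N : Multicategory.{u', v'}} : Category (Multifunctor M N) where
  Hom F H := MultiNatTrans F H
  id F :=
    { app a := N.id (F.obj a)
      naturality f := by rw [N.post_id, N.pre_id] }
  comp {F H K} α β :=
    { app a := N.post (β.app a) (α.app a)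
      naturality f := by
        rw [N.post_post, α.naturality, ← N.pre_post, β.naturality, N.pre_pre] }
  id_comp α := MultiNatTrans.ext (funext fun a => N.pre_id (α.app a))
  comp_id α := MultiNatTrans.ext (funext fun a => N.post_id (α.app a))
  assoc α β γ := MultiNatTrans.ext (funext fun a => (N.post_post _ _ _).symm)

@[ext]
theorem Multifunctor.hom_ext {M : Multicategory.{u, v}} {N : Multicategory.{u', v'}}
    {F H : Multifunctor M N} {α β : F ⟶ H} (h : ∀ a, α.app a = β.app a) : α = β :=
  MultiNatTrans.ext (funext h)

theorem Multifunctor.comp_app {M : Multicategory.{u, v}} {N : Multicategory.{u', v'}}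
    {F H K : Multifunctor M N} (α : F ⟶ H) (β : H ⟶ K) (a : M.Ob) :
    (α ≫ β).app a = N.post (β.app a) (α.app a) := rfl

/-- Precomposition with a multifunctor. -/
def Multifunctor.precomp {M : Multicategory.{u, v}} {N : Multicategory.{u', v'}}
    (F : Multifunctor M N) (P : Multicategory.{u'', v''}) :
    Multifunctor N P ⥤ Multifunctor M P where
  obj H := F.comp H
  map α :=
    { app a := α.app (F.obj a)
      naturality f := α.naturality (F.map f) }

/-! ### Symmetric structures -/

section Cross

variable (M : Multicategory.{u, v}) (G : GroupOperad.{w})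

/-- A multimorphism `(f, x)` from `a 0, …, a (n - 1)` to `b` in `M ⋊ G`: an element `x` of `G(n)` and
a multimorphism `f` in `M` from `a (x⁻¹ 0), …, a (x⁻¹ (n - 1))` to `b`. -/
structure CrossHom {n : ℕ} (a : Fin n → M.Ob) (b : M.Ob) where
  elt : G.Op n
  hom : M.Hom (fun i => a ((G.perm elt)⁻¹ i)) b

variable {M G}

namespace CrossHom

/-- The pair `(f, x)`, where the source of `f` is only propositionally equal to
`a (x⁻¹ 0), …, a (x⁻¹ (n - 1))`. -/
def mk' {n : ℕ} {a : Fin n → M.Ob} {b : M.Ob} (x : G.Op n) {a' : Fin n → M.Ob}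
    (h : ∀ i, a' i = a ((G.perm x)⁻¹ i)) (f : M.Hom a' b) : CrossHom M G a b where
  elt := x
  hom := cast (congrArg (fun e => M.Hom e b) (funext h)) f

theorem mk'_hom {n : ℕ} {a : Fin n → M.Ob} {b : M.Ob} (x : G.Op n) {a' : Fin n → M.Ob}
    (h : ∀ i, a' i = a ((G.perm x)⁻¹ i)) (f : M.Hom a' b) : (mk' x h f).hom ≍ f :=
  cast_heq _ _

theorem ext' {n : ℕ} {a : Fin n → M.Ob} {b : M.Ob} {φ ψ : CrossHom M G a b}
    (h : φ.elt = ψ.elt) (h' : φ.hom ≍ ψ.hom) : φ = ψ := by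
  obtain ⟨x, f⟩ := φ
  obtain ⟨x', f'⟩ := ψ
  obtain rfl : x = x' := h
  obtain rfl : f = f' := eq_of_heq h'
  rfl

/-- The composition `γ((f, x); (f_1, x_1), …, (f_n, x_n)) =
(γ(f; f_{x⁻¹(1)}, …, f_{x⁻¹(n)}), γ(x; x_1, …, x_n))` in `M ⋊ G`. -/
def comp {n m : ℕ} {k : Fin n → ℕ} (h : arity k = m) {a : Fin n → M.Ob} {b : M.Ob}
    {c : ∀ i, Fin (k i) → M.Ob} {d : Fin m → M.Ob} (hd : ∀ i s, d (blk h i s) = c i s)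
    (φ : CrossHom M G a b) (ψ : ∀ i, CrossHom M G (c i) (a i)) : CrossHom M G d b where
  elt := G.γ h φ.elt (fun i => (ψ i).elt)
  hom := M.comp (k := fun i => k ((G.perm φ.elt)⁻¹ i)) ((arity_perm k _).trans h)
    (c := fun i s => c ((G.perm φ.elt)⁻¹ i) ((G.perm (ψ ((G.perm φ.elt)⁻¹ i)).elt)⁻¹ s))
    (fun i s => by rw [G.perm_inv_γ h, hd])
    φ.hom (fun i => (ψ ((G.perm φ.elt)⁻¹ i)).hom)

end CrossHom

theorem perm_inv_elt_one {n : ℕ} (i : Fin n) : (G.perm (1 : G.Op n))⁻¹ i = i := by simp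

theorem heq_app {α : Type*} {β : α → Type*} (f : ∀ a, β a) {a a' : α} (h : a = a') : f a ≍ f a' := by
  subst h; rfl

variable (M G)

/-- The multicategory `M ⋊ G`. -/
def cross : Multicategory.{u, max w v} where
  Ob := M.Ob
  Hom a b := CrossHom M G a b
  id a := ⟨G.one, M.id a⟩
  comp h _ _ _ _ hd φ ψ := CrossHom.comp h hd φ ψ
  id_comp {n} h a b ha φ := by
    refine CrossHom.ext' (G.one_γ h _) ?_
    refine HEq.trans ?_ (heq_of_eq (M.post_id φ.hom))
    refine M.comp_heq ?_ rfl ?_ ?_ HEq.rfl ?_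
    · rfl
    · intro i; rfl
    · exact funext fun p => congrArg (fun x => a ((G.perm x)⁻¹ p)) (G.one_γ h φ.elt)
    · intro i; rfl
  comp_id {n} h a b ha φ := by
    refine CrossHom.ext' (G.γ_one h _) ?_
    refine HEq.trans ?_ (heq_of_eq (M.pre_id φ.hom))
    refine M.comp_heq rfl rfl ?_ ?_ HEq.rfl ?_
    · intro i; rfl
    · exact funext fun p => congrArg (fun x => a ((G.perm x)⁻¹ p)) (G.γ_one h φ.elt)
    · intro i; rfl
  assoc {n m q k} hm l hl r hr hq a b c e e' d hd he' hd' φ ψ χ := by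
    refine CrossHom.ext' (G.assoc hm hl hr hq _ _ _) ?_
    have hx := G.assoc hm hl hr hq φ.elt (fun i => (ψ i).elt) (fun p => (χ p).elt)
    have hP := G.perm_inv_γ hm φ.elt (fun i => (ψ i).elt) ((arity_perm k _).trans hm)
    have hr₂ : ∀ i, arity (fun s => l (blk hm ((G.perm φ.elt)⁻¹ i)
        ((G.perm (ψ ((G.perm φ.elt)⁻¹ i)).elt)⁻¹ s))) = r ((G.perm φ.elt)⁻¹ i) :=
      fun i => (arity_perm (fun s => l (blk hm _ s)) _).trans (hr _)
    have hq₂ : arity (fun i => r ((G.perm φ.elt)⁻¹ i)) = q := (arity_perm r _).trans hq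
    refine (heq_of_eq (M.assoc' (k := fun i => k ((G.perm φ.elt)⁻¹ i))
      (l := fun p => l ((G.perm (G.γ hm φ.elt fun i => (ψ i).elt))⁻¹ p)) (l' := fun i s => l (blk hm ((G.perm φ.elt)⁻¹ i)
        ((G.perm (ψ ((G.perm φ.elt)⁻¹ i)).elt)⁻¹ s))) _ _ (fun i s => congrArg l (hP i s))
      (r := fun i => r ((G.perm φ.elt)⁻¹ i)) hr₂ hq₂
      _ (e₂ := fun i s t => e (blk hm ((G.perm φ.elt)⁻¹ i)
        ((G.perm (ψ ((G.perm φ.elt)⁻¹ i)).elt)⁻¹ s)) ((G.perm (χ _).elt)⁻¹ t))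
      (fun i s => heq_app (fun p t => e p ((G.perm (χ p).elt)⁻¹ t)) (hP i s)) 
      (e' := fun i u => e' ((G.perm φ.elt)⁻¹ i) ((G.perm (G.γ (hr _) (ψ ((G.perm φ.elt)⁻¹ i)).elt
        (fun s => (χ (blk hm _ s)).elt)))⁻¹ u)) _ ?_ ?_ _ _
      (fun p => (χ ((G.perm (G.γ hm φ.elt fun i => (ψ i).elt))⁻¹ p)).hom)
      (fun i s => (χ (blk hm ((G.perm φ.elt)⁻¹ i)
        ((G.perm (ψ ((G.perm φ.elt)⁻¹ i)).elt)⁻¹ s))).hom)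
      (fun i s => heq_app (fun p => (χ p).hom) (hP i s)))).trans ?_
    · intro i s t
      rw [G.perm_inv_γ, he']
    · intro i u
      refine (congrArg (fun x => d ((G.perm x)⁻¹ (blk hq₂ i u))) hx).trans ?_
      rw [G.perm_inv_γ hq, hd']
    · refine M.comp_heq rfl rfl (fun _ => HEq.rfl) ?_ HEq.rfl (fun _ => HEq.rfl)
      exact funext fun p => congrArg (fun x => d ((G.perm x)⁻¹ p)) hx

end Cross

/-- A `G`-symmetric structure on a multicategory `M`: an algebra structure over the `2`-monad
`- ⋊ G`, that is, a multifunctor from `M ⋊ G` to `M`, necessarily the identity on objects, which is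
unital and associative with respect to the unit and the multiplication of `G`. -/
class SymmetricStructure (G : GroupOperad.{w}) (M : Multicategory.{u, v}) where
  sym : ∀ {n : ℕ} {a : Fin n → M.Ob} {b : M.Ob}, (cross M G).Hom a b → M.Hom a b
  sym_id : ∀ a, sym ((cross M G).id a) = M.id a
  sym_comp : ∀ {n m : ℕ} {k : Fin n → ℕ} (h : arity k = m) {a : Fin n → M.Ob} {b : M.Ob}
    {c : ∀ i, Fin (k i) → M.Ob} {d : Fin m → M.Ob} (hd : ∀ i s, d (blk h i s) = c i s)
    (φ : (cross M G).Hom a b) (ψ : ∀ i, (cross M G).Hom (c i) (a i)),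
    sym ((cross M G).comp h hd φ ψ) = M.comp h hd (sym φ) (fun i => sym (ψ i))
  sym_one : ∀ {n : ℕ} {a : Fin n → M.Ob} {b : M.Ob} (f : M.Hom a b),
    sym (CrossHom.mk' (1 : G.Op n) (fun _ => by rw [perm_inv_elt_one]) f) = f
  sym_mul : ∀ {n : ℕ} {a : Fin n → M.Ob} {b : M.Ob} (x y : G.Op n)
    (f : M.Hom (fun i => a ((G.perm y)⁻¹ ((G.perm x)⁻¹ i))) b),
    sym ⟨y, sym (⟨x, f⟩ : CrossHom M G (fun i => a ((G.perm y)⁻¹ i)) b)⟩ =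
      sym (CrossHom.mk' (x * y) (fun _ => by rw [G.perm_mul, mul_inv_rev]; rfl) f)

/-- The action of a multifunctor `F` on the multimorphisms of `M ⋊ G`, `(f, x) ↦ (F f, x)`. -/
def Multifunctor.crossMap {M : Multicategory.{u, v}} {N : Multicategory.{u', v'}}
    (F : Multifunctor M N) {G : GroupOperad.{w}} {n : ℕ} {a : Fin n → M.Ob} {b : M.Ob}
    (φ : CrossHom M G a b) : CrossHom N G (fun i => F.obj (a i)) (F.obj b) :=
  ⟨φ.elt, F.map φ.hom⟩

/-- A multifunctor between `G`-symmetric multicategories is `G`-symmetric if it commutes with the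
structure multifunctors `sym`. -/
def Multifunctor.IsSymmetric (G : GroupOperad.{w}) {M : Multicategory.{u, v}}
    {N : Multicategory.{u', v'}} [SymmetricStructure G M] [SymmetricStructure G N] :
    ObjectProperty (Multifunctor M N) := fun F =>
  ∀ {n : ℕ} {a : Fin n → M.Ob} {b : M.Ob} (φ : CrossHom M G a b),
    F.map (SymmetricStructure.sym (M := M) φ) =
      SymmetricStructure.sym (M := N) (F.crossMap φ)

/-- The category of `G`-symmetric multifunctors and multinatural transformations. -/
abbrev SymMultifunctor (G : GroupOperad.{w}) (M : Multicategory.{u, v}) (N : Multicategory.{u', v'})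
    [SymmetricStructure G M] [SymmetricStructure G N] :=
  (Multifunctor.IsSymmetric G (M := M) (N := N)).FullSubcategory

/-- Precomposition of `G`-symmetric multifunctors with a `G`-symmetric multifunctor. -/
def Multifunctor.symPrecomp {G : GroupOperad.{w}} {M : Multicategory.{u, v}}
    {N : Multicategory.{u', v'}} [SymmetricStructure G M] [SymmetricStructure G N]
    (F : Multifunctor M N) (hF : Multifunctor.IsSymmetric G F) (P : Multicategory.{u'', v''})
    [SymmetricStructure G P] : SymMultifunctor G N P ⥤ SymMultifunctor G M P :=
  ObjectProperty.lift _
    ((Multifunctor.IsSymmetric G (M := N) (N := P)).ι ⋙ F.precomp P) (fun H _ _ _ φ =>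
      (congrArg H.obj.map (hF φ)).trans (H.property _))

namespace GroupOperad

variable (G : GroupOperad.{w})

/-- The multiplication makes the one-object multicategory `G` a `G`-symmetric multicategory. -/
instance : SymmetricStructure G G.toMulticategory where
  sym φ := (show G.Op _ from φ.hom) * φ.elt
  sym_id _ := by
    change G.one * G.one = G.one
    rw [G.one_eq, mul_one]
  sym_comp h _ _ _ _ _ φ ψ :=
    (G.mul_γ h φ.hom φ.elt (fun i => (ψ i).hom) (fun i => (ψ i).elt) _).symm
  sym_one f := mul_one (show G.Op _ from f)
  sym_mul x y f := mul_assoc (show G.Op _ from f) x y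

/-- The map of operads from the trivial operad to `G` given by the units `e_n`. -/
def unit : Multifunctor trivialOperad.toMulticategory G.toMulticategory where
  obj _ := PUnit.unit
  map {n} _ _ _ := (1 : G.Op n)
  map_id _ := G.one_eq.symm
  map_comp h _ _ _ _ _ _ _ := (G.γ_one_one h).symm

end GroupOperad

/-- Restriction of `G`-symmetric multifunctors from `G` along the units of `G`. -/
def restrictUnit (G : GroupOperad.{w}) (N : Multicategory.{u, v}) [SymmetricStructure G N] :
    SymMultifunctor G G.toMulticategory N ⥤ Multifunctor trivialOperad.toMulticategory N :=
  (Multifunctor.IsSymmetric G (M := G.toMulticategory) (N := N)).ι ⋙ G.unit.precomp N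


/-! ### The multicategory of a monoidal category -/

section Tensor

variable {C : Type u} [Category.{v} C] [MonoidalCategory C]

/-- The tensor product `X 0 ⊗ (X 1 ⊗ (⋯ ⊗ (X (n - 1) ⊗ 𝟙)))`. -/
def tens : ∀ {n : ℕ}, (Fin n → C) → C
  | 0, _ => 𝟙_ C
  | _ + 1, X => X 0 ⊗ tens (fun i => X i.succ)

/-- The tensor product of a sequence of morphisms. -/
def tensHom : ∀ {n : ℕ} {X Y : Fin n → C}, (∀ i, X i ⟶ Y i) → (tens X ⟶ tens Y)
  | 0, _, _, _ => 𝟙 _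
  | _ + 1, _, _, f => f 0 ⊗ₘ tensHom (fun i => f i.succ)

theorem tensHom_id : ∀ {n : ℕ} (X : Fin n → C), tensHom (fun i => 𝟙 (X i)) = 𝟙 (tens X)
  | 0, _ => rfl
  | n + 1, X => by
    rw [tensHom, tensHom_id]; exact id_tensorHom_id _ _

theorem tensHom_comp : ∀ {n : ℕ} {X Y Z : Fin n → C} (f : ∀ i, X i ⟶ Y i) (g : ∀ i, Y i ⟶ Z i),
    tensHom (fun i => f i ≫ g i) = tensHom f ≫ tensHom g
  | 0, _, _, _, _, _ => (Category.comp_id _).symm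
  | n + 1, X, Y, Z, f, g => by
    simp only [tensHom]; rw [tensHom_comp]; exact (tensorHom_comp_tensorHom _ _ _ _).symm

theorem tensHom_comp_assoc {n : ℕ} {X Y Z : Fin n → C} (f : ∀ i, X i ⟶ Y i) (g : ∀ i, Y i ⟶ Z i)
    {W : C} (h : tens Z ⟶ W) :
    tensHom f ≫ tensHom g ≫ h = tensHom (fun i => f i ≫ g i) ≫ h := by
  rw [tensHom_comp, Category.assoc]

/-- Splitting a tensor product into the tensor product of the first `p` factors and the tensor
product of the other `q` factors. -/
def split : ∀ (q p : ℕ) (d : Fin (q + p) → C),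
    tens d ≅ tens (fun s : Fin p => d (lft q s)) ⊗ tens (fun t : Fin q => d (t.addNat p))
  | _, 0, d => (λ_ (tens d)).symm
  | q, p + 1, d => whiskerLeftIso (d 0) (split q p (fun i => d i.succ)) ≪≫ (α_ _ _ _).symm

/-- Splitting a tensor product of `k 0 + k 1 + ⋯ + k (n - 1)` factors into blocks. -/
def flat : ∀ {n : ℕ} (k : Fin n → ℕ) (d : Fin (arity k) → C),
    tens d ≅ tens (fun i => tens (fun s => d (pos k i s)))
  | 0, _, _ => Iso.refl _
  | _ + 1, k, d => split _ (k 0) d ≪≫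
      whiskerLeftIso _ (flat (fun i => k i.succ) (fun t => d (t.addNat (k 0))))

/-- `flat`, with the total arity replaced by any number equal to it. -/
def blocks {n : ℕ} {k : Fin n → ℕ} : ∀ {m : ℕ} (h : arity k = m) (d : Fin m → C),
    tens d ≅ tens (fun i => tens (fun s => d (blk h i s)))
  | _, rfl, d => flat k d

theorem split_natural_aux {A A' X X' P P' Q Q' : C} (f : A ⟶ A') (g : X ⟶ X') (p : P ⟶ P')
    (q : Q ⟶ Q') (s : X ⟶ P ⊗ Q) (s' : X' ⟶ P' ⊗ Q') (h : g ≫ s' = s ≫ (p ⊗ₘ q)) :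
    (f ⊗ₘ g) ≫ A' ◁ s' ≫ (α_ _ _ _).inv = (A ◁ s ≫ (α_ _ _ _).inv) ≫ ((f ⊗ₘ p) ⊗ₘ q) := by
  rw [← id_tensorHom, tensorHom_comp_tensorHom_assoc, h, Category.assoc, ← associator_inv_naturality,
    ← id_tensorHom, tensorHom_comp_tensorHom_assoc]
  simp

theorem split_natural (q p : ℕ) {d e : Fin (q + p) → C} (φ : ∀ i, d i ⟶ e i) :
    tensHom φ ≫ (split q p e).hom =
      (split q p d).hom ≫ (tensHom (fun s => φ (lft q s)) ⊗ₘ tensHom (fun t => φ (t.addNat p))) := by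
  induction p with
  | zero =>
    have h : ∀ {X Y : C} (f : X ⟶ Y), f ≫ (λ_ Y).inv = (λ_ X).inv ≫ (𝟙 (𝟙_ C) ⊗ₘ f) := by
      intro X Y f; simp
    exact h _
  | succ p ih => exact split_natural_aux _ _ _ _ _ _ (ih (fun i => φ i.succ))

theorem flat_natural_aux {X X' P P' Q Q' R R' : C} (f : X ⟶ X') (p : P ⟶ P') (q : Q ⟶ Q')
    (s : X ⟶ P ⊗ Q) (s' : X' ⟶ P' ⊗ Q') (h : f ≫ s' = s ≫ (p ⊗ₘ q)) (t : Q ⟶ R) (t' : Q' ⟶ R')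
    (r : R ⟶ R') (h' : q ≫ t' = t ≫ r) : f ≫ s' ≫ P' ◁ t' = (s ≫ P ◁ t) ≫ (p ⊗ₘ r) := by
  rw [reassoc_of% h, ← id_tensorHom, tensorHom_comp_tensorHom, h', Category.assoc, ← id_tensorHom,
    tensorHom_comp_tensorHom]
  simp

theorem flat_natural {n : ℕ} (k : Fin n → ℕ) {d e : Fin (arity k) → C} (φ : ∀ i, d i ⟶ e i) :
    tensHom φ ≫ (flat k e).hom =
      (flat k d).hom ≫ tensHom (fun i => tensHom (fun s => φ (pos k i s))) := by
  induction n with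
  | zero => exact (Category.comp_id _).trans (Category.id_comp _).symm
  | succ n ih =>
    exact flat_natural_aux _ _ _ _ _ (split_natural _ (k 0) φ) _ _ _
      (ih (fun i => k i.succ) (fun i => φ (i.addNat (k 0))))

theorem blocks_natural {n m : ℕ} {k : Fin n → ℕ} (h : arity k = m) {d e : Fin m → C}
    (φ : ∀ i, d i ⟶ e i) : tensHom φ ≫ (blocks h e).hom =
      (blocks h d).hom ≫ tensHom (fun i => tensHom (fun s => φ (blk h i s))) := by
  subst h; exact flat_natural k φ

end Tensor

section Functor

open Functor.LaxMonoidal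

variable {C : Type u} [Category.{v} C] [MonoidalCategory C]
variable {D : Type u'} [Category.{v'} D] [MonoidalCategory D] (F : C ⥤ D) [F.LaxMonoidal]

/-- The comparison morphism `F (X 0) ⊗ ⋯ ⊗ F (X (n - 1)) ⟶ F (X 0 ⊗ ⋯ ⊗ X (n - 1))`. -/
def μTens : ∀ {n : ℕ} (X : Fin n → C), tens (fun i => F.obj (X i)) ⟶ F.obj (tens X)
  | 0, _ => ε F
  | _ + 1, X => F.obj (X 0) ◁ μTens (fun i => X i.succ) ≫ μ F _ _

theorem μTens_natural {n : ℕ} {X Y : Fin n → C} (f : ∀ i, X i ⟶ Y i) :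
    tensHom (fun i => F.map (f i)) ≫ μTens F Y = μTens F X ≫ F.map (tensHom f) := by
  induction n with
  | zero => exact (Category.id_comp _).trans ((Category.comp_id _).symm.trans
      (congrArg (ε F ≫ ·) (F.map_id _).symm))
  | succ n ih =>
    have h : ∀ {A A' B B' : C} {T T' : D} (a : A ⟶ A') (b : B ⟶ B') (t : T ⟶ T') (m : T ⟶ F.obj B)
        (m' : T' ⟶ F.obj B'), t ≫ m' = m ≫ F.map b → (F.map a ⊗ₘ t) ≫ F.obj A' ◁ m' ≫ μ F A' B' =
          (F.obj A ◁ m ≫ μ F A B) ≫ F.map (a ⊗ₘ b) := by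
      intro A A' B B' T T' a b t m m' h
      rw [← id_tensorHom, tensorHom_comp_tensorHom_assoc, h, Category.assoc, ← μ_natural,
        ← id_tensorHom, tensorHom_comp_tensorHom_assoc]
      simp
    exact h _ _ _ _ _ (ih (fun i => f i.succ))

theorem μTens_split (q p : ℕ) (d : Fin (q + p) → C) :
    (split q p (fun i => F.obj (d i))).hom ≫ (μTens F (fun s => d (lft q s)) ⊗ₘ
      μTens F (fun t => d (t.addNat p))) ≫ μ F _ _ = μTens F d ≫ F.map (split q p d).hom := by
  induction p with
  | zero =>
    have h : ∀ {T : D} {A : C} (m : T ⟶ F.obj A), (λ_ T).inv ≫ (ε F ⊗ₘ m) ≫ μ F _ _ =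
        m ≫ F.map (λ_ A).inv := by
      intro T A m
      rw [ε_tensorHom_comp_μ]
      simp
    exact h _
  | succ p ih =>
    have h : ∀ {A X P Q : C} {X' P' Q' : D} (x : X' ⟶ F.obj X) (p : P' ⟶ F.obj P) (q : Q' ⟶ F.obj Q)
        (s : X ⟶ P ⊗ Q) (s' : X' ⟶ P' ⊗ Q'), s' ≫ (p ⊗ₘ q) ≫ μ F _ _ = x ≫ F.map s →
        (F.obj A ◁ s' ≫ (α_ _ _ _).inv) ≫ ((F.obj A ◁ p ≫ μ F _ _) ⊗ₘ q) ≫ μ F _ _ =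
          (F.obj A ◁ x ≫ μ F _ _) ≫ F.map (A ◁ s ≫ (α_ _ _ _).inv) := by
      intro A X P Q X' P' Q' x p q s s' h
      have h₁ : ((F.obj A ◁ p ≫ μ F A P) ⊗ₘ q) =
          (F.obj A ◁ p ⊗ₘ q) ≫ (μ F A P ▷ F.obj Q) := by
        rw [← tensorHom_id, tensorHom_comp_tensorHom, Category.comp_id]
      have h₂ : (α_ (F.obj A) P' Q').inv ≫ (F.obj A ◁ p ⊗ₘ q) =
          F.obj A ◁ (p ⊗ₘ q) ≫ (α_ _ _ _).inv := by
        rw [← id_tensorHom, ← id_tensorHom, ← associator_inv_naturality]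
      rw [h₁, Category.assoc, Category.assoc, reassoc_of% h₂, ← associativity_inv, F.map_comp,
        Category.assoc, ← μ_natural_right_assoc, ← whiskerLeft_comp_assoc, ← whiskerLeft_comp_assoc,
        ← whiskerLeft_comp_assoc, ← h]
      simp
    exact h _ _ _ _ _ (ih (fun i => d i.succ))

theorem μTens_flat {n : ℕ} (k : Fin n → ℕ) (d : Fin (arity k) → C) :
    (flat k (fun i => F.obj (d i))).hom ≫ tensHom (fun i => μTens F (fun s => d (pos k i s))) ≫
      μTens F _ = μTens F d ≫ F.map (flat k d).hom := by
  induction n with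
  | zero =>
    have h : ∀ {T : D} {A : C} (m : T ⟶ F.obj A), 𝟙 _ ≫ 𝟙 _ ≫ m = m ≫ F.map (𝟙 A) := by simp
    exact h _
  | succ n ih =>
    have h : ∀ {X P Q R : C} {X' P' Q' R' R'' : D} (x : X' ⟶ F.obj X) (p : P' ⟶ F.obj P)
        (q : Q' ⟶ F.obj Q) (s : X ⟶ P ⊗ Q) (s' : X' ⟶ P' ⊗ Q')
        (t : Q ⟶ R) (t' : Q' ⟶ R') (r' : R' ⟶ R'') (r : R'' ⟶ F.obj R),
        s' ≫ (p ⊗ₘ q) ≫ μ F _ _ = x ≫ F.map s → t' ≫ r' ≫ r = q ≫ F.map t →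
        (s' ≫ P' ◁ t') ≫ (p ⊗ₘ r') ≫ (F.obj P ◁ r ≫ μ F _ _) =
          x ≫ F.map (s ≫ P ◁ t) := by
      intro X P Q R X' P' Q' R' R'' x p q s s' t t' r' r h h'
      have h₁ : P' ◁ t' ≫ (p ⊗ₘ r') ≫ F.obj P ◁ r = (p ⊗ₘ q) ≫ F.obj P ◁ F.map t := by
        rw [← id_tensorHom, ← id_tensorHom, ← id_tensorHom, tensorHom_comp_tensorHom,
          tensorHom_comp_tensorHom, tensorHom_comp_tensorHom, h']
        simp
      rw [F.map_comp, ← reassoc_of% h, ← μ_natural_right, Category.assoc, reassoc_of% h₁]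
    exact h _ _ _ _ _ _ _ _ _ (μTens_split F _ (k 0) d)
      (ih (fun i => k i.succ) (fun t => d (t.addNat (k 0))))

theorem μTens_blocks {n m : ℕ} {k : Fin n → ℕ} (h : arity k = m) (d : Fin m → C) :
    (blocks h (fun i => F.obj (d i))).hom ≫ tensHom (fun i => μTens F (fun s => d (blk h i s))) ≫
      μTens F _ = μTens F d ≫ F.map (blocks h d).hom := by
  subst h; exact μTens_flat F k d

theorem μTens_eqToHom {n : ℕ} {X Y : Fin n → C} (h : X = Y)
    (h' : tens (fun i => F.obj (X i)) = tens (fun i => F.obj (Y i))) (h'' : tens X = tens Y) :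
    eqToHom h' ≫ μTens F Y = μTens F X ≫ F.map (eqToHom h'') := by
  subst h; simp

end Functor

section Coherence

theorem isIso_tensHom {C : Type u} [Category.{v} C] [MonoidalCategory C] {n : ℕ} {X Y : Fin n → C}
    (f : ∀ i, X i ⟶ Y i) (hf : ∀ i, IsIso (f i)) : IsIso (tensHom f) := by
  refine ⟨tensHom (fun i => inv (f i)), ?_, ?_⟩
  · rw [← tensHom_comp, ← tensHom_id]; simp
  · rw [← tensHom_comp, ← tensHom_id]; simp

theorem isIso_μTens {C : Type u} [Category.{v} C] [MonoidalCategory C]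
    {D : Type u'} [Category.{v'} D] [MonoidalCategory D] (F : C ⥤ D) [F.Monoidal] {n : ℕ}
    (X : Fin n → C) : IsIso (μTens F X) := by
  induction n with
  | zero => exact (inferInstance : IsIso (Functor.LaxMonoidal.ε F))
  | succ n ih =>
    have := ih (fun i => X i.succ)
    have h : ∀ {A B : C} {T : D} (f : T ⟶ F.obj B) [IsIso f],
        IsIso (F.obj A ◁ f ≫ Functor.LaxMonoidal.μ F A B) := by
      intros; infer_instance
    exact h (μTens F (fun i => X i.succ))

variable {C : Type u} [Category.{v} C] [MonoidalCategory C]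

theorem tens_congr {n : ℕ} {X Y : Fin n → C} (h : ∀ i, X i = Y i) : tens X = tens Y :=
  congrArg tens (funext h)

section

variable {E : Type u'} [Category.{v'} E] [MonoidalCategory E] (F : E ⥤ C)

theorem blocks_blocks_aux₁ [F.LaxMonoidal] {n m q : ℕ} {k : Fin n → ℕ} (hm : arity k = m)
    {l : Fin m → ℕ} (hl : arity l = q) (X : Fin q → E) :
    ((blocks hl (fun p => F.obj (X p))).hom ≫
        (blocks hm (fun p => tens fun t => F.obj (X (blk hl p t)))).hom) ≫
      tensHom (fun i => tensHom fun s => μTens F (fun t => X (blk hl (blk hm i s) t))) ≫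
      tensHom (fun i => μTens F _) ≫ μTens F _ =
    μTens F X ≫ F.map ((blocks hl X).hom ≫
      (blocks hm (fun p => tens fun t => X (blk hl p t))).hom) := by
  rw [F.map_comp, ← reassoc_of% (μTens_blocks F hl X), ← μTens_blocks,
    reassoc_of% (blocks_natural hm (fun p => μTens F (fun t => X (blk hl p t)))), Category.assoc]

theorem blocks_blocks_aux₂ [F.LaxMonoidal] {n m q : ℕ} {k : Fin n → ℕ} (hm : arity k = m)
    {l : Fin m → ℕ} (hl : arity l = q) {r : Fin n → ℕ}
    (hr : ∀ i, arity (fun s => l (blk hm i s)) = r i) (hq : arity r = q) (X : Fin q → E) :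
    ((blocks hq (fun p => F.obj (X p))).hom ≫
      tensHom (fun i => (blocks (hr i) (fun u => F.obj (X (blk hq i u)))).hom ≫
        tensHom (fun s => eqToHom (tens_congr fun t =>
          congrArg (fun p => F.obj (X p)) (blk_assoc hm hl hr hq i s t))))) ≫
      tensHom (fun i => tensHom fun s => μTens F (fun t => X (blk hl (blk hm i s) t))) ≫
      tensHom (fun i => μTens F _) ≫ μTens F _ =
    μTens F X ≫ F.map ((blocks hq X).hom ≫
      tensHom (fun i => (blocks (hr i) (fun u => X (blk hq i u))).hom ≫
        tensHom (fun s => eqToHom (tens_congr fun t =>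
          congrArg X (blk_assoc hm hl hr hq i s t))))) := by
  have h : ∀ i, ((blocks (hr i) (fun u => F.obj (X (blk hq i u)))).hom ≫
        tensHom (fun s => eqToHom (tens_congr fun t =>
          congrArg (fun p => F.obj (X p)) (blk_assoc hm hl hr hq i s t)))) ≫
        (tensHom fun s => μTens F (fun t => X (blk hl (blk hm i s) t))) ≫ μTens F _ =
      μTens F (fun u => X (blk hq i u)) ≫ F.map ((blocks (hr i) (fun u => X (blk hq i u))).hom ≫
        tensHom (fun s => eqToHom (tens_congr fun t =>
          congrArg X (blk_assoc hm hl hr hq i s t)))) := by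
    intro i
    rw [F.map_comp, ← Category.assoc (μTens F _), ← μTens_blocks, Category.assoc, Category.assoc,
      Category.assoc, ← μTens_natural, ← Category.assoc (tensHom _), ← Category.assoc (tensHom _),
      ← tensHom_comp, ← tensHom_comp]
    congr 4
    funext s
    exact μTens_eqToHom F (funext fun t => congrArg X (blk_assoc hm hl hr hq i s t)) _ _
  rw [F.map_comp, ← Category.assoc (μTens F X), ← μTens_blocks, Category.assoc, Category.assoc,
    Category.assoc, ← μTens_natural, tensHom_comp_assoc, tensHom_comp_assoc, tensHom_comp_assoc]
  congr 3
  funext i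
  rw [← h]
  simp only [Category.assoc]

end

/-- Splitting into blocks in two steps does not depend on the order of the steps. -/
theorem blocks_blocks {n m q : ℕ} {k : Fin n → ℕ} (hm : arity k = m) {l : Fin m → ℕ}
    (hl : arity l = q) {r : Fin n → ℕ} (hr : ∀ i, arity (fun s => l (blk hm i s)) = r i)
    (hq : arity r = q) (d : Fin q → C) :
    (blocks hl d).hom ≫ (blocks hm (fun p => tens fun t => d (blk hl p t))).hom =
      (blocks hq d).hom ≫ tensHom (fun i => (blocks (hr i) (fun u => d (blk hq i u))).hom ≫
        tensHom (fun s => eqToHom (tens_congr fun t =>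
          congrArg d (blk_assoc hm hl hr hq i s t)))) := by
  let F := FreeMonoidalCategory.project d
  let X : Fin q → FreeMonoidalCategory (Fin q) := FreeMonoidalCategory.of
  let ψ : tens (fun i => tens fun s => tens fun t => F.obj (X (blk hl (blk hm i s) t))) ⟶
      F.obj (tens (fun i => tens fun s => tens fun t => X (blk hl (blk hm i s) t))) :=
    tensHom (fun i => tensHom fun s => μTens F (fun t => X (blk hl (blk hm i s) t))) ≫
      tensHom (fun i => μTens F _) ≫ μTens F _
  have hψ : IsIso ψ :=
    @IsIso.comp_isIso _ _ _ _ _ _ _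
      (isIso_tensHom _ fun i => isIso_tensHom _ fun s => isIso_μTens F _)
      (@IsIso.comp_isIso _ _ _ _ _ _ _ (isIso_tensHom _ fun i => isIso_μTens F _) (isIso_μTens F _))
  have h₁ := blocks_blocks_aux₁ F hm hl X
  have h₂ := blocks_blocks_aux₂ F hm hl hr hq X
  exact (cancel_mono ψ).1 (h₁.trans ((congrArg (fun f => μTens F X ≫ F.map f)
    (Subsingleton.elim _ _)).trans h₂.symm))

theorem tensHom_eqToHom {n : ℕ} {X Y : Fin n → C} (h : ∀ i, X i = Y i) :
    tensHom (fun i => eqToHom (h i)) = eqToHom (tens_congr h) := by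
  obtain rfl : X = Y := funext h
  exact tensHom_id X

/-- The isomorphism from a tensor product with a single factor to this factor. -/
def tensOne (A : C) : tens (fun _ : Fin 1 => A) ⟶ A := (ρ_ A).hom

theorem μTens_one {E : Type u'} [Category.{v'} E] [MonoidalCategory E] (F : E ⥤ C) [F.LaxMonoidal]
    (A : E) : μTens F (fun _ : Fin 1 => A) ≫ F.map (tensOne A) = tensOne (F.obj A) :=
  (Category.assoc _ _ _).trans (Functor.LaxMonoidal.right_unitality F A).symm

theorem tensHom_one {A B : C} (f : A ⟶ B) :
    tensHom (fun _ : Fin 1 => f) ≫ tensOne B = tensOne A ≫ f := by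
  have h : (f ⊗ₘ 𝟙 (𝟙_ C)) ≫ (ρ_ B).hom = (ρ_ A).hom ≫ f := by simp
  exact h

theorem blocks_one_const_aux {E : Type u'} [Category.{v'} E] [MonoidalCategory E] (F : E ⥤ C)
    [F.LaxMonoidal] {n : ℕ} (h : arity (fun _ : Fin 1 => n) = n) (X : Fin n → E) :
    ((blocks h (fun i => F.obj (X i))).hom ≫ tensHom (fun _ : Fin 1 => eqToHom (tens_congr
      fun s => by rw [blk_one_const])) ≫ tensOne (tens (fun i => F.obj (X i)))) ≫ μTens F X =
    μTens F X ≫ F.map ((blocks h X).hom ≫ tensHom (fun _ : Fin 1 => eqToHom (tens_congr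
      fun s => by rw [blk_one_const])) ≫ tensOne (tens X)) := by
  rw [F.map_comp, F.map_comp, ← reassoc_of% (μTens_blocks F h X),
    ← reassoc_of% (μTens_natural F), μTens_one]
  have e : tensOne (tens (fun i => F.obj (X i))) ≫ μTens F X =
      tensHom (fun _ : Fin 1 => μTens F X) ≫ tensOne _ := (tensHom_one _).symm
  simp only [Category.assoc]
  rw [e, tensHom_comp_assoc, tensHom_comp_assoc]
  congr 3
  funext i
  exact μTens_eqToHom F (funext fun s => by rw [blk_one_const]) _ _

theorem blocks_one_const {n : ℕ} (h : arity (fun _ : Fin 1 => n) = n) (a : Fin n → C) :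
    (blocks h a).hom ≫ tensHom (fun _ : Fin 1 => eqToHom (tens_congr fun s => by
      rw [blk_one_const])) ≫ tensOne (tens a) = 𝟙 _ := by
  let F := FreeMonoidalCategory.project a
  let X : Fin n → FreeMonoidalCategory (Fin n) := FreeMonoidalCategory.of
  have h₁ := blocks_one_const_aux F h X
  have : IsIso (μTens F X) := isIso_μTens F X
  refine (cancel_mono (μTens F X)).1 (h₁.trans ((congrArg (fun f => μTens F X ≫ F.map f)
    (Subsingleton.elim _ (𝟙 _))).trans ?_))
  rw [F.map_id, Category.comp_id]
  exact (Category.id_comp _).symm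

theorem blocks_const_one_aux {E : Type u'} [Category.{v'} E] [MonoidalCategory E] (F : E ⥤ C)
    [F.LaxMonoidal] {n : ℕ} (h : arity (fun _ : Fin n => 1) = n) (X : Fin n → E) :
    ((blocks h (fun i => F.obj (X i))).hom ≫ tensHom (fun i => eqToHom (tens_congr (n := 1)
      (Y := fun _ => F.obj (X i)) fun s => by rw [blk_const_one]) ≫ tensOne _)) ≫ μTens F X =
    μTens F X ≫ F.map ((blocks h X).hom ≫ tensHom (fun i => eqToHom (tens_congr (n := 1)
      (Y := fun _ => X i) fun s => by rw [blk_const_one]) ≫ tensOne _)) := by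
  rw [F.map_comp, ← reassoc_of% (μTens_blocks F h X), ← μTens_natural, tensHom_comp_assoc,
    Category.assoc]
  congr 3
  funext i
  rw [F.map_comp, ← reassoc_of% (μTens_eqToHom F (n := 1) (Y := fun _ => X i)
    (funext fun s => by rw [blk_const_one])), μTens_one]

theorem blocks_const_one {n : ℕ} (h : arity (fun _ : Fin n => 1) = n) (a : Fin n → C) :
    (blocks h a).hom ≫ tensHom (fun i => eqToHom (tens_congr (n := 1)
      (Y := fun _ => a i) fun s => by rw [blk_const_one]) ≫ tensOne _) = 𝟙 _ := by
  let F := FreeMonoidalCategory.project a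
  let X : Fin n → FreeMonoidalCategory (Fin n) := FreeMonoidalCategory.of
  have h₁ := blocks_const_one_aux F h X
  have : IsIso (μTens F X) := isIso_μTens F X
  refine (cancel_mono (μTens F X)).1 (h₁.trans ((congrArg (fun f => μTens F X ≫ F.map f)
    (Subsingleton.elim _ (𝟙 _))).trans ?_))
  rw [F.map_id, Category.comp_id]
  exact (Category.id_comp _).symm

end Coherence

/-- The multicategory of a monoidal category. -/
def ofMonoidal (C : Type u) [Category.{v} C] [MonoidalCategory C] : Multicategory.{u, v} where
  Ob := C
  Hom a b := tens a ⟶ b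
  id a := tensOne a
  comp h _ _ _ d hd f g :=
    (blocks h d).hom ≫ tensHom (fun i => eqToHom (tens_congr (hd i)) ≫ g i) ≫ f
  id_comp h a b ha f := by
    rw [tensHom_comp, Category.assoc, tensHom_one, reassoc_of% (blocks_one_const h a)]
  comp_id h a b ha f := by
    rw [reassoc_of% (blocks_const_one h a)]
  assoc {n m q k} hm {l} hl {r} hr hq a b c e e' d hd he' hd' f g g' := by
    obtain rfl : (fun p t => d (blk hl p t)) = e := funext fun p => funext (hd p)
    obtain rfl : (fun i u => d (blk hq i u)) = e' := funext fun i => funext (hd' i)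
    simp only [eqToHom_refl, Category.id_comp]
    rw [← Category.assoc (tensHom _) (blocks _ _).hom, blocks_natural, Category.assoc,
      ← Category.assoc (blocks hl d).hom, blocks_blocks hm hl hr hq, ← Category.assoc (tensHom _) _ f, ← tensHom_comp,
      Category.assoc, ← Category.assoc (tensHom _) _ f, ← tensHom_comp]
    congr 3
    funext i
    rw [tensHom_comp]
    simp only [Category.assoc]

section FunctorMultifunctor

variable {C : Type u} [Category.{v} C] [MonoidalCategory C]
variable {D : Type u'} [Category.{v'} D] [MonoidalCategory D]

theorem multifunctorOf_aux (F : C ⥤ D) [F.LaxMonoidal] {n m : ℕ} {k : Fin n → ℕ} (h : arity k = m)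
    {a : Fin n → C} {b : C} {d : Fin m → C} (f : tens a ⟶ b)
    (g : ∀ i, tens (fun s => d (blk h i s)) ⟶ a i) :
    μTens F d ≫ F.map ((blocks h d).hom ≫ tensHom (fun i => 𝟙 _ ≫ g i) ≫ f) =
      (blocks h (fun p => F.obj (d p))).hom ≫ tensHom (fun i => 𝟙 _ ≫ μTens F _ ≫ F.map (g i)) ≫
        μTens F a ≫ F.map f := by
  simp only [Category.id_comp]
  rw [F.map_comp, F.map_comp, ← reassoc_of% (μTens_blocks F h d), ← reassoc_of% (μTens_natural F),
    tensHom_comp_assoc]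

/-- The multifunctor of a (lax) monoidal functor. -/
def multifunctorOf (F : C ⥤ D) [F.LaxMonoidal] : Multifunctor (ofMonoidal C) (ofMonoidal D) where
  obj a := F.obj a
  map {n a b} f := μTens F (show Fin n → C from a) ≫ F.map f
  map_id a := μTens_one F a
  map_comp h a b c d hd f g := by
    obtain rfl : (fun i s => d (blk h i s)) = c := funext fun i => funext (hd i)
    exact multifunctorOf_aux F h f g

theorem multiNatTransOf_aux₁ {F H : C ⥤ D} [F.LaxMonoidal] [H.LaxMonoidal] (α : F ⟶ H)
    [NatTrans.IsMonoidal α] {n : ℕ} (X : Fin n → C) :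
    tensHom (fun i => α.app (X i)) ≫ μTens H X = μTens F X ≫ α.app (tens X) := by
  induction n with
  | zero => exact (Category.id_comp _).trans (NatTrans.IsMonoidal.unit (τ := α)).symm
  | succ n ih =>
    have h : ∀ {A B : C} {T T' : D} (t : T ⟶ T') (m : T ⟶ F.obj B) (m' : T' ⟶ H.obj B),
        t ≫ m' = m ≫ α.app B →
        (α.app A ⊗ₘ t) ≫ H.obj A ◁ m' ≫ Functor.LaxMonoidal.μ H A B =
          (F.obj A ◁ m ≫ Functor.LaxMonoidal.μ F A B) ≫ α.app (A ⊗ B) := by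
      intro A B T T' t m m' h
      rw [Category.assoc, NatTrans.IsMonoidal.tensor, ← id_tensorHom, ← id_tensorHom,
        tensorHom_comp_tensorHom_assoc, tensorHom_comp_tensorHom_assoc, h]
      simp
    exact h _ _ _ (ih (fun i => X i.succ))

theorem multiNatTransOf_aux₂ {n : ℕ} {a : Fin n → D} {b c : D} (f : tens a ⟶ b) (g : b ⟶ c) :
    (ofMonoidal D).post (tensOne b ≫ g) f = f ≫ g := by
  change (blocks _ _).hom ≫ tensHom (fun _ : Fin 1 => eqToHom _ ≫ f) ≫ tensOne b ≫ g = _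
  rw [tensHom_comp, Category.assoc, reassoc_of% (tensHom_one f),
    reassoc_of% (blocks_one_const (arity_one_const n) a)]

theorem multiNatTransOf_aux₃ {n : ℕ} {a a' : Fin n → D} {b : D} (f : tens a ⟶ b)
    (g : ∀ i, a' i ⟶ a i) :
    (ofMonoidal D).pre f (fun i => tensOne (a' i) ≫ g i) = tensHom g ≫ f := by
  change (blocks _ _).hom ≫ tensHom (fun i => eqToHom _ ≫ tensOne (a' i) ≫ g i) ≫ f = _
  have e : (tensHom fun i => eqToHom (tens_congr (n := 1)
      (X := fun s => a' (blk (arity_const_one n) i s))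
      (Y := fun _ => a' i) fun s => by rw [blk_const_one]) ≫ tensOne (a' i) ≫ g i) =
      (tensHom fun i => eqToHom (tens_congr (n := 1)
      (X := fun s => a' (blk (arity_const_one n) i s))
      (Y := fun _ => a' i) fun s => by rw [blk_const_one]) ≫ tensOne (a' i)) ≫ tensHom g := by
    rw [← tensHom_comp]; simp only [Category.assoc]
  rw [e, Category.assoc, reassoc_of% (blocks_const_one (arity_const_one n) a')]

theorem multiNatTransOf_aux₄ {F H : C ⥤ D} [F.LaxMonoidal] [H.LaxMonoidal] (α : F ⟶ H)
    [NatTrans.IsMonoidal α] {n : ℕ} {X : Fin n → C} {b : C} (f : tens X ⟶ b) :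
    (μTens F X ≫ F.map f) ≫ α.app b = tensHom (fun i => α.app (X i)) ≫ μTens H X ≫ H.map f := by
  rw [Category.assoc, α.naturality, ← Category.assoc, ← multiNatTransOf_aux₁, Category.assoc]

/-- The multinatural transformation of a monoidal natural transformation. -/
def multiNatTransOf {F H : C ⥤ D} [F.LaxMonoidal] [H.LaxMonoidal] (α : F ⟶ H)
    [NatTrans.IsMonoidal α] : multifunctorOf F ⟶ multifunctorOf H :=
  (show MultiNatTrans (multifunctorOf F) (multifunctorOf H) from
  { app a := tensOne (F.obj a) ≫ α.app a
    naturality {n a b} f := by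
      refine (multiNatTransOf_aux₂ (μTens F (show Fin n → C from a) ≫ F.map f) (α.app b)).trans
        (Eq.trans ?_ (multiNatTransOf_aux₃ (μTens H (show Fin n → C from a) ≫ H.map f)
          (fun i => α.app (a i))).symm)
      exact multiNatTransOf_aux₄ α (X := a) f })

end FunctorMultifunctor

/-! ### Symmetric monoidal categories and functors -/

/-- A `G`-symmetric structure on a monoidal category `C`: a `G`-symmetric structure on the
multicategory of `C`. -/
abbrev SymmetricMonoidal (G : GroupOperad.{w}) (C : Type u) [Category.{v} C] [MonoidalCategory C] :=
  SymmetricStructure G (ofMonoidal C)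

section SymMonoidal

variable (G : GroupOperad.{w}) (C : Type u) [Category.{v} C] [MonoidalCategory C]
  (D : Type u') [Category.{v'} D] [MonoidalCategory D] [SymmetricMonoidal G C] [SymmetricMonoidal G D]

/-- A `G`-symmetric monoidal functor: a (strong) monoidal functor whose multifunctor is
`G`-symmetric. -/
structure SymMonoidalFunctor where
  toFunctor : C ⥤ D
  monoidal : toFunctor.Monoidal
  isSymmetric : Multifunctor.IsSymmetric G (multifunctorOf toFunctor)

attribute [instance] SymMonoidalFunctor.monoidal

variable {G C D}

/-- A monoidal natural transformation between `G`-symmetric monoidal functors. -/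
@[ext]
structure SymMonoidalFunctor.Hom (F H : SymMonoidalFunctor G C D) where
  hom : F.toFunctor ⟶ H.toFunctor
  isMonoidal : NatTrans.IsMonoidal hom

attribute [instance] SymMonoidalFunctor.Hom.isMonoidal

/-- `G`-symmetric monoidal functors and monoidal natural transformations form a category. -/
instance : Category (SymMonoidalFunctor G C D) where
  Hom F H := SymMonoidalFunctor.Hom F H
  id F := ⟨𝟙 F.toFunctor, inferInstance⟩
  comp α β := ⟨α.hom ≫ β.hom, inferInstance⟩
  id_comp α := SymMonoidalFunctor.Hom.ext (Category.id_comp α.hom)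
  comp_id α := SymMonoidalFunctor.Hom.ext (Category.comp_id α.hom)
  assoc α β γ := SymMonoidalFunctor.Hom.ext (Category.assoc α.hom β.hom γ.hom)

variable (G C D)

/-- The functor sending a `G`-symmetric monoidal functor to its `G`-symmetric multifunctor. -/
def toSymMultifunctor :
    SymMonoidalFunctor G C D ⥤ SymMultifunctor G (ofMonoidal C) (ofMonoidal D) where
  obj F := ⟨multifunctorOf F.toFunctor, F.isSymmetric⟩
  map {F H} α := ObjectProperty.homMk (multiNatTransOf (show SymMonoidalFunctor.Hom F H from α).hom)
  map_id F := by
    apply ObjectProperty.hom_ext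
    apply Multifunctor.hom_ext
    intro a
    exact Category.comp_id _
  map_comp {F H K} α β := by
    apply ObjectProperty.hom_ext
    apply Multifunctor.hom_ext
    intro a
    let α' : SymMonoidalFunctor.Hom F H := α
    let β' : SymMonoidalFunctor.Hom H K := β
    refine Eq.trans ?_ (multiNatTransOf_aux₂ (tensOne (F.toFunctor.obj a) ≫ α'.hom.app a)
      (β'.hom.app a)).symm
    exact (Category.assoc _ _ _).symm

end SymMonoidal


/-! ### Crossed groups -/

/-- A crossed `A`-group: a presheaf `X` over `A`, with `res φ x = φ^*(x)`, together with a group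
structure on each `X(a)` and left actions `act x φ = φ^x` of `X(a)` on the set of morphisms from `b`
to `a`, such that `(φψ)^x = φ^x ψ^{φ^*(x)}` and `φ^*(xy) = (φ^y)^*(x) φ^*(y)`. -/
structure CrossedGroup (A : Type u) [Category.{v} A] where
  obj : A → Type w
  group : ∀ a, Group (obj a)
  res : ∀ {b a : A}, (b ⟶ a) → obj a → obj b
  res_id : ∀ {a : A} (x : obj a), res (𝟙 a) x = x
  res_comp : ∀ {c b a : A} (ψ : c ⟶ b) (φ : b ⟶ a) (x : obj a), res (ψ ≫ φ) x = res ψ (res φ x)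
  act : ∀ {b a : A}, obj a → (b ⟶ a) → (b ⟶ a)
  act_one : ∀ {b a : A} (φ : b ⟶ a), act 1 φ = φ
  act_mul : ∀ {b a : A} (x y : obj a) (φ : b ⟶ a), act (x * y) φ = act x (act y φ)
  act_comp : ∀ {c b a : A} (ψ : c ⟶ b) (φ : b ⟶ a) (x : obj a),
    act x (ψ ≫ φ) = act (res φ x) ψ ≫ act x φ
  res_mul : ∀ {b a : A} (φ : b ⟶ a) (x y : obj a), res φ (x * y) = res (act y φ) x * res φ y

attribute [instance] CrossedGroup.group

namespace CrossedGroup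

variable {A : Type u} [Category.{v} A] (X : CrossedGroup.{w} A)

theorem act_id {a : A} (x : X.obj a) : X.act x (𝟙 a) = 𝟙 a := by
  have h := X.act_comp (X.act x⁻¹ (𝟙 a)) (𝟙 a) x
  rw [Category.comp_id, X.res_id, ← X.act_mul, mul_inv_cancel, X.act_one, Category.id_comp] at h
  exact h.symm

theorem res_one {b a : A} (φ : b ⟶ a) : X.res φ 1 = 1 := by
  have h := X.res_mul φ 1 1
  rw [mul_one, X.act_one] at h
  exact left_eq_mul.1 h

/-- The objects of the total category of a crossed group. -/
structure Total (X : CrossedGroup.{w} A) where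
  of : A

/-- A morphism `(map, elt)` of the total category of a crossed group. -/
@[ext]
structure TotalHom (X : CrossedGroup.{w} A) (a b : A) where
  map : a ⟶ b
  elt : X.obj a

/-- The total category of a crossed group, with composition
`(φ, x) ∘ (ψ, y) = (φ ψ^x, ψ^*(x) y)`. -/
instance : Category X.Total where
  Hom a b := TotalHom X a.of b.of
  id a := ⟨𝟙 a.of, 1⟩
  comp f g := ⟨X.act g.elt f.map ≫ g.map, X.res f.map g.elt * f.elt⟩
  id_comp f := TotalHom.ext (by simp [X.act_id]) (by simp [X.res_id])
  comp_id f := TotalHom.ext (by simp [X.act_one]) (by simp [X.res_one])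
  assoc f g h := TotalHom.ext (by simp [X.act_comp, X.act_mul])
    (by simp [X.res_comp, X.res_mul, mul_assoc])

end CrossedGroup

/-! ### Finite ordinals -/

section Fib

/-- The number of elements of the fibre of `φ` over `j`. -/
def fib {m n : ℕ} (φ : Fin m → Fin n) (j : Fin n) : ℕ := (Finset.univ.filter fun i => φ i = j).card

theorem arity_fib {m n : ℕ} (φ : Fin m → Fin n) : arity (fib φ) = m := by
  rw [arity_eq_sum]
  have := Finset.card_eq_sum_card_fiberwise (f := φ) (s := Finset.univ) (t := Finset.univ)
    (fun _ _ => Finset.mem_coe.2 (Finset.mem_univ _))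
  simpa [fib] using this.symm

theorem mem_iff_lt_card {m : ℕ} (S : Finset (Fin m)) (hS : ∀ i j, i ≤ j → j ∈ S → i ∈ S) (i : Fin m) :
    i ∈ S ↔ (i : ℕ) < S.card := by
  constructor
  · intro hi
    have h : Finset.Iic i ⊆ S := fun j hj => hS j i (Finset.mem_Iic.1 hj) hi
    have := Finset.card_le_card h
    rw [Fin.card_Iic] at this
    omega
  · intro hi
    by_contra hn
    have h : S ⊆ Finset.Iio i := fun j hj => Finset.mem_Iio.2 (by
      by_contra hh
      exact hn (hS i j (not_lt.1 hh) hj))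
    have := Finset.card_le_card h
    rw [Fin.card_Iio] at this
    omega

theorem lt_iff_fib {m n : ℕ} (φ : Fin m → Fin n) (hφ : Monotone φ) (i : Fin m) (j : Fin n) :
    φ i < j ↔ (i : ℕ) < ∑ l ∈ Finset.Iio j, fib φ l := by
  have h := mem_iff_lt_card (Finset.univ.filter fun i => φ i < j)
    (fun i i' h h' => by
      simp only [Finset.mem_filter, Finset.mem_univ, true_and] at h' ⊢
      exact (hφ h).trans_lt h') i
  have h2 := Finset.card_eq_sum_card_fiberwise (f := φ) (s := Finset.univ.filter fun i => φ i < j)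
    (t := Finset.Iio j) (fun i hi => by simpa using hi)
  have h3 : ∑ l ∈ Finset.Iio j, fib φ l = (Finset.univ.filter fun i => φ i < j).card := by
    rw [h2]
    refine Finset.sum_congr rfl fun l hl => congrArg Finset.card ?_
    ext p
    simp only [Finset.mem_filter, Finset.mem_univ, true_and]
    constructor
    · rintro rfl
      exact ⟨Finset.mem_Iio.1 hl, rfl⟩
    · exact fun h => h.2
  rw [h3, ← h]
  simp

/-- A monotone map is determined by the sizes of its fibres. -/
theorem eq_of_fib {m n : ℕ} {φ ψ : Fin m → Fin n} (hφ : Monotone φ) (hψ : Monotone ψ)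
    (h : ∀ j, fib φ j = fib ψ j) : φ = ψ := by
  have key : ∀ i j, φ i < j ↔ ψ i < j := by
    intro i j
    rw [lt_iff_fib φ hφ, lt_iff_fib ψ hψ]
    simp only [h]
  funext i
  refine le_antisymm ?_ ?_
  · by_contra hh
    exact lt_irrefl _ ((key i (φ i)).2 (not_le.1 hh))
  · by_contra hh
    exact lt_irrefl _ ((key i (ψ i)).1 (not_le.1 hh))

/-- The monotone map from `{1, …, m}` to `{1, …, n}` with fibres of sizes `k 0, …, k (n - 1)`. -/
noncomputable def ofFib {m n : ℕ} {k : Fin n → ℕ} (h : arity k = m) : Fin m →o Fin n where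
  toFun p := ((blkEquiv h).symm p).1
  monotone' p q hpq := by
    obtain ⟨i, s, rfl⟩ := blk_surj h p
    obtain ⟨j, t, rfl⟩ := blk_surj h q
    simp only [blkEquiv_symm_blk]
    by_contra hh
    exact absurd (blk_lt h t s (not_le.1 hh)) (not_lt.2 hpq)

theorem ofFib_blk {m n : ℕ} {k : Fin n → ℕ} (h : arity k = m) (i : Fin n) (s : Fin (k i)) :
    ofFib h (blk h i s) = i := by
  change ((blkEquiv h).symm (blk h i s)).1 = i
  rw [blkEquiv_symm_blk]

theorem sum_ofFib {m n : ℕ} {k : Fin n → ℕ} (h : arity k = m) (g : Fin m → ℕ) (j : Fin n) :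
    ∑ p with ofFib h p = j, g p = arity (fun s => g (blk h j s)) := by
  rw [arity_eq_sum]
  symm
  refine Finset.sum_bij (fun s _ => blk h j s) ?_ ?_ ?_ ?_
  · intro s _; simp [ofFib_blk]
  · intro s _ t _ hst
    have := blk_inj h (a₁ := ⟨j, s⟩) (a₂ := ⟨j, t⟩) hst
    cases this; rfl
  · intro p hp
    obtain ⟨i, s, rfl⟩ := blk_surj h p
    simp only [Finset.mem_filter, Finset.mem_univ, true_and, ofFib_blk] at hp
    subst hp
    exact ⟨s, Finset.mem_univ _, rfl⟩
  · intro _ _; rfl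

theorem fib_ofFib {m n : ℕ} {k : Fin n → ℕ} (h : arity k = m) (j : Fin n) : fib (ofFib h) j = k j := by
  have := sum_ofFib h (fun _ => 1) j
  rw [arity_const_one] at this
  rw [← this, fib, Finset.card_eq_sum_ones]

theorem fib_comp_ofFib {q m n : ℕ} {k : Fin n → ℕ} (h : arity k = m) (ψ : Fin q → Fin m) (j : Fin n) :
    fib (fun p => ofFib h (ψ p)) j = arity (fun s => fib ψ (blk h j s)) := by
  rw [← sum_ofFib h (fun i => fib ψ i) j, fib]
  have h2 := Finset.card_eq_sum_card_fiberwise (f := ψ)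
    (s := Finset.univ.filter fun p => ofFib h (ψ p) = j)
    (t := Finset.univ.filter fun i => ofFib h i = j) (fun i hi => by simpa using hi)
  rw [h2]
  refine Finset.sum_congr rfl fun l hl => congrArg Finset.card ?_
  ext p
  simp only [Finset.mem_filter, Finset.mem_univ, true_and] at hl ⊢
  constructor
  · exact fun h => h.2
  · rintro rfl
    exact ⟨hl, rfl⟩

theorem eq_ofFib {m n : ℕ} (φ : Fin m →o Fin n) {k : Fin n → ℕ} (h : arity k = m)
    (hk : ∀ j, fib φ j = k j) : φ = ofFib h :=
  OrderHom.ext _ _ (eq_of_fib φ.monotone (ofFib h).monotone fun j => (hk j).trans (fib_ofFib h j).symm)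

theorem fib_comp {q m n : ℕ} (φ : Fin m →o Fin n) (ψ : Fin q → Fin m) {k : Fin n → ℕ}
    (h : arity k = m) (hk : ∀ j, fib φ j = k j) (j : Fin n) :
    fib (fun p => φ (ψ p)) j = arity (fun s => fib ψ (blk h j s)) := by
  obtain rfl := eq_ofFib φ h hk
  exact fib_comp_ofFib h ψ j

theorem fib_id {m : ℕ} (j : Fin m) : fib (fun i : Fin m => i) j = 1 := by
  simp [fib, Finset.filter_eq']

end Fib

/-- The category of finite ordinals `⟨n⟩ = {1, …, n}`, including `⟨0⟩ = ∅`, and order-preserving maps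
(the augmented simplex category). -/
structure FinOrd where
  len : ℕ

instance : Category FinOrd where
  Hom a b := Fin a.len →o Fin b.len
  id _ := OrderHom.id
  comp f g := OrderHom.comp g f

namespace FinOrd

/-- The underlying order-preserving map. -/
def toMap {a b : FinOrd} (φ : a ⟶ b) : Fin a.len →o Fin b.len := φ

theorem hom_ext_fib {a b : FinOrd} {φ ψ : a ⟶ b} (h : ∀ j, fib (toMap φ) j = fib (toMap ψ) j) :
    φ = ψ :=
  OrderHom.ext _ _ (eq_of_fib (toMap φ).monotone (toMap ψ).monotone h)

end FinOrd

open FinOrd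

/-- The crossed group over the augmented simplex category associated with a group operad `G`. It is
given by `⟨n⟩ ↦ G(n)`; for `φ : ⟨m⟩ → ⟨n⟩` with fibres of sizes `k_1, …, k_n` and `x` in `G(n)`, one
has `φ^*(x) = γ(x; e_{k_1}, …, e_{k_n})`, and `φ^x` is the order-preserving map with fibres of sizes
`k_{x⁻¹(1)}, …, k_{x⁻¹(n)}`. -/
noncomputable def GroupOperad.crossedGroup (G : GroupOperad.{w}) : CrossedGroup.{w} FinOrd where
  obj a := G.Op a.len
  group _ := inferInstance
  res φ x := G.γ (arity_fib (toMap φ)) x (fun _ => 1)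
  act x φ := ofFib (k := fun j => fib (toMap φ) ((G.perm x)⁻¹ j))
    ((arity_perm _ _).trans (arity_fib (toMap φ)))
  res_id {a} x := by
    refine (G.γ_congr _ (arity_const_one _) (fun i => fib_id i) rfl _ (fun _ => G.one) ?_).trans
      (G.γ_one _ x)
    intro i
    rw [G.one_eq]
    exact heq_app (fun n => (1 : G.Op n)) (fib_id i)
  res_comp {c b a} ψ φ x := by
    have hr := fun i => (fib_comp (toMap φ) (toMap ψ) (arity_fib (toMap φ)) (fun _ => rfl) i).symm
    refine Eq.trans ?_ (G.assoc (arity_fib (toMap φ)) (arity_fib (toMap ψ)) hr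
      (arity_fib (toMap (ψ ≫ φ))) x (fun _ => 1) (fun _ => 1)).symm
    refine G.γ_congr _ _ (fun _ => rfl) rfl _ _ fun i => heq_of_eq ?_
    exact (G.γ_one_one (hr i)).symm
  act_one φ := hom_ext_fib fun j => by
    refine (fib_ofFib _ j).trans ?_
    rw [perm_inv_elt_one]
  act_mul x y φ := hom_ext_fib fun j => by
    refine (fib_ofFib _ j).trans (Eq.trans ?_ (fib_ofFib _ j).symm)
    refine Eq.trans ?_ (fib_ofFib _ _).symm
    rw [G.perm_mul, mul_inv_rev]; rfl
  act_comp {c b a} ψ φ x := hom_ext_fib fun j => by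
    refine (fib_ofFib _ j).trans ?_
    refine (fib_comp (toMap φ) (toMap ψ) (arity_fib (toMap φ)) (fun _ => rfl) _).trans ?_
    refine Eq.trans ?_ (fib_comp_ofFib _ _ j).symm
    refine congrArg arity (funext fun s => ?_)
    refine Eq.trans ?_ (fib_ofFib _ _).symm
    rw [G.perm_inv_γ, perm_inv_elt_one]
  res_mul φ x y := by
    have h' := (arity_perm _ (G.perm y)⁻¹).trans (arity_fib (toMap φ))
    have h := G.mul_γ (arity_fib (toMap φ)) x y (fun _ => 1) (fun _ => 1) h'
    simp only [mul_one] at h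
    refine h.trans (congrArg (· * _) ?_)
    have hf := fun i => (fib_ofFib h' i).symm
    exact G.γ_congr _ _ hf rfl _ _ fun i => heq_app (fun n => (1 : G.Op n)) (hf i)

/-! ### The monoidal structure -/

section Concat

variable (G : GroupOperad.{w})

theorem sig_γ {n m : ℕ} {k : Fin n → ℕ} (h : arity k = m) (x : G.Op n) (y : ∀ i, G.Op (k i)) :
    (⟨m, G.γ h x y⟩ : (n : ℕ) × G.Op n) = ⟨arity k, G.γ rfl x y⟩ := by
  subst h; rfl

/-- The operation `γ(x; z_1, …, z_n)`, together with its arity. -/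
def sigγ {n : ℕ} (x : G.Op n) (z : Fin n → (n : ℕ) × G.Op n) : (n : ℕ) × G.Op n :=
  ⟨arity (fun i => (z i).1), G.γ rfl x (fun i => (z i).2)⟩

theorem sigγ_eq {n m : ℕ} {k : Fin n → ℕ} (h : arity k = m) (x : G.Op n) (y : ∀ i, G.Op (k i)) :
    (⟨m, G.γ h x y⟩ : (n : ℕ) × G.Op n) = sigγ G x (fun i => ⟨k i, y i⟩) := sig_γ G h x y

theorem sigγ_assoc {n m : ℕ} {k : Fin n → ℕ} (hm : arity k = m) (x : G.Op n) (y : ∀ i, G.Op (k i))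
    (z : Fin m → (n : ℕ) × G.Op n) :
    sigγ G (G.γ hm x y) z = sigγ G x (fun i => sigγ G (y i) (fun s => z (blk hm i s))) := by
  have h := G.assoc hm (l := fun p => (z p).1) rfl
    (r := fun i => arity fun s => (z (blk hm i s)).1) (fun _ => rfl)
    (arity_assoc hm fun p => (z p).1) x y (fun p => (z p).2)
  exact (congrArg (Sigma.mk _) h).trans (sig_γ G _ _ _)

theorem one_sigγ (z : Fin 1 → (n : ℕ) × G.Op n) : sigγ G (1 : G.Op 1) z = z 0 := by
  obtain ⟨a, rfl⟩ : ∃ a, z = fun _ => a := ⟨z 0, funext fun i => by rw [Subsingleton.elim i 0]⟩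
  rw [← G.one_eq]
  exact (sig_γ G (arity_one_const a.1) _ _).symm.trans
    (congrArg (Sigma.mk a.1) (G.one_γ (arity_one_const a.1) a.2))

theorem sigγ_one {n : ℕ} (x : G.Op n) : sigγ G x (fun _ => ⟨1, 1⟩) = ⟨n, x⟩ := by
  refine (sigγ_eq G (arity_const_one n) x (fun _ => 1)).symm.trans
    (congrArg (Sigma.mk n) ?_)
  simp only [← G.one_eq]
  exact G.γ_one _ x

theorem sigγ_one_one {n m : ℕ} {k : Fin n → ℕ} (h : arity k = m) :
    sigγ G (1 : G.Op n) (fun i => ⟨k i, 1⟩) = ⟨m, 1⟩ := by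
  rw [← sigγ_eq G h, G.γ_one_one]

theorem sigγ_sigγ {n m : ℕ} {k : Fin n → ℕ} (hm : arity k = m) (z : Fin m → (n : ℕ) × G.Op n) :
    sigγ G (1 : G.Op n) (fun i => sigγ G (1 : G.Op (k i)) (fun s => z (blk hm i s))) =
      sigγ G (1 : G.Op m) z := by
  rw [← sigγ_assoc, G.γ_one_one]

theorem sigγ_succ {n : ℕ} (z : Fin (n + 1) → (n : ℕ) × G.Op n) :
    sigγ G (1 : G.Op (n + 1)) z = sigγ G (1 : G.Op 2) ![z 0, sigγ G (1 : G.Op n) (fun i => z i.succ)] := by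
  have h : arity ![1, n] = n + 1 := by simp [arity]
  rw [← sigγ_sigγ G h]
  congr 1
  funext i
  refine Fin.cases ?_ (fun i => ?_) i
  · refine (one_sigγ G _).trans (congrArg z (Fin.ext rfl))
  · obtain rfl : i = 0 := Subsingleton.elim _ _
    exact congrArg (sigγ G (1 : G.Op n)) (funext fun s => congrArg z (Fin.ext rfl))

theorem sigγ_nil (z : Fin 0 → (n : ℕ) × G.Op n) : sigγ G (1 : G.Op 0) z = ⟨0, 1⟩ := by
  obtain rfl : z = fun i => ⟨0, 1⟩ := funext fun i => i.elim0
  exact sigγ_one_one G rfl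

theorem sigγ_assoc₂ (a b c : (n : ℕ) × G.Op n) :
    sigγ G (1 : G.Op 2) ![sigγ G (1 : G.Op 2) ![a, b], c] =
      sigγ G (1 : G.Op 2) ![a, sigγ G (1 : G.Op 2) ![b, c]] := by
  have h : arity ![2, 1] = 3 := rfl
  refine Eq.trans ?_ ((sigγ_sigγ G h ![a, b, c]).trans ?_)
  · congr 1
    funext i
    fin_cases i
    · refine congrArg (sigγ G (1 : G.Op 2)) (funext fun s => ?_)
      fin_cases s <;> rfl
    · exact (one_sigγ G (fun s : Fin 1 => ![a, b, c] (blk h 1 s))).symm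
  · rw [sigγ_succ]
    congr 1

theorem sigγ_nil_left (a : (n : ℕ) × G.Op n) : sigγ G (1 : G.Op 2) ![⟨0, 1⟩, a] = a := by
  have h : arity ![0, 1] = 1 := rfl
  refine Eq.trans ?_ ((sigγ_sigγ G h ![a]).trans (one_sigγ G _))
  congr 1
  funext i
  fin_cases i
  · exact (sigγ_nil G _).symm
  · exact (one_sigγ G (fun s : Fin 1 => ![a] (blk h 1 s))).symm

theorem sigγ_nil_right (a : (n : ℕ) × G.Op n) : sigγ G (1 : G.Op 2) ![a, ⟨0, 1⟩] = a := by
  refine Eq.trans ?_ ((sigγ_succ G ![a]).symm.trans (one_sigγ G _))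
  congr 1
  funext i
  fin_cases i
  · rfl
  · exact (sigγ_nil G _).symm

theorem arity_two (m m' : ℕ) : arity (n := 2) (Fin.cons m fun _ => m') = m' + m :=
  congrArg (· + m) (Nat.zero_add _)

/-- The element `γ(e_2; x, y)`. -/
def GroupOperad.oplus {m m' : ℕ} (x : G.Op m) (y : G.Op m') : G.Op (m' + m) :=
  G.γ (n := 2) (k := Fin.cons m fun _ => m') (arity_two m m') 1 (Fin.cons x fun _ => y)

theorem sig_oplus {m m' : ℕ} (x : G.Op m) (y : G.Op m') :
    (⟨m' + m, G.oplus x y⟩ : (n : ℕ) × G.Op n) = sigγ G (1 : G.Op 2) ![⟨m, x⟩, ⟨m', y⟩] := by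
  refine (sigγ_eq G _ _ _).trans (congrArg _ (funext fun i => ?_))
  fin_cases i <;> rfl

theorem oplus_one {m m' : ℕ} : G.oplus (1 : G.Op m) (1 : G.Op m') = 1 := by
  refine Eq.trans ?_ (G.γ_one_one (arity_two m m'))
  refine congrArg (G.γ _ _) (funext fun i => ?_)
  fin_cases i <;> rfl

theorem oplus_mul {m m' : ℕ} (x x' : G.Op m) (y y' : G.Op m') :
    G.oplus (x * x') (y * y') = G.oplus x y * G.oplus x' y' := by
  refine Eq.trans ?_ (G.mul_γ_one (arity_two m m') 1 _ _)
  refine congrArg (G.γ _ _) (funext fun i => ?_)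
  fin_cases i <;> rfl

end Concat

/-- The order-preserving map `φ ⋆ φ'` given by `φ` on the first `m` elements and by `φ'` on the
last `m'` elements. -/
def join {m n m' n' : ℕ} (φ : Fin m →o Fin n) (φ' : Fin m' →o Fin n') :
    Fin (m' + m) →o Fin (n' + n) where
  toFun p := if h : (p : ℕ) < m then lft n' (φ ⟨p, h⟩) else (φ' ⟨p - m, by omega⟩).addNat n
  monotone' p q hpq := by
    have hpq' : (p : ℕ) ≤ q := hpq
    by_cases hq : (q : ℕ) < m
    · have hp : (p : ℕ) < m := by omega
      simp only [hp, hq, dite_true]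
      exact φ.monotone (show (⟨p, hp⟩ : Fin m) ≤ ⟨q, hq⟩ from hpq')
    · by_cases hp : (p : ℕ) < m
      · simp only [hp, hq, dite_true, dite_false]
        have := (φ ⟨p, hp⟩).2
        simp only [Fin.le_def, lft, Fin.val_addNat]
        omega
      · simp only [hp, hq, dite_false]
        have := φ'.monotone (show (⟨p - m, by omega⟩ : Fin m') ≤ ⟨q - m, by omega⟩ from
          Fin.le_def.2 (by simp only; omega))
        simp only [Fin.le_def, Fin.val_addNat] at this ⊢
        omega


section Aug

variable (G : GroupOperad.{w})

/-- The total category of the crossed group associated with `G`: its objects are the ordinals `⟨n⟩`,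
and its morphisms from `⟨m⟩` to `⟨n⟩` are pairs of an order-preserving map and an element of `G(m)`. -/
abbrev GroupOperad.Aug : Type := G.crossedGroup.Total

variable {G}

namespace Aug

/-- The number `n` of elements of `⟨n⟩`. -/
def len (a : G.Aug) : ℕ := a.of.len

/-- The object `⟨n⟩`. -/
def ob (n : ℕ) : G.Aug := ⟨⟨n⟩⟩

/-- The order-preserving map `φ` of a morphism `(φ, x)`. -/
def mp {a b : G.Aug} (f : a ⟶ b) : Fin (len a) →o Fin (len b) := CrossedGroup.TotalHom.map f

/-- The group element `x` of a morphism `(φ, x)`. -/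
def el {a b : G.Aug} (f : a ⟶ b) : G.Op (len a) := CrossedGroup.TotalHom.elt f

/-- The morphism `(φ, x)`. -/
def mk {a b : G.Aug} (φ : Fin (len a) →o Fin (len b)) (x : G.Op (len a)) : a ⟶ b :=
  (⟨φ, x⟩ : CrossedGroup.TotalHom G.crossedGroup a.of b.of)

theorem ext_fib {a b : G.Aug} {f g : a ⟶ b} (h : ∀ j, fib (mp f) j = fib (mp g) j)
    (hel : el f = el g) : f = g :=
  CrossedGroup.TotalHom.ext (FinOrd.hom_ext_fib h) hel

/-- The element of a morphism, together with its arity. -/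
def sg {a b : G.Aug} (f : a ⟶ b) : (n : ℕ) × G.Op n := ⟨len a, el f⟩

theorem el_eq {a b b' : G.Aug} {f : a ⟶ b} {g : a ⟶ b'} (h : sg f = sg g) : el f = el g :=
  eq_of_heq (Sigma.mk.inj h).2

theorem el_id (a : G.Aug) : el (𝟙 a) = 1 := rfl

theorem mp_id (a : G.Aug) (i : Fin (len a)) : mp (𝟙 a) i = i := rfl

theorem el_comp {a b c : G.Aug} (f : a ⟶ b) (g : b ⟶ c) :
    el (f ≫ g) = G.γ (arity_fib (mp f)) (el g) (fun _ => 1) * el f := rfl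

theorem fib_mp_comp {a b c : G.Aug} (f : a ⟶ b) (g : b ⟶ c) (j : Fin (len c)) :
    fib (mp (f ≫ g)) j = arity (fun s => fib (mp f) ((G.perm (el g))⁻¹
      (blk (arity_fib (mp g)) j s))) := by
  refine (fib_comp (mp g) _ (arity_fib (mp g)) (fun _ => rfl) j).trans (congrArg arity (funext fun s => ?_))
  exact fib_ofFib _ _

/-- The map of a composite with a morphism whose element is trivial. -/
theorem mp_comp_one {a b c : G.Aug} (f : a ⟶ b) (g : b ⟶ c) (h : el g = 1) (i : Fin (len a)) :
    mp (f ≫ g) i = mp g (mp f i) := by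
  have : mp (f ≫ g) = (mp g).comp (mp f) := by
    refine OrderHom.ext _ _ (eq_of_fib (mp (f ≫ g)).monotone ((mp g).comp (mp f)).monotone fun j => ?_)
    rw [fib_mp_comp, h]
    simp only [perm_inv_elt_one]
    exact (fib_comp (mp g) (mp f) (arity_fib (mp g)) (fun _ => rfl) j).symm
  rw [this]; rfl

theorem sg_eqToHom {a b : G.Aug} (h : a = b) : sg (eqToHom h) = ⟨len a, 1⟩ := by
  subst h; rfl

theorem el_eqToHom {a b : G.Aug} (h : a = b) : el (eqToHom h) = 1 := by
  subst h; rfl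

theorem sg_eqToHom_comp {a b c : G.Aug} (h : a = b) (f : b ⟶ c) : sg (eqToHom h ≫ f) = sg f := by
  subst h; rw [eqToHom_refl, Category.id_comp]

theorem sg_comp_eqToHom {a b c : G.Aug} (f : a ⟶ b) (h : b = c) : sg (f ≫ eqToHom h) = sg f := by
  subst h; rw [eqToHom_refl, Category.comp_id]

theorem mp_eqToHom {a b : G.Aug} (h : a = b) (i : Fin (len a)) : (mp (eqToHom h) i : ℕ) = i := by
  subst h; rfl

theorem mp_eqToHom_comp {a b c : G.Aug} (h : a = b) (f : b ⟶ c) (i : Fin (len a)) :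
    mp (eqToHom h ≫ f) i = mp f (i.cast (congrArg len h)) := by
  subst h; rw [eqToHom_refl, Category.id_comp]; rfl

theorem mp_comp_eqToHom {a b c : G.Aug} (f : a ⟶ b) (h : b = c) (i : Fin (len a)) :
    (mp (f ≫ eqToHom h) i : ℕ) = mp f i := by
  subst h; rw [eqToHom_refl, Category.comp_id]

theorem ext_val {a b : G.Aug} {f g : a ⟶ b} (h : ∀ i, (mp f i : ℕ) = mp g i)
    (h' : sg f = sg g) : f = g :=
  CrossedGroup.TotalHom.ext (OrderHom.ext _ _ (funext fun i => Fin.ext (h i))) (el_eq h')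

theorem comp_eqToHom_eq {a b a' b' : G.Aug} (f : a ⟶ b) (f' : a' ⟶ b') (ha : a = a') (hb : b = b')
    (h : ∀ i, (mp f i : ℕ) = mp f' (i.cast (congrArg len ha))) (h' : sg f = sg f') :
    f ≫ eqToHom hb = eqToHom ha ≫ f' := by
  subst ha hb
  rw [eqToHom_refl, Category.comp_id, eqToHom_refl, Category.id_comp]
  exact ext_val h h'

theorem ob_eq {a b : G.Aug} (h : len a = len b) : a = b := by
  obtain ⟨⟨m⟩⟩ := a
  obtain ⟨⟨n⟩⟩ := b
  obtain rfl : m = n := h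
  rfl

end Aug

open Aug

/-- Fibres of a map compatible with a decomposition into blocks. -/
theorem fib_concat {n m m' : ℕ} {k k' : Fin n → ℕ} (h : arity k = m) (h' : arity k' = m')
    (F : Fin m → Fin m') (f : ∀ i, Fin (k i) → Fin (k' i))
    (hF : ∀ i s, F (blk h i s) = blk h' i (f i s)) (i : Fin n) (s : Fin (k' i)) :
    fib F (blk h' i s) = fib (f i) s := by
  symm
  refine Finset.card_bij (fun t _ => blk h i t) ?_ ?_ ?_
  · intro t ht
    simp only [Finset.mem_filter, Finset.mem_univ, true_and] at ht ⊢
    rw [hF, ht]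
  · intro t _ t' _ hh
    have := blk_inj h (a₁ := ⟨i, t⟩) (a₂ := ⟨i, t'⟩) hh
    cases this; rfl
  · intro p hp
    obtain ⟨j, t, rfl⟩ := blk_surj h p
    simp only [Finset.mem_filter, Finset.mem_univ, true_and] at hp
    rw [hF] at hp
    have := blk_inj h' (a₁ := ⟨j, f j t⟩) (a₂ := ⟨i, s⟩) hp
    cases this
    exact ⟨t, by simp, rfl⟩

/-- Pulling back `γ(u; x_1, …, x_n)` along a map compatible with a decomposition into blocks. -/
theorem sg_res_concat {n m m' : ℕ} {k k' : Fin n → ℕ} (h : arity k = m) (h' : arity k' = m')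
    (F : Fin m → Fin m') (f : ∀ i, Fin (k i) → Fin (k' i))
    (hF : ∀ i s, F (blk h i s) = blk h' i (f i s)) (u : G.Op n) (x : ∀ i, G.Op (k' i)) :
    G.γ (arity_fib F) (G.γ h' u x) (fun _ => 1) =
      G.γ h u (fun i => G.γ (arity_fib (f i)) (x i) (fun _ => 1)) := by
  suffices hs : (⟨m, G.γ (arity_fib F) (G.γ h' u x) (fun _ => 1)⟩ : (n : ℕ) × G.Op n) =
      ⟨m, G.γ h u (fun i => G.γ (arity_fib (f i)) (x i) (fun _ => 1))⟩ from
    eq_of_heq (Sigma.mk.inj hs).2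
  rw [sigγ_eq, sigγ_eq, sigγ_assoc]
  congr 1
  funext i
  rw [sigγ_eq]
  congr 1
  funext s
  rw [fib_concat h h' F f hF]

theorem blk_two_zero {m m' : ℕ} (s : Fin m) : blk (n := 2) (arity_two m m') 0 s = lft m' s := Fin.ext rfl

theorem blk_two_one {m m' : ℕ} (s : Fin m') : blk (n := 2) (arity_two m m') 1 s = s.addNat m :=
  Fin.ext rfl

theorem join_lft {m n m' n' : ℕ} (φ : Fin m →o Fin n) (φ' : Fin m' →o Fin n') (s : Fin m) :
    join φ φ' (lft m' s) = lft n' (φ s) := by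
  have : ((lft m' s : Fin (m' + m)) : ℕ) < m := s.2
  change (if h : ((lft m' s : Fin (m' + m)) : ℕ) < m then _ else _) = _
  rw [dif_pos this]
  rfl

theorem join_addNat {m n m' n' : ℕ} (φ : Fin m →o Fin n) (φ' : Fin m' →o Fin n') (s : Fin m') :
    join φ φ' (s.addNat m) = (φ' s).addNat n := by
  have : ¬ ((s.addNat m : Fin (m' + m)) : ℕ) < m := by simp
  change (if h : ((s.addNat m : Fin (m' + m)) : ℕ) < m then _ else _) = _
  rw [dif_neg this]
  congr 2
  exact Fin.ext (by simp)

/-- The maps in `join`, as a family. -/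
def pairMap {m n m' n' : ℕ} (φ : Fin m → Fin n) (φ' : Fin m' → Fin n') :
    ∀ i : Fin 2, Fin ((Fin.cons m fun _ => m' : Fin 2 → ℕ) i) → Fin ((Fin.cons n fun _ => n' : Fin 2 → ℕ) i) :=
  Fin.cases φ (fun _ => φ')

theorem join_blk {m n m' n' : ℕ} (φ : Fin m →o Fin n) (φ' : Fin m' →o Fin n') (i : Fin 2)
    (s : Fin ((Fin.cons m fun _ => m' : Fin 2 → ℕ) i)) :
    join φ φ' (blk (arity_two m m') i s) = blk (arity_two n n') i (pairMap φ φ' i s) := by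
  revert s
  refine Fin.cases ?_ (fun i => ?_) i
  · intro s; exact join_lft φ φ' s
  · obtain rfl : i = 0 := Subsingleton.elim _ _
    intro s; exact join_addNat φ φ' s

theorem fib_join_lft {m n m' n' : ℕ} (φ : Fin m →o Fin n) (φ' : Fin m' →o Fin n') (s : Fin n) :
    fib (join φ φ') (lft n' s) = fib φ s :=
  fib_concat (arity_two m m') (arity_two n n') (join φ φ') (pairMap φ φ') (join_blk φ φ') 0 s

theorem fib_join_addNat {m n m' n' : ℕ} (φ : Fin m →o Fin n) (φ' : Fin m' →o Fin n') (s : Fin n') :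
    fib (join φ φ') (s.addNat n) = fib φ' s :=
  fib_concat (arity_two m m') (arity_two n n') (join φ φ') (pairMap φ φ') (join_blk φ φ') 1 s

theorem join_cases {m m' : ℕ} {motive : Fin (m' + m) → Prop} (h : ∀ s, motive (lft m' s))
    (h' : ∀ s : Fin m', motive (s.addNat m)) (p : Fin (m' + m)) : motive p := by
  by_cases hp : (p : ℕ) < m
  · exact h ⟨p, hp⟩
  · have := h' ⟨p - m, by omega⟩
    rwa [show (⟨p - m, by omega⟩ : Fin m').addNat m = p from Fin.ext (by simp; omega)] at this

theorem perm_inv_γ_one {n m : ℕ} {k : Fin n → ℕ} (h : arity k = m) (y : ∀ i, G.Op (k i)) (i : Fin n)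
    (s : Fin (k i)) : (G.perm (G.γ h 1 y))⁻¹ (blk h i s) = blk h i ((G.perm (y i))⁻¹ s) := by
  have hi : (G.perm (1 : G.Op n))⁻¹ i = i := perm_inv_elt_one i
  have h' : arity (fun i => k ((G.perm (1 : G.Op n))⁻¹ i)) = m := (arity_perm _ _).trans h
  rw [blk_congr h h' (fun j => congrArg k (perm_inv_elt_one j).symm) rfl s
    (s.cast (congrArg k hi.symm)) rfl, G.perm_inv_γ h 1 y h']
  exact blk_congr h h (fun _ => rfl) hi _ _
    (perm_val_congr (fun p => G.perm (y p)) hi.symm s).symm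

theorem perm_oplus_lft {m m' : ℕ} (x : G.Op m) (y : G.Op m') (s : Fin m) :
    (G.perm (G.oplus x y))⁻¹ (lft m' s) = lft m' ((G.perm x)⁻¹ s) :=
  perm_inv_γ_one (arity_two m m') _ 0 s

theorem perm_oplus_addNat {m m' : ℕ} (x : G.Op m) (y : G.Op m') (s : Fin m') :
    (G.perm (G.oplus x y))⁻¹ (s.addNat m) = ((G.perm y)⁻¹ s).addNat m :=
  perm_inv_γ_one (arity_two m m') _ 1 s

theorem res_join {m n m' n' : ℕ} (φ : Fin m →o Fin n) (φ' : Fin m' →o Fin n') (x : G.Op n)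
    (x' : G.Op n') : G.γ (arity_fib (join φ φ')) (G.oplus x x') (fun _ => 1) =
      G.oplus (G.γ (arity_fib φ) x fun _ => 1) (G.γ (arity_fib φ') x' fun _ => 1) := by
  refine (sg_res_concat (arity_two m m') (arity_two n n') (join φ φ') (pairMap φ φ') (join_blk φ φ')
    1 _).trans (congrArg (G.γ _ _) (funext fun i => ?_))
  fin_cases i <;> rfl

theorem act_join {m n m' n' : ℕ} (φ : (⟨m⟩ : FinOrd) ⟶ ⟨n⟩) (φ' : (⟨m'⟩ : FinOrd) ⟶ ⟨n'⟩)
    (x : G.Op n) (x' : G.Op n') :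
    G.crossedGroup.act (b := ⟨m' + m⟩) (a := ⟨n' + n⟩) (G.oplus x x') (join (toMap φ) (toMap φ')) =
      join (toMap (G.crossedGroup.act (a := ⟨n⟩) x φ)) (toMap (G.crossedGroup.act (a := ⟨n'⟩) x' φ')) := by
  apply FinOrd.hom_ext_fib
  refine join_cases (fun s => ?_) fun s => ?_
  · refine (fib_ofFib _ _).trans (Eq.trans ?_ (fib_join_lft _ _ s).symm)
    refine Eq.trans ?_ (fib_ofFib _ _).symm
    rw [perm_oplus_lft]
    exact fib_join_lft _ _ _
  · refine (fib_ofFib _ _).trans (Eq.trans ?_ (fib_join_addNat _ _ s).symm)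
    refine Eq.trans ?_ (fib_ofFib _ _).symm
    rw [perm_oplus_addNat]
    exact fib_join_addNat _ _ _

theorem join_comp {m n q m' n' q' : ℕ} (φ : Fin m →o Fin n) (φ' : Fin m' →o Fin n') (ψ : Fin n →o Fin q)
    (ψ' : Fin n' →o Fin q') : join (ψ.comp φ) (ψ'.comp φ') = (join ψ ψ').comp (join φ φ') := by
  refine OrderHom.ext _ _ (funext ?_)
  refine join_cases (fun s => ?_) fun s => ?_
  · refine (join_lft _ _ s).trans ?_
    change _ = join ψ ψ' (join φ φ' (lft m' s))
    rw [join_lft, join_lft]; rfl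
  · refine (join_addNat _ _ s).trans ?_
    change _ = join ψ ψ' (join φ φ' (s.addNat m))
    rw [join_addNat, join_addNat]; rfl

theorem assoc_ob (a b c : G.Aug) :
    (ob (len c + len (ob (len b + len a) : G.Aug)) : G.Aug) =
      ob (len (ob (len c + len b) : G.Aug) + len a) :=
  ob_eq (Nat.add_assoc (len c) (len b) (len a)).symm

theorem left_ob (a : G.Aug) : ob (len a + len (ob 0 : G.Aug)) = a := ob_eq (Nat.add_zero (len a))

theorem right_ob (a : G.Aug) : ob (len (ob 0 : G.Aug) + len a) = a := ob_eq (Nat.zero_add (len a))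

/-- The monoidal product `⟨m⟩ ⋆ ⟨n⟩ = ⟨m + n⟩`, given on morphisms by
`(φ, x) ⋆ (ψ, y) = (φ ⋆ ψ, γ(e_2; x, y))`; the associators and unitors are identities. -/
noncomputable instance : MonoidalCategoryStruct G.Aug where
  tensorObj a b := ob (len b + len a)
  tensorUnit := ob 0
  tensorHom f g := mk (join (mp f) (mp g)) (G.oplus (el f) (el g))
  whiskerLeft a _ _ f := mk (join (mp (𝟙 a)) (mp f)) (G.oplus (el (𝟙 a)) (el f))
  whiskerRight f a := mk (join (mp f) (mp (𝟙 a))) (G.oplus (el f) (el (𝟙 a)))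
  associator a b c := eqToIso (assoc_ob a b c)
  leftUnitor a := eqToIso (left_ob a)
  rightUnitor a := eqToIso (right_ob a)

namespace Aug

theorem sg_tensorHom {a b a' b' : G.Aug} (f : a ⟶ b) (f' : a' ⟶ b') :
    sg (f ⊗ₘ f') = sigγ G (1 : G.Op 2) ![sg f, sg f'] := sig_oplus G (el f) (el f')

theorem mp_tensorHom {a b a' b' : G.Aug} (f : a ⟶ b) (f' : a' ⟶ b') :
    mp (f ⊗ₘ f') = join (mp f) (mp f') := rfl

theorem sub_lt {a a' : G.Aug} (i : Fin (len (a ⊗ a'))) (h : ¬ (i : ℕ) < len a) :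
    (i : ℕ) - len a < len a' := by
  have h' : (i : ℕ) < len a' + len a := i.2
  omega

theorem mp_val {a b a' b' : G.Aug} (f : a ⟶ b) (f' : a' ⟶ b') (i : Fin (len (a ⊗ a'))) :
    (mp (f ⊗ₘ f') i : ℕ) =
      if h : (i : ℕ) < len a then (mp f ⟨i, h⟩ : ℕ) else mp f' ⟨i - len a, sub_lt i h⟩ + len b := by
  change ((if h : (i : ℕ) < len a then lft (len b') (mp f ⟨i, h⟩)
    else (mp f' ⟨i - len a, _⟩).addNat (len b) : Fin _) : ℕ) = _
  split_ifs <;> rfl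

theorem id_tensorHom_id' (a b : G.Aug) : 𝟙 a ⊗ₘ 𝟙 b = 𝟙 (a ⊗ b) := by
  refine ext_val (fun i => ?_) ?_
  · rw [mp_val]
    split_ifs with h
    · rfl
    · change (i : ℕ) - len a + len a = i
      omega
  · exact congrArg (Sigma.mk _) (oplus_one G)

theorem tensorHom_comp' {a b c a' b' c' : G.Aug} (f : a ⟶ b) (f' : a' ⟶ b') (g : b ⟶ c) (g' : b' ⟶ c') :
    (f ⊗ₘ f') ≫ (g ⊗ₘ g') = (f ≫ g) ⊗ₘ (f' ≫ g') := by
  refine CrossedGroup.TotalHom.ext ?_ ?_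
  · refine (congrArg (fun χ => OrderHom.comp (join (mp g) (mp g')) (toMap χ))
      (act_join (mp f) (mp f') (el g) (el g'))).trans ?_
    exact (join_comp _ _ _ _).symm
  · refine (congrArg (· * G.oplus (el f) (el f')) (res_join (mp f) (mp f') (el g) (el g'))).trans ?_
    exact (oplus_mul G _ _ _ _).symm

theorem id_tensorHom_eqToHom {a b c : G.Aug} (h : b = c) :
    𝟙 a ⊗ₘ eqToHom h = eqToHom (congrArg (a ⊗ ·) h) := by
  subst h; exact id_tensorHom_id' _ _

theorem eqToHom_tensorHom_id {a b c : G.Aug} (h : b = c) :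
    eqToHom h ⊗ₘ 𝟙 a = eqToHom (congrArg (· ⊗ a) h) := by
  subst h; exact id_tensorHom_id' _ _

end Aug

/-- The monoidal category of finite ordinals and pairs `(φ, x)`. -/
noncomputable instance : MonoidalCategory G.Aug :=
  MonoidalCategory.ofTensorHom
    (id_tensorHom_id := id_tensorHom_id')
    (id_tensorHom := fun _ _ _ _ => rfl)
    (tensorHom_id := fun _ _ => rfl)
    (tensorHom_comp_tensorHom := fun f f' g g' => tensorHom_comp' f f' g g')
    (associator_naturality := by
      intro a₁ a₂ a₃ b₁ b₂ b₃ f₁ f₂ f₃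
      refine comp_eqToHom_eq _ _ (assoc_ob a₁ a₂ a₃) (assoc_ob b₁ b₂ b₃) (fun i => ?_) ?_
      · rw [mp_val, mp_val]
        by_cases h₁ : (i : ℕ) < len a₁
        · have h₂ : (i : ℕ) < len (a₁ ⊗ a₂) := lt_of_lt_of_le h₁ (Nat.le_add_left _ _)
          rw [dif_pos h₂, dif_pos (by exact h₁), mp_val, dif_pos (by exact h₁)]
          rfl
        · by_cases h₂ : (i : ℕ) < len a₂ + len a₁
          · have h₃ : (i : ℕ) - len a₁ < len a₂ := by omega
            rw [dif_pos (by exact h₂), dif_neg (by exact h₁), mp_val, dif_neg (by exact h₁), mp_val,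
              dif_pos (by exact h₃)]
            rfl
          · have h₃ : ¬ (i : ℕ) - len a₁ < len a₂ := by omega
            rw [dif_neg (by exact h₂), dif_neg (by exact h₁), mp_val, dif_neg (by exact h₃)]
            have h₄ : (i : ℕ) - (len a₂ + len a₁) = i - len a₁ - len a₂ := by omega
            refine Eq.trans ?_ (Nat.add_assoc _ _ _).symm
            exact congrArg (· + (len b₂ + len b₁)) (congrArg (fun p => (mp f₃ p : ℕ)) (Fin.ext h₄))
      · simp only [sg_tensorHom]
        exact sigγ_assoc₂ G _ _ _)
    (leftUnitor_naturality := by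
      intro a b f
      refine comp_eqToHom_eq _ _ (left_ob a) (left_ob b) (fun i => ?_) ?_
      · rw [mp_val, dif_neg (by exact Nat.not_lt_zero _)]
        rfl
      · rw [sg_tensorHom]
        exact sigγ_nil_left G _)
    (rightUnitor_naturality := by
      intro a b f
      refine comp_eqToHom_eq _ _ (right_ob a) (right_ob b) (fun i => ?_) ?_
      · have h := i.2
        have h₁ : (i : ℕ) < len a := by
          have : (i : ℕ) < 0 + len a := h
          omega
        rw [mp_val, dif_pos h₁]
        rfl
      · rw [sg_tensorHom]
        exact sigγ_nil_right G _)
    (pentagon := by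
      intro a b c d
      simp only [MonoidalCategoryStruct.associator, eqToIso.hom, id_tensorHom_eqToHom,
        eqToHom_tensorHom_id, eqToHom_trans])
    (triangle := by
      intro a b
      simp only [MonoidalCategoryStruct.associator, MonoidalCategoryStruct.leftUnitor,
        MonoidalCategoryStruct.rightUnitor, eqToIso.hom, id_tensorHom_eqToHom,
        eqToHom_tensorHom_id, eqToHom_trans])

end Aug

open Aug

section AugSymmetric

variable {G : GroupOperad.{w}}

namespace Aug

theorem len_tens {n : ℕ} (X : Fin n → G.Aug) : arity (fun i => len (X i)) = len (tens X) := by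
  induction n with
  | zero => rfl
  | succ n ih => exact congrArg (· + len (X 0)) (ih fun i => X i.succ)

theorem mp_tensHom {n : ℕ} {X Y : Fin n → G.Aug} (f : ∀ i, X i ⟶ Y i) (i : Fin n)
    (s : Fin (len (X i))) :
    mp (tensHom f) (blk (len_tens X) i s) = blk (len_tens Y) i (mp (f i) s) := by
  induction n with
  | zero => exact i.elim0
  | succ n ih =>
    revert s
    refine Fin.cases ?_ (fun i => ?_) i
    · intro s
      exact join_lft (mp (f 0)) (mp (tensHom fun i => f i.succ)) s
    · intro s
      exact (join_addNat (mp (f 0)) (mp (tensHom fun i => f i.succ)) _).trans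
        (congrArg (fun p => p.addNat (len (Y 0))) (ih (fun i => f i.succ) i s))

theorem sg_tensHom {n : ℕ} {X Y : Fin n → G.Aug} (f : ∀ i, X i ⟶ Y i) :
    sg (tensHom f) = sigγ G (1 : G.Op n) (fun i => sg (f i)) := by
  induction n with
  | zero => exact (sigγ_nil G _).symm
  | succ n ih =>
    rw [sigγ_succ, ← ih (fun i => f i.succ)]
    exact sg_tensorHom (f 0) (tensHom fun i => f i.succ)

theorem fib_tensHom {n : ℕ} {X Y : Fin n → G.Aug} (f : ∀ i, X i ⟶ Y i) (i : Fin n)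
    (s : Fin (len (Y i))) : fib (mp (tensHom f)) (blk (len_tens Y) i s) = fib (mp (f i)) s :=
  fib_concat (len_tens X) (len_tens Y) (mp (tensHom f)) (fun i => mp (f i)) (mp_tensHom f) i s

theorem eq_of_sig {m : ℕ} {x y : G.Op m} (h : (⟨m, x⟩ : (n : ℕ) × G.Op n) = ⟨m, y⟩) : x = y :=
  eq_of_heq (Sigma.mk.inj h).2

theorem el_tensHom {n : ℕ} {X Y : Fin n → G.Aug} (f : ∀ i, X i ⟶ Y i) :
    el (tensHom f) = G.γ (len_tens X) 1 (fun i => el (f i)) :=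
  eq_of_sig ((sg_tensHom f).trans (sigγ_eq G (len_tens X) 1 _).symm)

theorem el_tensHom_comp {n : ℕ} {X Y : Fin n → G.Aug} (f : ∀ i, X i ⟶ Y i) {b : G.Aug}
    (g : tens Y ⟶ b) (x : G.Op n) (hg : el g = G.γ (len_tens Y) x (fun _ => 1)) :
    el (tensHom f ≫ g) = G.γ (len_tens X) x (fun i => el (f i)) := by
  rw [el_comp, hg, sg_res_concat (len_tens X) (len_tens Y) (mp (tensHom f)) (fun i => mp (f i))
    (mp_tensHom f), el_tensHom, ← G.mul_γ_one]
  simp only [G.γ_one_one, one_mul]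

/-- The endomorphism `(id, x)`. -/
def tw (a : G.Aug) (x : G.Op (len a)) : a ⟶ a := mk OrderHom.id x

theorem el_tw_comp {a b : G.Aug} (x : G.Op (len a)) (g : a ⟶ b) : el (tw a x ≫ g) = el g * x :=
  congrArg (· * x) (G.crossedGroup.res_id (el g))

theorem mp_tw_comp {a b : G.Aug} (x : G.Op (len a)) (g : a ⟶ b) : mp (tw a x ≫ g) = mp g :=
  (congrArg (fun χ : a.of ⟶ a.of => χ ≫ (mp g : a.of ⟶ b.of)) (G.crossedGroup.act_id (el g))).trans
    (OrderHom.ext _ _ rfl)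

theorem fib_comp_tw {a b : G.Aug} (f : a ⟶ b) (x : G.Op (len b)) (j : Fin (len b)) :
    fib (mp (f ≫ tw b x)) j = fib (mp f) ((G.perm x)⁻¹ j) :=
  fib_ofFib ((arity_perm _ _).trans (arity_fib (mp f))) j

theorem fib_comp_eqToHom {a b c : G.Aug} (f : a ⟶ b) (h : b = c) (j : Fin (len c)) :
    fib (mp (f ≫ eqToHom h)) j = fib (mp f) (j.cast (congrArg len h.symm)) := by
  subst h; rw [eqToHom_refl, Category.comp_id]; rfl

theorem fib_eqToHom_comp {a b c : G.Aug} (h : a = b) (f : b ⟶ c) (j : Fin (len c)) :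
    fib (mp (eqToHom h ≫ f)) j = fib (mp f) j := by
  subst h; rw [eqToHom_refl, Category.id_comp]

theorem theta_ob {n : ℕ} (u : G.Op n) (a : Fin n → G.Aug) :
    tens a = tens (fun i => a ((G.perm u)⁻¹ i)) :=
  ob_eq ((len_tens a).symm.trans ((arity_perm (fun i => len (a i)) _).symm.trans (len_tens _)))

/-- The morphism `(id, γ(u; e_{k_1}, …, e_{k_n}))` from `⟨k_1⟩ ⋆ ⋯ ⋆ ⟨k_n⟩ = ⟨k_1 + ⋯ + k_n⟩` to
`⟨k_{u⁻¹(1)}⟩ ⋆ ⋯ ⋆ ⟨k_{u⁻¹(n)}⟩ = ⟨k_1 + ⋯ + k_n⟩`. -/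
noncomputable def theta {n : ℕ} (u : G.Op n) (a : Fin n → G.Aug) : tens a ⟶ tens (fun i => a ((G.perm u)⁻¹ i)) :=
  tw (tens a) (G.γ (len_tens a) u (fun _ => 1)) ≫ eqToHom (theta_ob u a)

theorem el_theta {n : ℕ} (u : G.Op n) (a : Fin n → G.Aug) :
    el (theta u a) = G.γ (len_tens a) u (fun _ => 1) :=
  el_eq (f := theta u a) (g := tw (tens a) (G.γ (len_tens a) u (fun _ => 1)))
    (sg_comp_eqToHom _ _)

theorem sg_theta {n : ℕ} (u : G.Op n) (a : Fin n → G.Aug) :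
    sg (theta u a) = sigγ G u (fun i => ⟨len (a i), 1⟩) :=
  (congrArg (Sigma.mk _) (el_theta u a)).trans (sigγ_eq G _ _ _)

theorem theta_natural {n : ℕ} (u : G.Op n) {a b : Fin n → G.Aug} (p : ∀ i, b i ⟶ a i) :
    tensHom p ≫ theta u a = theta u b ≫ tensHom (fun i => p ((G.perm u)⁻¹ i)) := by
  refine ext_fib (fun j => ?_) ?_
  · obtain ⟨i, s, rfl⟩ := blk_surj (len_tens fun i => a ((G.perm u)⁻¹ i)) j
    have h' : arity (fun i => len (a ((G.perm u)⁻¹ i))) = len (tens a) :=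
      (arity_perm (fun i => len (a i)) _).trans (len_tens a)
    refine Eq.trans ?_ (((fib_tensHom (fun i => p ((G.perm u)⁻¹ i)) i s).symm.trans
      (fib_eqToHom_comp (theta_ob u b) _ _).symm).trans ?_)
    · rw [theta, ← Category.assoc, fib_comp_eqToHom, fib_comp_tw]
      have e : (blk (len_tens fun i => a ((G.perm u)⁻¹ i)) i s).cast
          (congrArg len (theta_ob u a).symm) = blk h' i s := rfl
      rw [e, G.perm_inv_γ (len_tens a) u _ h', perm_inv_elt_one]
      exact fib_tensHom p _ _
    · rw [theta, Category.assoc, mp_tw_comp]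
  · have h'' : arity (fun i => len (b ((G.perm u)⁻¹ i))) = len (tens b) :=
      (arity_perm (fun i => len (b i)) _).trans (len_tens b)
    have e : el (eqToHom (theta_ob u b) ≫ tensHom (fun i => p ((G.perm u)⁻¹ i))) =
        G.γ h'' 1 (fun i => el (p ((G.perm u)⁻¹ i))) :=
      eq_of_sig ((sg_eqToHom_comp _ _).trans ((sg_tensHom _).trans (sigγ_eq G h'' 1 _).symm))
    rw [el_tensHom_comp p _ u (el_theta u a), theta, Category.assoc, el_tw_comp, e]
    have h := G.mul_γ (len_tens b) 1 u (fun i => el (p i)) (fun _ => 1) h''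
    simp only [mul_one, one_mul] at h
    exact h

/-- Morphisms of the form `(id, 1)`. -/
def IsTriv {a b : G.Aug} (f : a ⟶ b) : Prop := ∃ h : a = b, f = eqToHom h

theorem IsTriv.comp {a b c : G.Aug} {f : a ⟶ b} {g : b ⟶ c} (hf : IsTriv f) (hg : IsTriv g) :
    IsTriv (f ≫ g) := by
  obtain ⟨rfl, rfl⟩ := hf
  obtain ⟨rfl, rfl⟩ := hg
  exact ⟨rfl, by simp⟩

theorem isTriv_id (a : G.Aug) : IsTriv (𝟙 a) := ⟨rfl, rfl⟩

theorem isTriv_eqToHom {a b : G.Aug} (h : a = b) : IsTriv (eqToHom h) := ⟨h, rfl⟩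

theorem IsTriv.whiskerLeft (a : G.Aug) {b c : G.Aug} {f : b ⟶ c} (hf : IsTriv f) :
    IsTriv (a ◁ f) := by
  obtain ⟨rfl, rfl⟩ := hf
  exact ⟨rfl, by simp⟩

theorem isTriv_split (q p : ℕ) (d : Fin (q + p) → G.Aug) : IsTriv (split q p d).hom := by
  induction p with
  | zero => exact isTriv_eqToHom (left_ob _).symm
  | succ p ih =>
    have h : ∀ {a b c d : G.Aug} (f : b ⟶ c ⊗ d), IsTriv f → IsTriv (a ◁ f ≫ (α_ a c d).inv) :=
      fun {a _ c d} f hf => (hf.whiskerLeft a).comp (isTriv_eqToHom (assoc_ob a c d).symm)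
    exact h _ (ih fun i => d i.succ)

theorem isTriv_flat {n : ℕ} (k : Fin n → ℕ) (d : Fin (arity k) → G.Aug) :
    IsTriv (flat k d).hom := by
  induction n with
  | zero => exact isTriv_id _
  | succ n ih =>
    exact (isTriv_split _ _ d).comp ((ih _ (fun t => d (t.addNat (k 0)))).whiskerLeft _)

theorem isTriv_blocks {n m : ℕ} {k : Fin n → ℕ} (h : arity k = m) (d : Fin m → G.Aug) :
    IsTriv (blocks h d).hom := by
  subst h
  exact isTriv_flat k d

theorem IsTriv.sg_comp {a b c : G.Aug} {f : a ⟶ b} (hf : IsTriv f) (g : b ⟶ c) :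
    sg (f ≫ g) = sg g := by
  obtain ⟨rfl, rfl⟩ := hf
  exact sg_eqToHom_comp _ _

theorem IsTriv.comp_sg {a b c : G.Aug} (f : a ⟶ b) {g : b ⟶ c} (hg : IsTriv g) :
    sg (f ≫ g) = sg f := by
  obtain ⟨rfl, rfl⟩ := hg
  exact sg_comp_eqToHom _ _

/-- Morphisms of the form `(id, x)`. -/
def IsTw {a b : G.Aug} (f : a ⟶ b) : Prop := ∃ (h : a = b) (x : G.Op (len a)), f = tw a x ≫ eqToHom h

theorem IsTw.mp_val {a b : G.Aug} {f : a ⟶ b} (hf : IsTw f) (i : Fin (len a)) : (mp f i : ℕ) = i := by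
  obtain ⟨rfl, x, rfl⟩ := hf
  rw [mp_tw_comp]
  rfl

theorem isTw_of {a b : G.Aug} {f : a ⟶ b} (h : len a = len b) (hf : ∀ i, (mp f i : ℕ) = i) : IsTw f := by
  obtain rfl := ob_eq h
  refine ⟨rfl, el f, ext_val (fun i => ?_) ?_⟩
  · rw [mp_tw_comp, hf]
    rfl
  · exact congrArg (Sigma.mk _) (by rw [eqToHom_refl, el_tw_comp, el_id, one_mul])

theorem IsTw.comp {a b c : G.Aug} {f : a ⟶ b} {g : b ⟶ c} (hf : IsTw f) (hg : IsTw g) :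
    IsTw (f ≫ g) := by
  obtain ⟨rfl, x, rfl⟩ := hf
  obtain ⟨rfl, y, rfl⟩ := hg
  refine isTw_of rfl fun i => ?_
  rw [eqToHom_refl, Category.comp_id, Category.comp_id, mp_tw_comp]
  rfl

theorem IsTriv.isTw {a b : G.Aug} {f : a ⟶ b} (hf : IsTriv f) : IsTw f := by
  obtain ⟨rfl, rfl⟩ := hf
  exact isTw_of rfl fun _ => rfl

theorem isTw_theta {n : ℕ} (u : G.Op n) (a : Fin n → G.Aug) : IsTw (theta u a) := ⟨_, _, rfl⟩

theorem isTw_tensHom {n : ℕ} {X Y : Fin n → G.Aug} {f : ∀ i, X i ⟶ Y i} (hf : ∀ i, IsTw (f i)) :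
    IsTw (tensHom f) := by
  have hXY : ∀ i, X i = Y i := fun i => (hf i).1
  obtain rfl : X = Y := funext hXY
  refine isTw_of rfl fun j => ?_
  obtain ⟨i, s, rfl⟩ := blk_surj (len_tens X) j
  rw [mp_tensHom]
  exact congrArg (fun t => (blk (len_tens X) i t : ℕ)) (Fin.ext ((hf i).mp_val s))

theorem IsTw.ext {a b : G.Aug} {f g : a ⟶ b} (hf : IsTw f) (hg : IsTw g) (h : sg f = sg g) : f = g :=
  ext_val (fun i => (hf.mp_val i).trans (hg.mp_val i).symm) h

theorem theta_comp {n m : ℕ} {k : Fin n → ℕ} (h : arity k = m) (d : Fin m → G.Aug) (u : G.Op n)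
    (v : ∀ i, G.Op (k i))
    (e : ∀ i, tens (fun s => d ((G.perm (G.γ h u v))⁻¹
      (blk (k := fun i => k ((G.perm u)⁻¹ i)) ((arity_perm k _).trans h) i s))) =
      tens (fun s => d (blk h ((G.perm u)⁻¹ i) ((G.perm (v ((G.perm u)⁻¹ i)))⁻¹ s)))) :
    theta (G.γ h u v) d ≫
        (blocks (k := fun i => k ((G.perm u)⁻¹ i)) ((arity_perm k _).trans h)
          (fun p => d ((G.perm (G.γ h u v))⁻¹ p))).hom ≫ tensHom (fun i => eqToHom (e i)) =
      (blocks h d).hom ≫ tensHom (fun i => theta (v i) (fun s => d (blk h i s))) ≫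
        theta u (fun i => tens (fun s => d (blk h i ((G.perm (v i))⁻¹ s)))) := by
  refine IsTw.ext ((isTw_theta _ _).comp ((isTriv_blocks _ _).isTw.comp
    (isTw_tensHom fun i => (isTriv_eqToHom _).isTw)))
    ((isTriv_blocks _ _).isTw.comp ((isTw_tensHom fun i => isTw_theta _ _).comp (isTw_theta _ _))) ?_
  have hT : IsTriv (tensHom fun i => eqToHom (e i)) := ⟨tens_congr e, tensHom_eqToHom e⟩
  rw [((isTriv_blocks _ _).comp hT).comp_sg, (isTriv_blocks _ _).sg_comp, sg_theta, sigγ_assoc]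
  refine Eq.trans ?_ (congrArg (Sigma.mk _) (el_tensHom_comp _ _ u (el_theta u _))).symm
  rw [sigγ_eq]
  refine congrArg (sigγ G u) (funext fun i => ?_)
  exact (sg_theta (v i) _).symm

theorem theta_one {n : ℕ} (a a' : Fin n → G.Aug) (h : ∀ i, a' i = a ((G.perm (1 : G.Op n))⁻¹ i))
    (h' : a' = a) : theta 1 a ≫ eqToHom (tens_congr h).symm = eqToHom (congrArg tens h'.symm) := by
  refine IsTw.ext ((isTw_theta _ _).comp (isTriv_eqToHom _).isTw) (isTriv_eqToHom _).isTw ?_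
  rw [sg_comp_eqToHom, sg_eqToHom, sg_theta, sigγ_one_one G (len_tens a)]

theorem theta_mul {n : ℕ} (x y : G.Op n) (a : Fin n → G.Aug)
    (e : tens (fun i => a ((G.perm (x * y))⁻¹ i)) = tens (fun i => a ((G.perm y)⁻¹ ((G.perm x)⁻¹ i)))) :
    theta y a ≫ theta x (fun i => a ((G.perm y)⁻¹ i)) = theta (x * y) a ≫ eqToHom e := by
  refine IsTw.ext ((isTw_theta _ _).comp (isTw_theta _ _))
    ((isTw_theta _ _).comp (isTriv_eqToHom _).isTw) (congrArg (Sigma.mk _) ?_)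
  have h'' : arity (fun i => len (a ((G.perm y)⁻¹ i))) = len (tens a) :=
    (arity_perm (fun i => len (a i)) _).trans (len_tens a)
  have h₁ : el (theta (x * y) a ≫ eqToHom e) = G.γ (len_tens a) (x * y) (fun _ => 1) :=
    (el_eq (sg_comp_eqToHom _ _)).trans (el_theta _ _)
  have h₂ : el (eqToHom (theta_ob y a) ≫ theta x (fun i => a ((G.perm y)⁻¹ i))) =
      G.γ h'' x (fun _ => 1) :=
    eq_of_sig ((sg_eqToHom_comp _ _).trans ((sg_theta _ _).trans (sigγ_eq G h'' x _).symm))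
  rw [h₁]
  change el ((tw (tens a) _ ≫ eqToHom (theta_ob y a)) ≫ _) = _
  rw [Category.assoc, el_tw_comp, h₂]
  have h := G.mul_γ (len_tens a) x y (fun _ => 1) (fun _ => 1) h''
  simp only [mul_one] at h
  exact h.symm

theorem heq_sig {m m' : ℕ} (h : m = m') : (⟨m, 1⟩ : (n : ℕ) × G.Op n) = ⟨m', 1⟩ := by
  subst h; rfl

theorem theta_id (a : G.Aug) : theta G.one (fun _ : Fin 1 => a) ≫ tensOne a = tensOne a := by
  have hT : IsTriv (tensOne a) := isTriv_eqToHom (right_ob a)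
  refine IsTw.ext ((isTw_theta _ _).comp hT.isTw) hT.isTw ?_
  rw [hT.comp_sg, sg_theta]
  refine ((congrArg (fun x => sigγ G x fun _ : Fin 1 => ⟨len a, 1⟩) G.one_eq).trans
    (one_sigγ G _)).trans ?_
  refine Eq.trans ?_ (sg_eqToHom (right_ob a)).symm
  exact heq_sig (Nat.zero_add (len a)).symm

theorem mk'_hom_eq {n : ℕ} {a a' : Fin n → G.Aug} {b : G.Aug} (x : G.Op n)
    (h : ∀ i, a' i = a ((G.perm x)⁻¹ i)) (f : tens a' ⟶ b) :
    (CrossHom.mk' (M := ofMonoidal G.Aug) (a := a) (b := b) x h f).hom =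
      eqToHom (tens_congr h).symm ≫ f := by
  obtain rfl : a' = fun i => a ((G.perm x)⁻¹ i) := funext h
  exact (Category.id_comp f).symm

/-- The action of the structure multifunctor. -/
noncomputable def symHom {n : ℕ} {a : Fin n → G.Aug} {b : G.Aug}
    (φ : CrossHom (ofMonoidal G.Aug) G a b) : tens a ⟶ b :=
  theta φ.elt a ≫ φ.hom

theorem symHom_one {n : ℕ} {a a' : Fin n → G.Aug} {b : G.Aug}
    (h : ∀ i, a' i = a ((G.perm (1 : G.Op n))⁻¹ i)) (h' : a' = a) (f : tens a' ⟶ b) :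
    symHom (CrossHom.mk' (M := ofMonoidal G.Aug) (1 : G.Op n) h f) =
      eqToHom (congrArg tens h'.symm) ≫ f := by
  refine (congrArg (theta (1 : G.Op n) a ≫ ·) (mk'_hom_eq (1 : G.Op n) h f)).trans ?_
  refine (Category.assoc _ _ _).symm.trans ?_
  exact congrArg (· ≫ f) (theta_one a a' h h')

theorem symHom_mul {n : ℕ} {a : Fin n → G.Aug} {b : G.Aug} (x y : G.Op n)
    (h : ∀ i, a ((G.perm y)⁻¹ ((G.perm x)⁻¹ i)) = a ((G.perm (x * y))⁻¹ i))
    (f : tens (fun i => a ((G.perm y)⁻¹ ((G.perm x)⁻¹ i))) ⟶ b) :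
    theta y a ≫ theta x (fun i => a ((G.perm y)⁻¹ i)) ≫ f =
      symHom (CrossHom.mk' (M := ofMonoidal G.Aug) (a := a) (x * y) h f) := by
  refine Eq.trans ?_ (congrArg (theta (x * y) a ≫ ·) (mk'_hom_eq (x * y) h f)).symm
  refine ((Category.assoc _ _ _).symm.trans ?_).trans (Category.assoc _ _ _)
  exact congrArg (· ≫ f) (theta_mul x y a _)

theorem symHom_comp {n m : ℕ} {k : Fin n → ℕ} (h : arity k = m) (d : Fin m → G.Aug) {a : Fin n → G.Aug}
    {b : G.Aug} (u : G.Op n) (v : ∀ i, G.Op (k i)) (f : tens (fun i => a ((G.perm u)⁻¹ i)) ⟶ b)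
    (g : ∀ i, tens (fun s => d (blk h i ((G.perm (v i))⁻¹ s))) ⟶ a i)
    (e : ∀ i, tens (fun s => d ((G.perm (G.γ h u v))⁻¹
      (blk (k := fun i => k ((G.perm u)⁻¹ i)) ((arity_perm k _).trans h) i s))) =
      tens (fun s => d (blk h ((G.perm u)⁻¹ i) ((G.perm (v ((G.perm u)⁻¹ i)))⁻¹ s)))) :
    theta (G.γ h u v) d ≫
        (blocks (k := fun i => k ((G.perm u)⁻¹ i)) ((arity_perm k _).trans h)
          (fun p => d ((G.perm (G.γ h u v))⁻¹ p))).hom ≫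
          tensHom (fun i => eqToHom (e i) ≫ g ((G.perm u)⁻¹ i)) ≫ f =
      (blocks h d).hom ≫ tensHom (fun i => eqToHom rfl ≫ theta (v i) (fun s => d (blk h i s)) ≫ g i) ≫
        theta u a ≫ f := by
  have h₁ := theta_comp h d u v e
  have h₂ : tensHom (fun i => eqToHom rfl ≫ theta (v i) (fun s => d (blk h i s)) ≫ g i) =
      tensHom (fun i => theta (v i) (fun s => d (blk h i s))) ≫ tensHom g := by
    rw [← tensHom_comp]
    simp only [eqToHom_refl, Category.id_comp]
  rw [h₂, tensHom_comp, Category.assoc, Category.assoc, ← Category.assoc (tensHom g), theta_natural,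
    Category.assoc]
  simpa only [Category.assoc] using congrArg
    (· ≫ tensHom (fun i => g ((G.perm u)⁻¹ i)) ≫ f) h₁

end Aug

/-- The `G`-symmetric structure on the monoidal category of finite ordinals and pairs `(φ, x)`, given
by `((φ, x), u) ↦ (φ, x) ∘ (id, γ(u; e_{k_1}, …, e_{k_n})) = (φ, x γ(u; e_{k_1}, …, e_{k_n}))` for
`u` in `G(n)` and `(φ, x)` from `⟨k_{u⁻¹(1)}⟩ ⋆ ⋯ ⋆ ⟨k_{u⁻¹(n)}⟩` to `⟨m⟩`. -/
noncomputable instance : SymmetricMonoidal G G.Aug where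
  sym φ := symHom φ
  sym_id a := theta_id a
  sym_one f := (symHom_one _ rfl f).trans (Category.id_comp f)
  sym_mul x y f := symHom_mul x y _ f
  sym_comp {n m k} h {a b c d} hd φ ψ := by
    obtain rfl : (fun i s => d (blk h i s)) = c := funext fun i => funext fun s => hd i s
    exact symHom_comp h d φ.elt (fun i => (ψ i).elt) φ.hom (fun i => (ψ i).hom) _

/-! ### The universal monoid -/

namespace Aug

theorem ob_tens_one (n : ℕ) : tens (fun _ : Fin n => (ob 1 : G.Aug)) = ob n :=
  ob_eq ((len_tens _).symm.trans (arity_const_one n))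

/-- The morphism `(μ_n, x)` from `⟨1⟩ ⋆ ⋯ ⋆ ⟨1⟩ = ⟨n⟩` to `⟨1⟩`, where `μ_n` is the unique map to the
terminal object `⟨1⟩`. -/
noncomputable def muHom {n : ℕ} (x : G.Op n) : tens (fun _ : Fin n => (ob 1 : G.Aug)) ⟶ ob 1 :=
  eqToHom (ob_tens_one n) ≫ mk (a := ob n) (b := ob 1) ⟨fun _ => (0 : Fin 1), fun _ _ _ => le_rfl⟩ x

theorem sg_muHom {n : ℕ} (x : G.Op n) : sg (muHom x) = ⟨n, x⟩ := sg_eqToHom_comp _ _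

theorem el_muHom {n : ℕ} (x : G.Op n) : el (muHom x) = G.γ (len_tens _) x (fun _ => 1) :=
  eq_of_sig ((sg_muHom x).trans ((sigγ_one G x).symm.trans (sigγ_eq G
    (len_tens fun _ : Fin n => (ob 1 : G.Aug)) x (fun _ => 1)).symm))

theorem ext_to_one {a : G.Aug} {f g : a ⟶ ob 1} (h : sg f = sg g) : f = g :=
  ext_val (fun _ => congrArg Fin.val (Subsingleton.elim (α := Fin 1) _ _)) h

theorem muHom_comp {n m : ℕ} {k : Fin n → ℕ} (h : arity k = m) (x : G.Op n) (y : ∀ i, G.Op (k i))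
    (e : ∀ i, tens (fun _ : Fin (k i) => (ob 1 : G.Aug)) = tens (fun _ : Fin (k i) => (ob 1 : G.Aug))) :
    muHom (G.γ h x y) = (blocks h fun _ => ob 1).hom ≫ tensHom (fun i => eqToHom (e i) ≫ muHom (y i)) ≫
      muHom x := by
  apply ext_to_one
  rw [(isTriv_blocks _ _).sg_comp]
  refine ((sg_muHom _).trans (sigγ_eq G h x y)).trans ?_
  refine Eq.trans ?_ (congrArg (Sigma.mk _) (el_tensHom_comp _ _ x (el_muHom x))).symm
  rw [sigγ_eq]
  refine congrArg (sigγ G x) (funext fun i => ?_)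
  exact ((sg_eqToHom_comp _ _).trans (sg_muHom _)).symm

theorem muHom_mul {n : ℕ} (x u : G.Op n) :
    muHom (x * u) = theta u (fun _ => (ob 1 : G.Aug)) ≫ muHom x := by
  apply ext_to_one
  refine (sg_muHom _).trans ((sigγ_one G _).symm.trans ?_)
  refine (sigγ_eq G (len_tens fun _ : Fin n => (ob 1 : G.Aug)) (x * u) (fun _ => 1)).symm.trans
    (congrArg (Sigma.mk _) ?_)
  have e : el (eqToHom (theta_ob u fun _ : Fin n => (ob 1 : G.Aug)) ≫ muHom x) =
      G.γ (len_tens fun _ : Fin n => (ob 1 : G.Aug)) x (fun _ => 1) :=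
    el_muHom x ▸ eq_of_sig (sg_eqToHom_comp _ _)
  rw [theta, Category.assoc, el_tw_comp, e]
  have h := G.mul_γ (len_tens fun _ : Fin n => (ob 1 : G.Aug)) x u (fun _ => 1) (fun _ => 1)
    (len_tens fun _ : Fin n => (ob 1 : G.Aug))
  simp only [mul_one] at h
  exact h

theorem muHom_one : muHom G.one = tensOne (ob 1 : G.Aug) := by
  apply ext_to_one
  refine (sg_muHom _).trans (Eq.trans ?_ (sg_eqToHom (right_ob (ob 1))).symm)
  exact congrArg (Sigma.mk 1) G.one_eq

end Aug

end AugSymmetric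

/-- The multifunctor `M` from `G` to the multicategory of finite ordinals and pairs `(φ, x)`, with
`M(∗) = ⟨1⟩` and `M(x) = (μ_n, x)` for `x` in `G(n)`. -/
noncomputable def augMonoid (G : GroupOperad.{w}) : Multifunctor G.toMulticategory (ofMonoidal G.Aug) where
  obj _ := ob 1
  map x := muHom x
  map_id _ := muHom_one
  map_comp h _ _ _ _ _ x y := muHom_comp h x y _

theorem augMonoid_isSymmetric (G : GroupOperad.{w}) : Multifunctor.IsSymmetric G (augMonoid G) :=
  fun φ => muHom_mul (show G.Op _ from φ.hom) φ.elt

/-- A monoid in a monoidal category `C`, as a multifunctor from the terminal operad to the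
multicategory of `C`. -/
abbrev MonoidIn (C : Type u) [Category.{v} C] [MonoidalCategory C] :=
  Multifunctor trivialOperad.toMulticategory (ofMonoidal C)

/-- The functor from `G`-symmetric monoidal functors on the monoidal category of finite ordinals and
pairs `(φ, x)` to monoids in `C`: pass to multifunctors, precompose with `M`, and restrict along the
units of `G`. -/
noncomputable def comparison (G : GroupOperad.{w}) (C : Type u) [Category.{v} C] [MonoidalCategory C]
    [SymmetricMonoidal G C] : SymMonoidalFunctor G G.Aug C ⥤ MonoidIn C :=
  toSymMultifunctor G G.Aug C ⋙
    Multifunctor.symPrecomp (augMonoid G) (augMonoid_isSymmetric G) (ofMonoidal C) ⋙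
      restrictUnit G (ofMonoidal C)

end GrpOpd

/-! A morphism `(φ, x)` of the total category factors as `(φ, 1) ∘ (id, x)`. The object `⟨n⟩` is the
`n`-fold tensor power of `⟨1⟩`, and `(φ, 1)` is a tensor product of multiplications `⟨k⟩ → ⟨1⟩`. So
on the powers of `⟨1⟩` everything is generated by the action of `G` and by one multiplication for
each arity (`exists_eq_theta_comp`). A symmetric monoidal functor must carry the action to the
action in `C`, so only the monoid `F⟨1⟩` is left to choose.

Essential surjectivity. For a monoid `A`, send `⟨n⟩` to `A^{⊗n}`, and send `(φ, x)` to the action of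
`x` followed by multiplication within the fibres of `φ`. Functoriality needs the crossed composition
law: acting by `u` after merging blocks equals acting by `γ(u; e, …, e)` and then merging the
permuted blocks (`merge_twist`). This follows from naturality of the action (`twist_natural`) and
its compatibility with operadic composition (`twist_γ`). Merging twice is merging once
(`merge_merge`), by coherence and associativity of `A`. Cutting a power in two gives the monoidal
structure, and symmetry is the same block permutation identity (`μTens_lift_theta`).

Full faithfulness. A monoidal transformation is determined at `⟨n⟩` by the `n`-th tensor power of
its component `f` at `⟨1⟩`. Conversely, if `f` respects multiplication, its powers commute with the
action, with regrouping and with multiplication, hence with every morphism by the decomposition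
above (`powerApp_natural`). Compatibility with tensor products is compatibility of the powers with
cutting (`powerApp_split`).

Restriction along the units. In `G` one has `x = e_n x = sym(e_n, x)`. A symmetric multifunctor on
`G` is therefore determined by its values at the units, which are the data of a monoid, and every
monoid extends. Naturality at `x` likewise follows from naturality at `e_n`. -/

namespace GrpOpd

/-! ### Symmetric multifunctors on `G` and restriction along the units. -/

section SymmetricMulticategory

variable {G : GroupOperad.{w}} {N : Multicategory.{u, v}} [SymmetricStructure G N]

/-- The action of an element of `G(n)` on a multimorphism. -/
def symElt {n : ℕ} (x : G.Op n) {a : Fin n → N.Ob} {b : N.Ob}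
    (f : N.Hom (fun i => a ((G.perm x)⁻¹ i)) b) : N.Hom a b :=
  SymmetricStructure.sym (G := G) (M := N) ⟨x, f⟩

/-- The permutation of `1` is the identity only propositionally, so the two sources differ as terms
and the unit law has to be stated with `≍`. For a constant family the hypothesis is `HEq.rfl`. -/
theorem symElt_one {n : ℕ} {a : Fin n → N.Ob} {b : N.Ob} (f : N.Hom a b)
    (f' : N.Hom (fun i => a ((G.perm (1 : G.Op n))⁻¹ i)) b) (hf : f' ≍ f) :
    symElt (1 : G.Op n) f' = f := by
  refine Eq.trans ?_ (SymmetricStructure.sym_one (G := G) (M := N) f)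
  exact congrArg (SymmetricStructure.sym (G := G) (M := N))
    (CrossHom.ext' rfl (hf.trans (CrossHom.mk'_hom _ _ f).symm))

/-- The source of all compatibilities below: a trivial outer element gives `post_symElt`, trivial
inner elements give `pre_symElt`, and identity multimorphisms give `twist_γ`. -/
theorem symElt_comp {n m : ℕ} {k : Fin n → ℕ} (h : arity k = m) {a : Fin n → N.Ob} {b : N.Ob}
    {c : ∀ i, Fin (k i) → N.Ob} {d : Fin m → N.Ob} (hd : ∀ i s, d (blk h i s) = c i s)
    (u : G.Op n) (f : N.Hom (fun i => a ((G.perm u)⁻¹ i)) b) (v : ∀ i, G.Op (k i))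
    (g : ∀ i, N.Hom (fun s => c i ((G.perm (v i))⁻¹ s)) (a i)) :
    symElt (G.γ h u v) (N.comp (k := fun i => k ((G.perm u)⁻¹ i)) ((arity_perm k _).trans h)
      (c := fun i s => c ((G.perm u)⁻¹ i) ((G.perm (v ((G.perm u)⁻¹ i)))⁻¹ s))
      (fun i s => by rw [G.perm_inv_γ h, hd]) f (fun i => g ((G.perm u)⁻¹ i))) =
      N.comp h hd (symElt u f) (fun i => symElt (v i) (g i)) :=
  SymmetricStructure.sym_comp (G := G) (M := N) h hd ⟨u, f⟩ (fun i => ⟨v i, g i⟩)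

theorem symElt_congr {n : ℕ} {x y : G.Op n} (h : x = y) {a : Fin n → N.Ob} {b : N.Ob}
    {f : N.Hom (fun i => a ((G.perm x)⁻¹ i)) b} {g : N.Hom (fun i => a ((G.perm y)⁻¹ i)) b}
    (hf : f ≍ g) : symElt x f = symElt y g :=
  congrArg (SymmetricStructure.sym (G := G) (M := N)) (CrossHom.ext' h hf)

theorem symElt_mul {n : ℕ} {a : Fin n → N.Ob} {b : N.Ob} (x y : G.Op n)
    (f : N.Hom (fun i => a ((G.perm y)⁻¹ ((G.perm x)⁻¹ i))) b)
    (f' : N.Hom (fun i => a ((G.perm (x * y))⁻¹ i)) b) (hf : f' ≍ f) :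
    symElt y (symElt (a := fun i => a ((G.perm y)⁻¹ i)) x f) = symElt (x * y) f' :=
  (SymmetricStructure.sym_mul (G := G) (M := N) x y f).trans
    (congrArg (SymmetricStructure.sym (G := G) (M := N))
      (CrossHom.ext' rfl ((CrossHom.mk'_hom _ _ f).trans hf.symm)))

/-- The action of `G` commutes with postcomposition. -/
theorem post_symElt {n : ℕ} {a : Fin n → N.Ob} {b c : N.Ob} (g : N.Hom (fun _ : Fin 1 => b) c)
    (x : G.Op n) (f : N.Hom (fun i => a ((G.perm x)⁻¹ i)) b) :
    N.post g (symElt x f) = symElt x (N.post g f) := by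
  -- Here `g` is written as `sym(g, 1)` with `1` in `G(1)`, and `γ(1; x) = x`.
  have h := symElt_comp (N := N) (arity_one_const n) (a := fun _ => b) (c := fun _ s => a s)
    (fun _ _ => by rw [blk_one_const]) (1 : G.Op 1) g (fun _ => x) (fun _ => f)
  rw [symElt_one (G := G) g g HEq.rfl] at h
  have hx : G.γ (arity_one_const n) 1 (fun _ => x) = x := by
    rw [← G.one_eq]; exact G.one_γ _ x
  refine h.symm.trans (symElt_congr hx ?_)
  refine N.comp_heq rfl rfl (fun _ => HEq.rfl) ?_ HEq.rfl (fun _ => HEq.rfl)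
  exact funext fun p => congrArg (fun y => a ((G.perm y)⁻¹ p)) hx

/-- The action of `G` and precomposition. -/
theorem pre_symElt {n : ℕ} {a a' : Fin n → N.Ob} {b : N.Ob}
    (x : G.Op n) (f : N.Hom (fun i => a ((G.perm x)⁻¹ i)) b)
    (g : ∀ i, N.Hom (fun _ : Fin 1 => a' i) (a i)) :
    N.pre (symElt x f) g = symElt x (N.pre f (fun i => g ((G.perm x)⁻¹ i))) := by
  -- Here each `g i` is written as `sym(g i, 1)`, and `γ(x; 1, …, 1) = x`.
  have h := symElt_comp (N := N) (arity_const_one n) (a := a) (c := fun i _ => a' i)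
    (fun _ _ => by rw [blk_const_one]) x f (fun _ => (1 : G.Op 1)) g
  simp only [fun i => symElt_one (G := G) (g i) (g i) HEq.rfl] at h
  have hx : G.γ (arity_const_one n) x (fun _ => 1) = x := by
    rw [← G.one_eq]; exact G.γ_one _ x
  refine h.symm.trans (symElt_congr hx ?_)
  refine N.comp_heq rfl rfl (fun _ => HEq.rfl) ?_ HEq.rfl (fun _ => HEq.rfl)
  exact funext fun p => congrArg (fun y => a' ((G.perm y)⁻¹ p)) hx

variable (G) in
/-- The `G`-symmetric multifunctor on `G` extending a multifunctor on the terminal operad. -/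
def extendUnit (A : Multifunctor trivialOperad.toMulticategory N) :
    Multifunctor G.toMulticategory N where
  obj a := A.obj a
  map {n a b} x := symElt (show G.Op n from x) (a := fun i => A.obj (a i))
    (A.map (a := fun i => a ((G.perm (show G.Op n from x))⁻¹ i)) (b := b) PUnit.unit)
  map_id a := by
    refine Eq.trans ?_ (SymmetricStructure.sym_id (G := G) (M := N) (A.obj a))
    exact congrArg (SymmetricStructure.sym (G := G) (M := N))
      (CrossHom.ext' rfl (heq_of_eq (A.map_id a)))
  map_comp {n m k} h {a b c d} hd x y := by
    refine Eq.trans ?_ (symElt_comp (N := N) h (fun i s => congrArg A.obj (hd i s))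
      (show G.Op n from x) _ (fun i => (show G.Op (k i) from y i)) _)
    refine symElt_congr rfl (heq_of_eq ?_)
    -- Composition in the crossed multicategory permutes the inner multimorphisms by `x⁻¹`, so
    -- multifunctoriality of `A` is needed for the permuted arities.
    exact A.map_comp (k := fun i => k ((G.perm (show G.Op n from x))⁻¹ i)) ((arity_perm k _).trans h)
      (fun _ _ => rfl) (PUnit.unit) (fun _ => PUnit.unit)

/-- In `G` the structure is `sym(x, u) = xu`, so symmetry is exactly the associativity law of the
action on `N`. -/
theorem extendUnit_isSymmetric (A : Multifunctor trivialOperad.toMulticategory N) :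
    Multifunctor.IsSymmetric G (extendUnit G A) := fun φ =>
  (symElt_mul (N := N) (show G.Op _ from φ.hom) φ.elt _ _ HEq.rfl).symm

theorem unit_comp_extendUnit (A : Multifunctor trivialOperad.toMulticategory N) :
    G.unit.comp (extendUnit G A) = A := by
  refine Multifunctor.ext rfl (heq_of_eq ?_)
  funext n a b x
  exact symElt_one (G := G) _ _ HEq.rfl

/-- Since `x = 1 * x = sym(1, x)` in `G`, symmetry recovers the value at `x` from the value at the
unit. Injectivity on objects and fullness of the restriction both rest on this. -/
theorem map_eq_symElt {F : Multifunctor G.toMulticategory N} (hF : Multifunctor.IsSymmetric G F)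
    {n : ℕ} (a : Fin n → PUnit) (b : PUnit) (x : G.Op n) :
    F.map (a := a) (b := b) x = symElt x (a := fun i => F.obj (a i))
      (F.map (a := fun i => a ((G.perm x)⁻¹ i)) (b := b) (1 : G.Op n)) := by
  have h := hF (a := a) (b := b) (⟨x, (1 : G.Op n)⟩ : CrossHom G.toMulticategory G a b)
  exact (congrArg (F.map (a := a) (b := b)) (one_mul x).symm).trans h

theorem extendUnit_unit_comp {F : Multifunctor G.toMulticategory N}
    (hF : Multifunctor.IsSymmetric G F) : extendUnit G (G.unit.comp F) = F := by
  refine Multifunctor.ext rfl (heq_of_eq ?_)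
  funext n a b x
  exact (map_eq_symElt hF a b x).symm

variable (G N)

/-- `extendUnit` is a strict two-sided inverse on objects: both round trips are equalities of
multifunctors. -/
theorem restrictUnit_bijective : Function.Bijective (restrictUnit G N).obj := by
  refine ⟨fun F H h => ?_, fun A => ⟨⟨extendUnit G A, extendUnit_isSymmetric A⟩,
    unit_comp_extendUnit A⟩⟩
  obtain ⟨F, hF⟩ := F
  obtain ⟨H, hH⟩ := H
  have h' : G.unit.comp F = G.unit.comp H := h
  obtain rfl : F = H := by rw [← extendUnit_unit_comp hF, ← extendUnit_unit_comp hH, h']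
  rfl

theorem restrictUnit_full : (restrictUnit G N).Full where
  map_surjective {F H} β := by
    let β' : MultiNatTrans (G.unit.comp F.obj) (G.unit.comp H.obj) := β
    refine ⟨ObjectProperty.homMk (show MultiNatTrans F.obj H.obj from
      { app a := β'.app a
        naturality {n a b} x := ?_ }), rfl⟩
    -- Naturality at `e_n`. Acting by `x` on both sides gives naturality at `x`, since the action
    -- passes through `post` and `pre`; the permutation of the components is harmless because `G`
    -- has a single object.
    have hβ := β'.naturality (n := n) (a := a) (b := b) PUnit.unit
    refine (congrArg (N.post (β'.app b)) (map_eq_symElt F.property a b x)).trans ?_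
    refine Eq.trans ?_ (congrArg (fun f => N.pre f fun i => β'.app (a i))
      (map_eq_symElt H.property a b x)).symm
    refine (post_symElt (β'.app b) (show G.Op n from x) _).trans ?_
    refine Eq.trans ?_ (pre_symElt (show G.Op n from x) _ _).symm
    exact congrArg (symElt (show G.Op n from x)) hβ

theorem restrictUnit_faithful : (restrictUnit G N).Faithful where
  map_injective {F H} α β h := by
    apply ObjectProperty.hom_ext
    apply Multifunctor.hom_ext
    intro a
    exact congrFun (congrArg MultiNatTrans.app h) a

end SymmetricMulticategory

end GrpOpd

namespace GrpOpd

/-! ### The action of `G` on tensor products, as morphisms of `C`. -/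

section Twist

variable {G : GroupOperad.{w}} {C : Type u} [Category.{v} C] [MonoidalCategory C]
  [SymmetricMonoidal G C]

/-- The action of `x` on a tensor product, as a morphism permuting the factors. -/
def twist {n : ℕ} (x : G.Op n) (a : Fin n → C) : tens a ⟶ tens (fun i => a ((G.perm x)⁻¹ i)) :=
  symElt (N := ofMonoidal C) x (a := a) (𝟙 (tens fun i => a ((G.perm x)⁻¹ i)))

/-- A Yoneda argument: `f` is the identity followed by `f`, and the action commutes with
postcomposition. Thus the whole symmetric structure is precomposition with `twist`. -/
theorem symElt_eq_twist {n : ℕ} (x : G.Op n) (a : Fin n → C) {b : C}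
    (f : tens (fun i => a ((G.perm x)⁻¹ i)) ⟶ b) :
    symElt (N := ofMonoidal C) x (a := a) (b := b) f = twist x a ≫ f := by
  have h := post_symElt (N := ofMonoidal C) (tensOne _ ≫ f) x (a := a)
    (𝟙 (tens fun i => a ((G.perm x)⁻¹ i)))
  refine Eq.trans ?_ (h.symm.trans (multiNatTransOf_aux₂ (twist x a) f))
  refine congrArg (symElt (N := ofMonoidal C) x (a := a)) ?_
  exact ((multiNatTransOf_aux₂ (𝟙 _) f).trans (Category.id_comp f)).symm

/-- This is `pre_symElt` at the identity: precomposing by `p` before acting permutes the components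
of `p`. -/
theorem twist_natural {n : ℕ} (x : G.Op n) {a b : Fin n → C} (p : ∀ i, a i ⟶ b i) :
    tensHom p ≫ twist x b = twist x a ≫ tensHom (fun i => p ((G.perm x)⁻¹ i)) := by
  refine (multiNatTransOf_aux₃ (twist x b) p).symm.trans ?_
  refine (pre_symElt (N := ofMonoidal C) x (a := b) (a' := a) _ _).trans ?_
  refine Eq.trans ?_ (symElt_eq_twist x a _)
  refine congrArg (symElt (N := ofMonoidal C) x (a := a)) ?_
  exact (multiNatTransOf_aux₃ (𝟙 _) _).trans (Category.comp_id _)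

theorem twist_const_one {n : ℕ} (X : C) : twist (1 : G.Op n) (fun _ => X) = 𝟙 _ :=
  symElt_one (N := ofMonoidal C) _ _ HEq.rfl

/-- A constant family is fixed by every permutation definitionally, so the twists are endomorphisms
of a tensor power. With `twist_const_one` this makes them an action of the group `G(n)`. -/
theorem twist_const_mul {n : ℕ} (x y : G.Op n) (X : C) :
    twist y (fun _ => X) ≫ twist x (fun _ => X) = twist (x * y) (fun _ => X) :=
  (symElt_eq_twist y (fun _ => X) (twist x fun _ => X)).symm.trans
    (symElt_mul (N := ofMonoidal C) x y (a := fun _ => X) (b := tens (C := C) fun _ : Fin n => X)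
      (CategoryStruct.id (obj := C) _) _ HEq.rfl)

theorem twist_one_eqToHom {n : ℕ} (a : Fin n → C)
    (h : tens a = tens (fun i => a ((G.perm (1 : G.Op n))⁻¹ i))) : twist (1 : G.Op n) a = eqToHom h := by
  have e : (fun i => a ((G.perm (1 : G.Op n))⁻¹ i)) = a := funext fun i => by rw [perm_inv_elt_one]
  refine (symElt_one (N := ofMonoidal C) (a := a) (eqToHom h) _ ?_)
  have : ∀ {b : Fin n → C} (e : b = a) (h : tens a = tens b), 𝟙 (tens b) ≍ eqToHom h := by
    intro b e h; subst e; rfl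
  exact this e h

/-- Evaluate `symElt_comp` at identities: a multicategorical composite of identities of tensor
products is the regrouping `blocks`, so only the twists and the two regroupings remain. -/
theorem twist_γ {n m : ℕ} {k : Fin n → ℕ} (h : arity k = m) (u : G.Op n) (v : ∀ i, G.Op (k i)) (X : C)
    (h' : arity (fun i => k ((G.perm u)⁻¹ i)) = m) :
    twist (G.γ h u v) (fun _ => X) ≫ (blocks h' fun _ => X).hom =
      (blocks h fun _ => X).hom ≫ tensHom (fun i => twist (v i) (fun _ => X)) ≫
        twist u (fun i => tens fun _ : Fin (k i) => X) := by
  have e := symElt_comp (N := ofMonoidal C) h (a := fun i => tens (C := C) fun _ : Fin (k i) => X)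
    (b := tens (C := C) (fun i => tens (C := C) fun _ : Fin (k ((G.perm u)⁻¹ i)) => X)) (c := fun _ _ => X)
    (d := fun _ => X) (fun _ _ => rfl) u (CategoryStruct.id (obj := C) _) v
    (fun i => CategoryStruct.id (obj := C) (tens fun _ : Fin (k i) => X))
  refine Eq.trans ?_ (e.trans ?_)
  · refine (symElt_eq_twist _ _ _).symm.trans ?_
    refine congrArg (symElt (N := ofMonoidal C) (G.γ h u v) (a := fun _ => X)) ?_
    change _ = (blocks h' fun _ => X).hom ≫ tensHom (fun i => 𝟙 _ ≫ 𝟙 _) ≫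
      𝟙 (tens fun i => tens fun _ : Fin (k ((G.perm u)⁻¹ i)) => X)
    simp only [Category.comp_id, tensHom_id]
  · change (blocks h fun _ => X).hom ≫ tensHom (fun i => 𝟙 _ ≫ twist (v i) (fun _ => X)) ≫ twist u _ = _
    simp only [Category.id_comp]

theorem blocks_hom_eqToHom {n m : ℕ} {k k' : Fin n → ℕ} (h : arity k = m) (h' : arity k' = m) (X : C)
    (hk : k = k')
    (e : tens (fun i => tens fun _ : Fin (k i) => X) = tens (fun i => tens fun _ : Fin (k' i) => X)) :
    (blocks h fun _ => X).hom ≫ eqToHom e = (blocks h' fun _ => X).hom := by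
  subst hk; simp

theorem twist_γ_one {n m : ℕ} {k : Fin n → ℕ} (h : arity k = m) (v : ∀ i, G.Op (k i)) (X : C) :
    twist (G.γ h 1 v) (fun _ => X) ≫ (blocks h fun _ => X).hom =
      (blocks h fun _ => X).hom ≫ tensHom (fun i => twist (v i) (fun _ => X)) := by
  have hk : (fun i => k ((G.perm (1 : G.Op n))⁻¹ i)) = k := funext fun i => by rw [perm_inv_elt_one]
  have e : tens (fun i => tens fun _ : Fin (k i) => X) =
      tens (fun i => tens fun _ : Fin (k ((G.perm (1 : G.Op n))⁻¹ i)) => X) :=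
    congrArg (fun l : Fin n → ℕ => tens fun i => tens fun _ : Fin (l i) => X) hk.symm
  have h₁ := twist_γ h 1 v X ((arity_perm _ _).trans h)
  rw [twist_one_eqToHom _ e] at h₁
  -- `twist_γ` with `u = 1` lands in blocks indexed through the permutation of `1`, which is only
  -- propositionally the identity; the comparison is an isomorphism and is cancelled.
  refine (cancel_mono (eqToHom e)).1 ?_
  rw [Category.assoc, Category.assoc, blocks_hom_eqToHom h ((arity_perm _ _).trans h) X hk.symm e, h₁]

/-- The pure block permutation. It makes the functor of a monoid respect composition (`merge_twist`)
and the symmetric structure (`μTens_lift_theta`). -/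
theorem twist_γ_const_one {n m : ℕ} {k : Fin n → ℕ} (h : arity k = m) (u : G.Op n) (X : C)
    (h' : arity (fun i => k ((G.perm u)⁻¹ i)) = m) :
    twist (G.γ h u fun _ => 1) (fun _ => X) ≫ (blocks h' fun _ => X).hom =
      (blocks h fun _ => X).hom ≫ twist u (fun i => tens fun _ : Fin (k i) => X) := by
  rw [twist_γ]
  simp only [twist_const_one, tensHom_id]
  congr 1
  exact Category.id_comp _

end Twist

/-! ### Block decompositions of tensor powers of one object. -/

section Blocks

variable {C : Type u} [Category.{v} C] [MonoidalCategory C]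

theorem blocks_succ {n q : ℕ} (k : Fin (n + 1) → ℕ) (h : arity (fun i => k i.succ) = q)
    (d : Fin (q + k 0) → C) :
    (blocks (k := k) (congrArg (· + k 0) h) d).hom = (split q (k 0) d).hom ≫
      tens (fun s : Fin (k 0) => d (lft q s)) ◁ (blocks h fun t => d (t.addNat (k 0))).hom := by
  subst h; rfl

/-- The recursion for `blocks` with a tail length `q` that need not literally be an `arity`; the
lengths of objects of the total category are of this kind. -/
theorem blocks_const_succ {n q : ℕ} (k : Fin (n + 1) → ℕ) (h : arity (fun i => k i.succ) = q)
    (h' : arity k = q + k 0) (X : C) :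
    (blocks (k := k) h' fun _ => X).hom = (split q (k 0) fun _ => X).hom ≫
      tens (fun _ : Fin (k 0) => X) ◁ (blocks h fun _ => X).hom :=
  blocks_succ k h _

theorem blocks_one {m : ℕ} (h : arity (fun _ : Fin 1 => m) = m) (X : C) :
    (blocks h fun _ => X).hom ≫ tensOne (tens fun _ : Fin m => X) = 𝟙 _ := by
  refine Eq.trans ?_ (blocks_one_const h fun _ => X)
  congr 1
  refine (Category.id_comp _).symm.trans ?_
  congr 1
  exact (tensHom_id _).symm

/-- `tens` always ends in a unit factor, so a decomposition into two blocks is `P ⊗ (Q ⊗ 𝟙)`.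
Removing the unit gives the binary cut `split`, which serves as the monoidal structure below. -/
theorem blocks_two (p q : ℕ) (X : C) :
    (blocks (arity_two p q) fun _ => X).hom ≫
      tens (fun _ : Fin p => X) ◁ tensOne (tens fun _ : Fin q => X) = (split q p fun _ => X).hom := by
  have h := blocks_const_succ (Fin.cons p fun _ => q : Fin 2 → ℕ) (arity_one_const q) (arity_two p q) X
  refine (congrArg (· ≫ _) h).trans ?_
  refine (Category.assoc _ _ _).trans ?_
  refine Eq.trans ?_ (Category.comp_id _)
  refine congrArg ((split q p fun _ => X).hom ≫ ·) ?_
  refine (MonoidalCategory.whiskerLeft_comp _ _ _).symm.trans ?_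
  refine Eq.trans ?_ (MonoidalCategory.whiskerLeft_id _ _)
  exact congrArg _ (blocks_one _ X)

theorem blocks_const_one_const {n : ℕ} (h : arity (fun _ : Fin n => 1) = n) (X : C) :
    (blocks h fun _ => X).hom ≫ tensHom (fun _ => tensOne X) = 𝟙 _ := by
  refine Eq.trans ?_ (blocks_const_one h fun _ => X)
  congr 2
  funext i
  exact (Category.id_comp _).symm

end Blocks

end GrpOpd

namespace GrpOpd

/-! ### Multiplying the factors of a power of a monoid blockwise. -/

section Merge

variable {C : Type u} [Category.{v} C] [MonoidalCategory C]

namespace MonoidIn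

variable (A : MonoidIn C)

/-- The underlying object of a monoid. -/
def carrier : C := A.obj PUnit.unit

/-- The `n`-fold multiplication of a monoid. -/
def mulTens (n : ℕ) : tens (fun _ : Fin n => carrier A) ⟶ carrier A :=
  A.map (a := fun _ => PUnit.unit) (b := PUnit.unit) PUnit.unit

theorem mulTens_one : mulTens A 1 = tensOne (carrier A) := A.map_id PUnit.unit

/-- Generalised associativity: in the terminal operad a composite of the unique operations is again
the unique operation, and `A` preserves this composite. -/
theorem mulTens_arity {n m : ℕ} {k : Fin n → ℕ} (h : arity k = m) :
    mulTens A m = (blocks h fun _ => carrier A).hom ≫ tensHom (fun i => mulTens A (k i)) ≫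
      mulTens A n := by
  refine (A.map_comp h (a := fun _ => PUnit.unit) (b := PUnit.unit) (c := fun _ _ => PUnit.unit)
    (d := fun _ => PUnit.unit) (fun _ _ => rfl) PUnit.unit fun _ => PUnit.unit).trans ?_
  change _ ≫ tensHom (fun i => 𝟙 _ ≫ mulTens A (k i)) ≫ _ = _
  simp only [Category.id_comp]
  rfl

/-- Multiplying the factors in each block. -/
def merge {n m : ℕ} {k : Fin n → ℕ} (h : arity k = m) :
    tens (fun _ : Fin m => carrier A) ⟶ tens (fun _ : Fin n => carrier A) :=
  (blocks h fun _ => carrier A).hom ≫ tensHom (fun i => mulTens A (k i))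

theorem merge_congr {n m : ℕ} {k k' : Fin n → ℕ} (h : arity k = m) (h' : arity k' = m)
    (hk : ∀ i, k i = k' i) : merge A h = merge A h' := by
  obtain rfl : k = k' := funext hk
  rfl

theorem merge_one {m : ℕ} {k : Fin m → ℕ} (h : arity k = m) (hk : ∀ i, k i = 1) : merge A h = 𝟙 _ := by
  obtain rfl : k = fun _ => 1 := funext hk
  rw [merge]
  simp only [mulTens_one]
  exact blocks_const_one_const h (carrier A)

/-- Merging is local: after cutting along a coarser decomposition it takes place inside each piece.
The content is naturality of `blocks` together with the coherence statement `blocks_blocks`. -/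
theorem merge_blocks {n m q : ℕ} {k : Fin n → ℕ} (hm : arity k = m) {l : Fin m → ℕ} (hl : arity l = q)
    {r : Fin n → ℕ} (hr : ∀ i, arity (fun s => l (blk hm i s)) = r i) (hq : arity r = q) :
    merge A hl ≫ (blocks hm fun _ => carrier A).hom =
      (blocks hq fun _ => carrier A).hom ≫ tensHom (fun i => merge A (hr i)) := by
  have h := blocks_blocks hm hl hr hq (fun _ => carrier A)
  rw [merge, Category.assoc, blocks_natural, reassoc_of% h, ← tensHom_comp]
  congr 2
  funext i
  refine (Category.assoc _ _ _).trans ?_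
  refine congrArg ((blocks (hr i) fun _ => carrier A).hom ≫ ·) ?_
  refine (congrArg (· ≫ _) (tensHom_id _)).trans (Category.id_comp _)

/-- Localise the first merge with `merge_blocks`; inside each block, merging and then multiplying is
one multiplication by `mulTens_arity`. This is functoriality of `A^{⊗n}` for order-preserving maps.
-/
theorem merge_merge {n m q : ℕ} {k : Fin n → ℕ} (hm : arity k = m) {l : Fin m → ℕ} (hl : arity l = q)
    {r : Fin n → ℕ} (hr : ∀ i, arity (fun s => l (blk hm i s)) = r i) (hq : arity r = q) :
    merge A hl ≫ merge A hm = merge A hq := by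
  rw [merge.eq_1 A hm, ← Category.assoc, merge_blocks A hm hl hr hq, Category.assoc, ← tensHom_comp,
    merge.eq_1 A hq]
  congr 2
  funext i
  rw [mulTens_arity A (hr i), merge, Category.assoc]

/-- Naturality moves `u` before the multiplications, where it permutes whole blocks, that is, acts
as `γ(u; e, …, e)`. This is the exchange `(id, u) ∘ (φ, 1) = (φ^u, φ^*(u))` of the total category,
realised in `C`. -/
theorem merge_twist {G : GroupOperad.{w}} [SymmetricMonoidal G C] {n m : ℕ} {k : Fin n → ℕ}
    (h : arity k = m) (u : G.Op n) (h' : arity (fun i => k ((G.perm u)⁻¹ i)) = m) :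
    merge A h ≫ twist u (fun _ => carrier A) =
      twist (G.γ h u fun _ => 1) (fun _ => carrier A) ≫ merge A h' := by
  rw [merge, merge, Category.assoc, twist_natural, ← Category.assoc, ← Category.assoc,
    twist_γ_const_one h u _ h']

end MonoidIn

end Merge

/-! ### Associativity and unit laws for cutting a tensor power in two. -/

section SplitCoherence

variable {C : Type u} [Category.{v} C] [MonoidalCategory C]

theorem tens_const_congr {m n : ℕ} (h : m = n) (X : C) :
    tens (fun _ : Fin m => X) = tens (fun _ : Fin n => X) := by rw [h]

/-- Relabelling along an equality of lengths peels off one factor at a time, which drives the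
inductions on the length of the first block below. -/
theorem eqToHom_tens_succ {m n : ℕ} (h : m = n) (X : C) (h' : m + 1 = n + 1) :
    eqToHom (tens_const_congr h' X) = X ◁ eqToHom (tens_const_congr h X) := by
  subst h
  exact (MonoidalCategory.whiskerLeft_id _ _).symm

theorem eqToHom_blocks {n m m' : ℕ} {k : Fin n → ℕ} (h : arity k = m) (h' : arity k = m')
    (e : m = m') (X : C) :
    eqToHom (tens_const_congr e X) ≫ (blocks h' fun _ => X).hom = (blocks h fun _ => X).hom := by
  subst e
  exact Category.id_comp _

theorem split_assoc_aux {X S P Q R T U V : C} (e : S ⟶ T) (s : S ⟶ P ⊗ R) (t : P ⟶ Q ⊗ U) (s' : T ⟶ Q ⊗ V)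
    (t' : V ⟶ U ⊗ R) (h : s ≫ t ▷ R ≫ (α_ _ _ _).hom = e ≫ s' ≫ Q ◁ t') :
    (X ◁ s ≫ (α_ _ _ _).inv) ≫ (X ◁ t ≫ (α_ _ _ _).inv) ▷ R ≫ (α_ _ _ _).hom =
      X ◁ e ≫ (X ◁ s' ≫ (α_ _ _ _).inv) ≫ (X ⊗ Q) ◁ t' := by
  have h₁ : (X ◁ s ≫ (α_ _ _ _).inv) ≫ (X ◁ t ≫ (α_ _ _ _).inv) ▷ R ≫ (α_ _ _ _).hom =
      X ◁ (s ≫ t ▷ R ≫ (α_ _ _ _).hom) ≫ (α_ _ _ _).inv := by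
    simp
  rw [h₁, h]
  simp

/-- Induction on the first block, whose length `p` is the last summand in `q + p`; the inductive
step is the identity `split_assoc_aux`, valid in any monoidal category. The relabelling records that
the two bracketings of the sum of lengths are not definitionally equal. -/
theorem split_assoc (r q p : ℕ) (X : C) :
    (split r (q + p) fun _ => X).hom ≫ (split q p fun _ => X).hom ▷ tens (fun _ : Fin r => X) ≫
        (α_ _ _ _).hom =
      eqToHom (tens_const_congr (Nat.add_assoc r q p).symm X) ≫ (split (r + q) p fun _ => X).hom ≫
        tens (fun _ : Fin p => X) ◁ (split r q fun _ => X).hom := by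
  induction p with
  | zero =>
    have h : ∀ {S Q R : C} (s : S ⟶ Q ⊗ R), s ≫ (λ_ Q).inv ▷ R ≫ (α_ _ _ _).hom =
        𝟙 S ≫ (λ_ S).inv ≫ 𝟙_ C ◁ s := by
      intros; simp
    exact h _
  | succ p ih =>
    rw [eqToHom_tens_succ (Nat.add_assoc r q p).symm X (Nat.add_assoc r q (p + 1)).symm]
    exact split_assoc_aux _ _ _ _ _ ih

/-- Cutting off an empty last block. The corresponding cut at the front is a left unitor by
definition, whereas here `0 + p = p` needs a relabelling and an induction. -/
theorem split_right_unit (p : ℕ) (X : C) :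
    (ρ_ (tens fun _ : Fin p => X)).inv =
      eqToHom (tens_const_congr (Nat.zero_add p).symm X) ≫ (split 0 p fun _ => X).hom := by
  induction p with
  | zero =>
    have h : (ρ_ (𝟙_ C)).inv = 𝟙 _ ≫ (λ_ (𝟙_ C)).inv := by
      rw [Category.id_comp, unitors_inv_equal]
    exact h
  | succ p ih =>
    rw [eqToHom_tens_succ (Nat.zero_add p).symm X (Nat.zero_add (p + 1)).symm]
    have h : ∀ {S T : C} (e : S ⟶ T) (s : T ⟶ S ⊗ 𝟙_ C), (ρ_ S).inv = e ≫ s →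
        (ρ_ (X ⊗ S)).inv = X ◁ e ≫ X ◁ s ≫ (α_ _ _ _).inv := by
      intro S T e s h
      rw [← whiskerLeft_comp_assoc, ← h]
      simp
    exact h _ _ ih

end SplitCoherence

end GrpOpd

namespace GrpOpd

open Aug

/-! ### The symmetric monoidal functor of a monoid. -/

section FreeLift

variable {G : GroupOperad.{w}} {C : Type u} [Category.{v} C] [MonoidalCategory C]
  [SymmetricMonoidal G C]

namespace MonoidIn

variable (A : MonoidIn C)

/-- The action on morphisms of the `G`-symmetric monoidal functor of a monoid. -/
noncomputable def liftMap {a b : G.Aug} (f : a ⟶ b) :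
    tens (fun _ : Fin (len a) => carrier A) ⟶ tens (fun _ : Fin (len b) => carrier A) :=
  twist (el f) (fun _ => carrier A) ≫ merge A (arity_fib (mp f))

theorem liftMap_of_el_one {a b : G.Aug} (f : a ⟶ b) (h : el f = 1) :
    liftMap A f = merge A (arity_fib (mp f)) := by
  rw [liftMap, h, twist_const_one, Category.id_comp]

theorem liftMap_tw (a : G.Aug) (x : G.Op (len a)) :
    liftMap A (tw a x) = twist x (fun _ => carrier A) := by
  have h : merge A (arity_fib (mp (tw a x))) = 𝟙 _ := merge_one A _ fun i => fib_id i
  rw [liftMap, h, Category.comp_id]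
  rfl

/-- Each factor is a twist followed by a merge. Exchanging the middle merge and twist by
`merge_twist` brings the two twists together, giving the element of the composite, and the two
merges together, along the fibres computed in `fib_mp_comp`. -/
theorem liftMap_comp {a b c : G.Aug} (f : a ⟶ b) (g : b ⟶ c) :
    liftMap A (f ≫ g) = liftMap A f ≫ liftMap A g := by
  have h' := (arity_perm (fib (mp f)) (G.perm (el g))⁻¹).trans (arity_fib (mp f))
  have h := merge_merge A (arity_fib (mp g)) h' (fun j => (fib_mp_comp f g j).symm)
    (arity_fib (mp (f ≫ g)))
  rw [liftMap, liftMap, liftMap, Category.assoc, ← Category.assoc (merge A _) (twist _ _),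
    merge_twist A (arity_fib (mp f)) (el g) h', Category.assoc, h, ← Category.assoc (twist _ _),
    twist_const_mul, el_comp]

/-- A morphism that preserves blocks acts blockwise: `merge_blocks` handles its map and
`twist_γ_one` its element `γ(1; x_1, …, x_n)`. Two blocks give compatibility with the tensor
product. -/
theorem liftMap_blocks {a b : G.Aug} (f : a ⟶ b) {n : ℕ} {k k' : Fin n → ℕ} (h : arity k = len a)
    (h' : arity k' = len b) (φ : ∀ i, Fin (k i) → Fin (k' i))
    (hφ : ∀ i s, mp f (blk h i s) = blk h' i (φ i s)) (x : ∀ i, G.Op (k i)) (hx : el f = G.γ h 1 x) :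
    liftMap A f ≫ (blocks h' fun _ => carrier A).hom =
      (blocks h fun _ => carrier A).hom ≫
        tensHom (fun i => twist (x i) (fun _ => carrier A) ≫ merge A (arity_fib (φ i))) := by
  have hf := fib_concat h h' (mp f) φ hφ
  have hr : ∀ i, arity (fun s => fib (mp f) (blk h' i s)) = k i := fun i =>
    (congrArg arity (funext fun s => hf i s)).trans (arity_fib (φ i))
  have e : ∀ i, merge A (hr i) = merge A (arity_fib (φ i)) := fun i => merge_congr A _ _ (hf i)
  rw [liftMap, hx, Category.assoc, merge_blocks A h' (arity_fib (mp f)) hr h, ← Category.assoc,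
    twist_γ_one, Category.assoc, ← tensHom_comp]
  simp only [e]

theorem liftMap_tensorHom {a b a' b' : G.Aug} (f : a ⟶ b) (f' : a' ⟶ b') :
    liftMap A (f ⊗ₘ f') ≫ (split (len b') (len b) fun _ => carrier A).hom =
      (split (len a') (len a) fun _ => carrier A).hom ≫ (liftMap A f ⊗ₘ liftMap A f') := by
  have h := liftMap_blocks A (f ⊗ₘ f') (arity_two (len a) (len a')) (arity_two (len b) (len b'))
    (pairMap (mp f) (mp f')) (join_blk (mp f) (mp f')) (Fin.cons (el f) fun _ => el f') rfl
  -- Removes the trailing unit factor, to pass from two-block `blocks` to `split` by `blocks_two`.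
  have e : ∀ {P P' Q Q' : C} (s : P ⟶ P') (t : Q ⟶ Q'),
      (s ⊗ₘ (t ⊗ₘ 𝟙 (𝟙_ C))) ≫ P' ◁ (ρ_ Q').hom = P ◁ (ρ_ Q).hom ≫ (s ⊗ₘ t) := by
    intro P P' Q Q' s t
    rw [← MonoidalCategory.id_tensorHom, ← MonoidalCategory.id_tensorHom, tensorHom_comp_tensorHom,
      tensorHom_comp_tensorHom]
    simp
  rw [← blocks_two, ← blocks_two]
  refine (Category.assoc _ _ _).symm.trans ((congrArg (· ≫ _) h).trans ?_)
  refine (Category.assoc _ _ _).trans (Eq.trans ?_ (Category.assoc _ _ _).symm)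
  exact congrArg ((blocks (arity_two (len a) (len a')) fun _ => carrier A).hom ≫ ·)
    (e (liftMap A f) (liftMap A f'))

variable (G)

/-- The functor of a monoid, sending `⟨n⟩` to the `n`-fold tensor product. -/
noncomputable def lift : G.Aug ⥤ C where
  obj a := tens (fun _ : Fin (len a) => carrier A)
  map f := liftMap A f
  map_id a := by
    have h : liftMap A (𝟙 a) = twist (1 : G.Op (len a)) (fun _ => carrier A) := liftMap_tw A a 1
    rw [h, twist_const_one]
  map_comp f g := liftMap_comp A f g

theorem lift_map_eqToHom {a b : G.Aug} (h : a = b) :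
    (lift G A).map (eqToHom h) = eqToHom (tens_const_congr (congrArg len h) (carrier A)) :=
  eqToHom_map (lift G A) h

/-- The monoidal structure on the functor of a monoid. -/
noncomputable def liftCore : (lift G A).CoreMonoidal :=
  -- The axioms are checked in oplax form because `split`, the inverse of the tensorator, is the map
  -- with a recursive definition.
  Functor.CoreMonoidal.mk'
    (εIso := Iso.refl (𝟙_ C))
    (μIso := fun a b => (split (len b) (len a) fun _ => carrier A).symm)
    (μIso_inv_natural_left := fun {a b} f c => by
      have h := liftMap_tensorHom A f (𝟙 c)
      have h₁ : liftMap A (𝟙 c) = 𝟙 _ := (lift G A).map_id c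
      rw [h₁, MonoidalCategory.tensorHom_id, MonoidalCategory.tensorHom_id] at h
      exact h.symm)
    (μIso_inv_natural_right := fun {a b} c f => by
      have h := liftMap_tensorHom A (𝟙 c) f
      have h₁ : liftMap A (𝟙 c) = 𝟙 _ := (lift G A).map_id c
      rw [h₁, MonoidalCategory.id_tensorHom, MonoidalCategory.id_tensorHom] at h
      exact h.symm)
    (oplax_associativity := fun a b c =>
      (split_assoc (len c) (len b) (len a) (carrier A)).trans
        (congrArg (· ≫ _) (lift_map_eqToHom G A (assoc_ob a b c)).symm))
    (oplax_left_unitality := fun a => by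
      have h : (λ_ (tens fun _ : Fin (len a) => carrier A)).inv =
          (lift G A).map (λ_ a).inv ≫ (λ_ (tens fun _ : Fin (len a) => carrier A)).inv ≫
            (𝟙 (𝟙_ C) ▷ _) := by
        -- `len a + 0` reduces to `len a`, so this relabelling is an identity on the nose; the right
        -- unit has length `0 + len a` and relies on `split_right_unit`.
        have : (lift G A).map (λ_ a).inv = 𝟙 _ := lift_map_eqToHom G A (left_ob a).symm
        refine Eq.trans ?_ (congrArg (· ≫ _) this).symm
        refine Eq.trans ?_ (Category.id_comp _).symm
        exact ((congrArg ((λ_ _).inv ≫ ·) (MonoidalCategory.id_whiskerRight _ _)).trans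
          (Category.comp_id _)).symm
      exact h)
    (oplax_right_unitality := fun a => by
      have h : (ρ_ (tens fun _ : Fin (len a) => carrier A)).inv =
          (lift G A).map (ρ_ a).inv ≫ (split 0 (len a) fun _ => carrier A).hom ≫
            (_ ◁ 𝟙 (𝟙_ C)) := by
        have : (lift G A).map (ρ_ a).inv = _ := lift_map_eqToHom G A (right_ob a).symm
        refine Eq.trans ?_ (congrArg (· ≫ _) this).symm
        refine (split_right_unit (len a) (carrier A)).trans (congrArg (eqToHom _ ≫ ·) ?_)
        exact ((congrArg ((split 0 (len a) fun _ => carrier A).hom ≫ ·)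
          (MonoidalCategory.whiskerLeft_id _ _)).trans (Category.comp_id _)).symm
      exact h)

noncomputable instance liftMonoidal : (lift G A).Monoidal := (liftCore G A).toMonoidal

/-- Both maps follow the same recursion, one built from `split` and the other from its inverse. As
`blocks` is an isomorphism, this identifies the iterated tensorator as its inverse. -/
theorem μTens_lift_blocks {n : ℕ} (a : Fin n → G.Aug) :
    μTens (lift G A) a ≫ (blocks (len_tens a) fun _ => carrier A).hom = 𝟙 _ := by
  induction n with
  | zero => exact Category.comp_id _
  | succ n ih =>
    have h : ∀ {P Q R S : C} (m : Q ⟶ R) (s : S ≅ P ⊗ R) (t : R ⟶ Q), m ≫ t = 𝟙 _ →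
        (P ◁ m ≫ s.inv) ≫ s.hom ≫ P ◁ t = 𝟙 _ := by
      intro P Q R S m s t h
      simp [← MonoidalCategory.whiskerLeft_comp, h]
    refine (congrArg (μTens (lift G A) a ≫ ·) (blocks_const_succ (fun i => len (a i))
      (len_tens fun i => a i.succ) (len_tens a) (carrier A))).trans ?_
    exact h _ _ _ (ih fun i => a i.succ)

/-- The symmetry of the lift. Replacing the tensorators by inverses of `blocks` turns it into the
block permutation identity `twist_γ_const_one`, because `theta u a` carries the element `γ(u; e, …,
e)`. -/
theorem μTens_lift_theta {n : ℕ} (u : G.Op n) (a : Fin n → G.Aug) :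
    μTens (lift G A) a ≫ (lift G A).map (theta u a) =
      twist u (fun i => (lift G A).obj (a i)) ≫ μTens (lift G A) (fun i => a ((G.perm u)⁻¹ i)) := by
  have h' : arity (fun i => len (a ((G.perm u)⁻¹ i))) = len (tens a) :=
    (arity_perm (fun i => len (a i)) _).trans (len_tens a)
  have e : (lift G A).map (theta u a) =
      twist (G.γ (len_tens a) u fun _ => 1) (fun _ => carrier A) ≫
        eqToHom (tens_const_congr (congrArg len (theta_ob u a)) (carrier A)) := by
    rw [theta, Functor.map_comp, lift_map_eqToHom]
    exact congrArg (· ≫ _) (liftMap_tw A (tens a) _)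
  have h : ∀ {T T' P Q : C} (M : T ⟶ P) (f : P ⟶ Q) (t : T ⟶ T') (M' : T' ⟶ Q) (b : P ⟶ T)
      (b' : Q ≅ T'), M ≫ b = 𝟙 _ → M' ≫ b'.hom = 𝟙 _ → f ≫ b'.hom = b ≫ t → M ≫ f = t ≫ M' := by
    intro T T' P Q M f t M' b b' h₁ h₂ h₃
    rw [← cancel_mono b'.hom, Category.assoc, Category.assoc, h₂, h₃, ← Category.assoc, h₁]
    simp
  refine h _ _ _ _ (blocks (len_tens a) fun _ => carrier A).hom
    (blocks (len_tens fun i => a ((G.perm u)⁻¹ i)) fun _ => carrier A) (μTens_lift_blocks G A a)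
    (μTens_lift_blocks G A _) ?_
  refine (congrArg (· ≫ _) e).trans ((Category.assoc _ _ _).trans ?_)
  refine (congrArg (_ ≫ ·) (eqToHom_blocks h' (len_tens fun i => a ((G.perm u)⁻¹ i))
    (congrArg len (theta_ob u a)) (carrier A))).trans ?_
  exact twist_γ_const_one (len_tens a) u _ h'

end MonoidIn

end FreeLift

end GrpOpd

namespace GrpOpd

open Aug

/-! ### Generators for the morphisms between tensor powers of `⟨1⟩`. -/

section Decomposition

variable {G : GroupOperad.{w}}

namespace Aug

theorem fib_muHom {n : ℕ} (x : G.Op n) (s : Fin (len (ob 1 : G.Aug))) : fib (mp (muHom x)) s = n := by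
  have h := arity_fib (mp (muHom x))
  have h₁ : arity (fib (mp (muHom x))) = fib (mp (muHom x)) s := by
    refine (Nat.zero_add _).trans (congrArg (fib (mp (muHom x))) ?_)
    exact Subsingleton.elim (α := Fin 1) _ _
  exact h₁.symm.trans (h.trans ((len_tens _).symm.trans (arity_const_one n)))

/-- Each morphism between tensor powers of `⟨1⟩` is a permutation of the factors followed by a tensor
product of multiplications. -/
theorem exists_eq_theta_comp {m n : ℕ}
    (f : tens (fun _ : Fin m => (ob 1 : G.Aug)) ⟶ tens (fun _ : Fin n => (ob 1 : G.Aug))) :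
    ∃ (x : G.Op m) (k : Fin n → ℕ) (h : arity k = m), f = theta x (fun _ => ob 1) ≫
      (blocks h fun _ => ob 1).hom ≫ tensHom (fun i => muHom (1 : G.Op (k i))) := by
  have hm : len (tens fun _ : Fin m => (ob 1 : G.Aug)) = m :=
    (len_tens _).symm.trans (arity_const_one m)
  obtain ⟨x, hx⟩ : ∃ x : G.Op m, sg f = ⟨m, x⟩ := by
    -- The source of `f` has length `m` only propositionally, so its element is transported to
    -- `G(m)`.
    have : ∀ p (y : G.Op p), p = m → ∃ x : G.Op m, (⟨p, y⟩ : (n : ℕ) × G.Op n) = ⟨m, x⟩ := by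
      rintro p y rfl
      exact ⟨y, rfl⟩
    exact this _ (el f) hm
  -- The fibre sizes of the underlying map; the `i`-th factor of the target is a single point, hence
  -- the position `0` in its block.
  let k : Fin n → ℕ := fun i => fib (mp f) (blk (len_tens fun _ : Fin n => (ob 1 : G.Aug)) i (0 : Fin 1))
  have hk : arity k = m := by
    refine Eq.trans ?_ ((arity_assoc (len_tens fun _ : Fin n => (ob 1 : G.Aug)) (fib (mp f))).trans
      ((arity_fib (mp f)).trans hm))
    exact congrArg arity (funext fun i => (Nat.zero_add _).symm)
  refine ⟨x, k, hk, ext_fib (fun j => ?_) (el_eq ?_)⟩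
  · obtain ⟨i, s, rfl⟩ := blk_surj (len_tens fun _ : Fin n => (ob 1 : G.Aug)) j
    obtain rfl : s = (0 : Fin 1) := Subsingleton.elim (α := Fin 1) _ _
    obtain ⟨h₀, h₁⟩ := isTriv_blocks hk fun _ => (ob 1 : G.Aug)
    rw [theta, Category.assoc, mp_tw_comp, h₁, fib_eqToHom_comp]
    refine Eq.trans ?_ (((fib_eqToHom_comp h₀ (tensHom fun i => muHom (1 : G.Op (k i))) _).trans
      (fib_tensHom (fun i => muHom (1 : G.Op (k i))) i (0 : Fin 1))).symm)
    exact (fib_muHom (1 : G.Op (k i)) (0 : Fin 1)).symm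
  -- Everything after the permutation has trivial element, so the element of the composite is that
  -- of `theta x`.
  · have hg : el (eqToHom (theta_ob x fun _ => (ob 1 : G.Aug)) ≫
        (blocks hk fun _ => (ob 1 : G.Aug)).hom ≫ tensHom (fun i => muHom (1 : G.Op (k i)))) = 1 := by
      refine eq_of_sig ((sg_eqToHom_comp _ _).trans (((isTriv_blocks hk _).sg_comp _).trans
        ((sg_tensHom _).trans ?_)))
      simp only [sg_muHom]
      exact (sigγ_one_one G hk).trans (heq_sig hm.symm)
    refine hx.trans ((sigγ_one G x).symm.trans ?_)
    refine (sigγ_eq G (len_tens fun _ : Fin m => (ob 1 : G.Aug)) x fun _ => 1).symm.trans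
      (congrArg (Sigma.mk _) ?_)
    rw [theta, Category.assoc, el_tw_comp, hg, one_mul]

theorem eq_tens_ob_one (a : G.Aug) : a = tens (fun _ : Fin (len a) => (ob 1 : G.Aug)) :=
  (ob_tens_one (len a)).symm

/-- All coherence morphisms of the total category are trivial, so any two parallel ones agree; this
settles coherence questions in the source category. -/
theorem IsTriv.eq {a b : G.Aug} {f g : a ⟶ b} (hf : IsTriv f) (hg : IsTriv g) : f = g := by
  obtain ⟨_, rfl⟩ := hf
  obtain ⟨_, rfl⟩ := hg
  rfl

end Aug

end Decomposition

/-! ### Extending a morphism of monoids to a monoidal transformation. -/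

section SymmetricFunctor

variable {G : GroupOperad.{w}} {C : Type u} [Category.{v} C] [MonoidalCategory C]
  [SymmetricMonoidal G C]

/-- Both symmetric structures are precompositions, with `theta` and with `twist`. It therefore
suffices to test symmetry on identity multimorphisms; postcomposing with `F.map f` gives the general
case. -/
theorem isSymmetric_multifunctorOf_iff (F : G.Aug ⥤ C) [F.LaxMonoidal] :
    Multifunctor.IsSymmetric G (multifunctorOf F) ↔ ∀ {n : ℕ} (u : G.Op n) (a : Fin n → G.Aug),
      μTens F a ≫ F.map (theta u a) =
        twist u (fun i => F.obj (a i)) ≫ μTens F (fun i => a ((G.perm u)⁻¹ i)) := by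
  refine ⟨fun h n u a => ?_, fun h n a b φ => ?_⟩
  · have e := h (a := a) (b := tens (C := G.Aug) fun i => a ((G.perm u)⁻¹ i))
      (⟨u, CategoryStruct.id (obj := G.Aug) _⟩ : CrossHom (ofMonoidal G.Aug) G a _)
    have e₁ : μTens F a ≫ F.map (theta u a ≫ 𝟙 _) = twist u (fun i => F.obj (a i)) ≫
        μTens F (fun i => a ((G.perm u)⁻¹ i)) ≫ F.map (𝟙 _) :=
      e.trans (symElt_eq_twist u (fun i => F.obj (a i)) _)
    simpa only [Category.comp_id, F.map_id] using e₁
  · refine Eq.trans ?_ (symElt_eq_twist φ.elt (fun i => F.obj (a i)) _).symm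
    have e : ∀ {a : Fin n → G.Aug} {b : G.Aug} (u : G.Op n) (f : tens (fun i => a ((G.perm u)⁻¹ i)) ⟶ b),
        μTens F a ≫ F.map (theta u a ≫ f) = twist u (fun i => F.obj (a i)) ≫
          μTens F (fun i => a ((G.perm u)⁻¹ i)) ≫ F.map f := by
      intro a b u f
      rw [F.map_comp, ← Category.assoc, h u a, Category.assoc]
    exact e φ.elt φ.hom

/-- Up to the tensorators, `F` on a morphism in normal form is expressed by the twist, the
regrouping and the multiplications of `F⟨1⟩`. This is why `F` carries no more information than that
monoid. -/
theorem μTens_map_theta_comp (F : SymMonoidalFunctor G G.Aug C) {m n : ℕ} (x : G.Op m)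
    {k : Fin n → ℕ} (h : arity k = m) :
    μTens F.toFunctor (fun _ : Fin m => ob 1) ≫ F.toFunctor.map (theta x (fun _ => ob 1) ≫
      (blocks h fun _ => ob 1).hom ≫ tensHom (fun i => muHom (1 : G.Op (k i)))) =
    twist x (fun _ => F.toFunctor.obj (ob 1)) ≫ (blocks h fun _ => F.toFunctor.obj (ob 1)).hom ≫
      tensHom (fun i => μTens F.toFunctor (fun _ => ob 1) ≫
        F.toFunctor.map (muHom (1 : G.Op (k i)))) ≫ μTens F.toFunctor (fun _ : Fin n => ob 1) := by
  have hF := (isSymmetric_multifunctorOf_iff F.toFunctor).1 F.isSymmetric x fun _ => ob 1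
  rw [Functor.map_comp, Functor.map_comp, reassoc_of% hF, ← reassoc_of% (μTens_blocks F.toFunctor h),
    ← μTens_natural, tensHom_comp_assoc]

variable (F H : SymMonoidalFunctor G G.Aug C)

/-- The extension to the tensor powers of `⟨1⟩` of a morphism defined on `⟨1⟩`. -/
noncomputable def powerApp (f : F.toFunctor.obj (ob 1) ⟶ H.toFunctor.obj (ob 1)) (n : ℕ) :
    F.toFunctor.obj (tens fun _ : Fin n => ob 1) ⟶ H.toFunctor.obj (tens fun _ : Fin n => ob 1) :=
  have := isIso_μTens F.toFunctor (fun _ : Fin n => (ob 1 : G.Aug))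
  inv (μTens F.toFunctor fun _ => ob 1) ≫ tensHom (fun _ => f) ≫ μTens H.toFunctor fun _ => ob 1

variable {F H}

theorem μTens_powerApp (f : F.toFunctor.obj (ob 1) ⟶ H.toFunctor.obj (ob 1)) (n : ℕ) :
    μTens F.toFunctor (fun _ : Fin n => ob 1) ≫ powerApp F H f n =
      tensHom (fun _ => f) ≫ μTens H.toFunctor fun _ => ob 1 := by
  have := isIso_μTens F.toFunctor (fun _ : Fin n => (ob 1 : G.Aug))
  rw [powerApp, IsIso.hom_inv_id_assoc]

/-- A morphism compatible with the multiplications of `⟨1⟩`. -/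
def IsMulHom (f : F.toFunctor.obj (ob 1) ⟶ H.toFunctor.obj (ob 1)) : Prop :=
  ∀ n : ℕ, (μTens F.toFunctor (fun _ => ob 1) ≫ F.toFunctor.map (muHom (1 : G.Op n))) ≫ f =
    tensHom (fun _ => f) ≫ μTens H.toFunctor (fun _ => ob 1) ≫ H.toFunctor.map (muHom (1 : G.Op n))

/-- Put `g` in normal form and cancel the tensorator. The powers of `f` then pass the twist by
`twist_natural`, the regrouping by `blocks_natural` and the multiplications by hypothesis. -/
theorem powerApp_natural {f : F.toFunctor.obj (ob 1) ⟶ H.toFunctor.obj (ob 1)}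
    (hf : IsMulHom f) {m n : ℕ}
    (g : tens (fun _ : Fin m => (ob 1 : G.Aug)) ⟶ tens (fun _ : Fin n => (ob 1 : G.Aug))) :
    F.toFunctor.map g ≫ powerApp F H f n = powerApp F H f m ≫ H.toFunctor.map g := by
  have := isIso_μTens F.toFunctor (fun _ : Fin m => (ob 1 : G.Aug))
  obtain ⟨x, k, h, rfl⟩ := exists_eq_theta_comp g
  rw [← cancel_epi (μTens F.toFunctor fun _ : Fin m => (ob 1 : G.Aug)), ← Category.assoc,
    μTens_map_theta_comp, ← Category.assoc _ (powerApp F H f m), μTens_powerApp]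
  simp only [Category.assoc]
  rw [μTens_map_theta_comp]
  have e₁ := twist_natural x (fun _ : Fin m => f)
  have e₂ := blocks_natural h (fun _ : Fin m => f)
  rw [μTens_powerApp, reassoc_of% e₁, reassoc_of% e₂, tensHom_comp_assoc, tensHom_comp_assoc]
  congr 4
  funext i
  exact hf (k i)

/-- The extension to all objects of a morphism defined on `⟨1⟩`. -/
noncomputable def extendApp (f : F.toFunctor.obj (ob 1) ⟶ H.toFunctor.obj (ob 1)) (a : G.Aug) :
    F.toFunctor.obj a ⟶ H.toFunctor.obj a :=
  F.toFunctor.map (eqToHom (eq_tens_ob_one a)) ≫ powerApp F H f (len a) ≫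
    H.toFunctor.map (eqToHom (eq_tens_ob_one a).symm)

theorem extendApp_natural {f : F.toFunctor.obj (ob 1) ⟶ H.toFunctor.obj (ob 1)}
    (hf : IsMulHom f) {a b : G.Aug} (g : a ⟶ b) :
    F.toFunctor.map g ≫ extendApp f b = extendApp f a ≫ H.toFunctor.map g := by
  have h := powerApp_natural hf
    (eqToHom (eq_tens_ob_one a).symm ≫ g ≫ eqToHom (eq_tens_ob_one b))
  have hF : F.toFunctor.map g ≫ F.toFunctor.map (eqToHom (eq_tens_ob_one b)) =
      F.toFunctor.map (eqToHom (eq_tens_ob_one a)) ≫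
        F.toFunctor.map (eqToHom (eq_tens_ob_one a).symm ≫ g ≫ eqToHom (eq_tens_ob_one b)) := by
    rw [← Functor.map_comp, ← Functor.map_comp]; simp
  have hH : H.toFunctor.map (eqToHom (eq_tens_ob_one a).symm ≫ g ≫ eqToHom (eq_tens_ob_one b)) ≫
        H.toFunctor.map (eqToHom (eq_tens_ob_one b).symm) =
      H.toFunctor.map (eqToHom (eq_tens_ob_one a).symm) ≫ H.toFunctor.map g := by
    rw [← Functor.map_comp, ← Functor.map_comp]; simp
  rw [extendApp, extendApp, reassoc_of% hF, reassoc_of% h, hH]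
  simp only [Category.assoc]

/-- The natural transformation extending a morphism defined on `⟨1⟩`. -/
noncomputable def extendNatTrans {f : F.toFunctor.obj (ob 1) ⟶ H.toFunctor.obj (ob 1)}
    (hf : IsMulHom f) : F.toFunctor ⟶ H.toFunctor where
  app a := extendApp f a
  naturality _ _ g := extendApp_natural hf g

/-- The case `n = 0`: the empty tensor power of `f` is an identity and the iterated tensorators are
the units `ε`. The relabellings are definitional identities here. -/
theorem ε_extendApp (f : F.toFunctor.obj (ob 1) ⟶ H.toFunctor.obj (ob 1)) :
    Functor.LaxMonoidal.ε F.toFunctor ≫ extendApp f (𝟙_ G.Aug) =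
      Functor.LaxMonoidal.ε H.toFunctor := by
  have h : extendApp f (𝟙_ G.Aug) = powerApp F H f 0 := by
    refine (congrArg (· ≫ _) (F.toFunctor.map_id (𝟙_ G.Aug))).trans ((Category.id_comp _).trans ?_)
    exact (congrArg (powerApp F H f 0 ≫ ·) (H.toFunctor.map_id (𝟙_ G.Aug))).trans (Category.comp_id _)
  rw [h]
  exact (μTens_powerApp f 0).trans (Category.id_comp _)

/-- After precomposition with the isomorphisms `split` and the two tensorators of `F`, both sides
become tensor powers of `f`, and `μTens_split` for `F` and `H` with `split_natural` matches them. -/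
theorem powerApp_split (f : F.toFunctor.obj (ob 1) ⟶ H.toFunctor.obj (ob 1)) (q p : ℕ) :
    (powerApp F H f p ⊗ₘ powerApp F H f q) ≫ Functor.LaxMonoidal.μ H.toFunctor _ _ =
      Functor.LaxMonoidal.μ F.toFunctor _ _ ≫
        F.toFunctor.map (split q p fun _ => (ob 1 : G.Aug)).inv ≫ powerApp F H f (q + p) ≫
          H.toFunctor.map (split q p fun _ => (ob 1 : G.Aug)).hom := by
  have i₁ := isIso_μTens F.toFunctor (fun _ : Fin p => (ob 1 : G.Aug))
  have i₂ := isIso_μTens F.toFunctor (fun _ : Fin q => (ob 1 : G.Aug))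
  have hF := μTens_split F.toFunctor q p (fun _ => ob 1)
  have hH := μTens_split H.toFunctor q p (fun _ => ob 1)
  have hs := split_natural q p (fun _ : Fin (q + p) => f)
  rw [← cancel_epi (μTens F.toFunctor (fun _ : Fin p => (ob 1 : G.Aug)) ⊗ₘ
    μTens F.toFunctor (fun _ : Fin q => (ob 1 : G.Aug))),
    ← cancel_epi (split q p fun _ => F.toFunctor.obj (ob 1)).hom]
  have e : F.toFunctor.map (split q p fun _ => (ob 1 : G.Aug)).hom ≫
      F.toFunctor.map (split q p fun _ => (ob 1 : G.Aug)).inv = 𝟙 _ := by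
    rw [← Functor.map_comp, Iso.hom_inv_id]
    exact F.toFunctor.map_id _
  have e₂ : (μTens F.toFunctor (fun _ : Fin p => (ob 1 : G.Aug)) ⊗ₘ
      μTens F.toFunctor (fun _ : Fin q => (ob 1 : G.Aug))) ≫
        (powerApp F H f p ⊗ₘ powerApp F H f q) =
      (tensHom (fun _ => f) ⊗ₘ tensHom (fun _ => f)) ≫
        (μTens H.toFunctor (fun _ : Fin p => (ob 1 : G.Aug)) ⊗ₘ
          μTens H.toFunctor (fun _ : Fin q => (ob 1 : G.Aug))) := by
    rw [tensorHom_comp_tensorHom, μTens_powerApp, μTens_powerApp, tensorHom_comp_tensorHom]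
  rw [reassoc_of% hF, reassoc_of% e, reassoc_of% (μTens_powerApp f (q + p)), reassoc_of% e₂, ← hH,
    reassoc_of% hs]

/-- The identification of `a ⊗ b` with a power of `⟨1⟩` is that of `a` tensored with that of `b`,
followed by the inverse of `split`; all are trivial, so `IsTriv.eq` applies. Naturality of `μ` then
reduces the claim to `powerApp_split`. -/
theorem μ_extendApp {f : F.toFunctor.obj (ob 1) ⟶ H.toFunctor.obj (ob 1)} (a b : G.Aug) :
    Functor.LaxMonoidal.μ F.toFunctor a b ≫ extendApp f (a ⊗ b) =
      (extendApp f a ⊗ₘ extendApp f b) ≫ Functor.LaxMonoidal.μ H.toFunctor a b := by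
  have e : ∀ {a a' b b' : G.Aug} (h : a = a') (h' : b = b'),
      IsTriv (eqToHom h ⊗ₘ eqToHom h') := by
    rintro a _ b _ rfl rfl
    exact ⟨rfl, id_tensorHom_id' a b⟩
  have hs := isTriv_split (len b) (len a) fun _ => (ob 1 : G.Aug)
  have hs' : IsTriv (split (len b) (len a) fun _ => (ob 1 : G.Aug)).inv := by
    obtain ⟨h, h'⟩ := hs
    refine ⟨h.symm, ?_⟩
    rw [← cancel_epi (split (len b) (len a) fun _ => (ob 1 : G.Aug)).hom, Iso.hom_inv_id, h',
      eqToHom_trans, eqToHom_refl]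
  have e₁ : eqToHom (eq_tens_ob_one (a ⊗ b)) =
      (eqToHom (eq_tens_ob_one a) ⊗ₘ eqToHom (eq_tens_ob_one b)) ≫
        (split (len b) (len a) fun _ => (ob 1 : G.Aug)).inv :=
    (isTriv_eqToHom _).eq ((e _ _).comp hs')
  have e₂ : eqToHom (eq_tens_ob_one (a ⊗ b)).symm =
      (split (len b) (len a) fun _ => (ob 1 : G.Aug)).hom ≫
        (eqToHom (eq_tens_ob_one a).symm ⊗ₘ eqToHom (eq_tens_ob_one b).symm) :=
    (isTriv_eqToHom _).eq (hs.comp (e _ _))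
  have e₃ : extendApp f (a ⊗ b) =
      F.toFunctor.map (eqToHom (eq_tens_ob_one a) ⊗ₘ eqToHom (eq_tens_ob_one b)) ≫
      F.toFunctor.map (split (len b) (len a) fun _ => (ob 1 : G.Aug)).inv ≫
      powerApp F H f (len b + len a) ≫
      H.toFunctor.map (split (len b) (len a) fun _ => (ob 1 : G.Aug)).hom ≫
      H.toFunctor.map (eqToHom (eq_tens_ob_one a).symm ⊗ₘ eqToHom (eq_tens_ob_one b).symm) := by
    refine (congrArg (F.toFunctor.map · ≫ _) e₁).trans ?_
    refine (congrArg (_ ≫ powerApp F H f (len b + len a) ≫ H.toFunctor.map ·) e₂).trans ?_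
    have h : ∀ {P Q R S T U : G.Aug} (t : P ⟶ Q) (i : Q ⟶ R) (p : F.toFunctor.obj R ⟶ H.toFunctor.obj S)
        (j : S ⟶ T) (t' : T ⟶ U), F.toFunctor.map (t ≫ i) ≫ p ≫ H.toFunctor.map (j ≫ t') =
          F.toFunctor.map t ≫ F.toFunctor.map i ≫ p ≫ H.toFunctor.map j ≫ H.toFunctor.map t' := by
      intros; simp
    exact h _ _ _ _ _
  rw [e₃, ← Functor.LaxMonoidal.μ_natural_assoc]
  have h := powerApp_split f (len b) (len a)
  rw [← reassoc_of% h, extendApp, extendApp, ← tensorHom_comp_tensorHom, ← tensorHom_comp_tensorHom,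
    Category.assoc, Category.assoc, Functor.LaxMonoidal.μ_natural]

end SymmetricFunctor

end GrpOpd

namespace GrpOpd

open Aug

/-! ### The comparison functor is an equivalence. -/

section Comparison

variable (G : GroupOperad.{w}) (C : Type u) [Category.{v} C] [MonoidalCategory C]
  [SymmetricMonoidal G C]

theorem isIso_tensOne {C : Type u} [Category.{v} C] [MonoidalCategory C] (X : C) :
    IsIso (tensOne X) :=
  (inferInstance : IsIso (ρ_ X).hom)

/-- A monoidal transformation commutes with the iterated tensorators, which are invertible, so its
component at a power of `⟨1⟩` is determined by the one at `⟨1⟩`; every object is such a power. -/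
theorem comparison_faithful : (comparison G C).Faithful where
  map_injective {F H} α β h := by
    let α' : SymMonoidalFunctor.Hom F H := α
    let β' : SymMonoidalFunctor.Hom F H := β
    have h₀ : tensOne (F.toFunctor.obj (ob 1)) ≫ α'.hom.app (ob 1) =
        tensOne (F.toFunctor.obj (ob 1)) ≫ β'.hom.app (ob 1) :=
      congrFun (congrArg MultiNatTrans.app h) PUnit.unit
    have := isIso_tensOne (F.toFunctor.obj (ob 1))
    have h₁ : α'.hom.app (ob 1) = β'.hom.app (ob 1) := (cancel_epi _).1 h₀
    have h₂ : ∀ n, α'.hom.app (tens fun _ : Fin n => ob 1) =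
        β'.hom.app (tens fun _ : Fin n => ob 1) := by
      intro n
      have := isIso_μTens F.toFunctor (fun _ : Fin n => (ob 1 : G.Aug))
      rw [← cancel_epi (μTens F.toFunctor fun _ : Fin n => (ob 1 : G.Aug)),
        ← multiNatTransOf_aux₁, ← multiNatTransOf_aux₁, h₁]
    have h₃ : ∀ {a b : G.Aug}, a = b → α'.hom.app b = β'.hom.app b → α'.hom.app a = β'.hom.app a := by
      rintro a _ rfl h
      exact h
    exact SymMonoidalFunctor.Hom.ext (NatTrans.ext (funext fun a => h₃ (eq_tens_ob_one a) (h₂ _)))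

variable {G C}

/-- Multinaturality at the unique `n`-ary operation of the terminal operad. The factor `tensOne`
appears because a unary multimorphism has source `X ⊗ 𝟙`. -/
theorem isMulHom_of_comparison {F H : SymMonoidalFunctor G G.Aug C}
    (f : F.toFunctor.obj (ob 1) ⟶ H.toFunctor.obj (ob 1))
    (β : MultiNatTrans ((comparison G C).obj F) ((comparison G C).obj H))
    (hβ : β.app PUnit.unit = tensOne (F.toFunctor.obj (ob 1)) ≫ f) : IsMulHom f := by
  intro n
  have h := β.naturality (n := n) (a := fun _ => PUnit.unit) (b := PUnit.unit) PUnit.unit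
  simp only [hβ] at h
  exact (multiNatTransOf_aux₂ _ f).symm.trans (h.trans (multiNatTransOf_aux₃ _ fun _ => f))

/-- The extension restricts to `f`: the case `n = 1`, where the tensorators of `F` and `H` are right
unitors up to the identification of `⟨1⟩ ⊗ 𝟙` with `⟨1⟩`. -/
theorem tensOne_extendApp {F H : SymMonoidalFunctor G G.Aug C}
    (f : F.toFunctor.obj (ob 1) ⟶ H.toFunctor.obj (ob 1)) :
    tensOne (F.toFunctor.obj (ob 1)) ≫ extendApp f (ob 1) = tensOne (F.toFunctor.obj (ob 1)) ≫ f := by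
  have h : ∀ {X Y : G.Aug} {T P Q : C} (t : Y ⟶ X) (e : X ⟶ Y) (m : T ⟶ F.toFunctor.obj Y)
      (s : T ⟶ F.toFunctor.obj X) (p : F.toFunctor.obj Y ⟶ P) (q : P ⟶ Q), t ≫ e = 𝟙 Y →
      m ≫ F.toFunctor.map t = s → s ≫ F.toFunctor.map e ≫ p ≫ q = (m ≫ p) ≫ q := by
    rintro X Y T P Q t e m _ p q h rfl
    rw [Category.assoc, ← Category.assoc (F.toFunctor.map t), ← Functor.map_comp, h, CategoryTheory.Functor.map_id,
      Category.id_comp, Category.assoc]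
  have e : tensOne (ob 1 : G.Aug) ≫ eqToHom (eq_tens_ob_one (ob 1)) = 𝟙 _ :=
    (eqToHom_trans (eq_tens_ob_one (ob 1)).symm (eq_tens_ob_one (ob 1))).trans (eqToHom_refl _ _)
  refine (h _ _ _ _ _ _ e (μTens_one F.toFunctor (ob 1))).trans ?_
  refine (congrArg (· ≫ _) (μTens_powerApp f 1)).trans ((Category.assoc _ _ _).trans ?_)
  exact (congrArg (tensHom (fun _ => f) ≫ ·) (μTens_one H.toFunctor (ob 1))).trans (tensHom_one f)

variable (G C)

theorem comparison_full : (comparison G C).Full where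
  map_surjective {F H} β := by
    let β' : MultiNatTrans ((comparison G C).obj F) ((comparison G C).obj H) := β
    -- The component of a multinatural transformation starts at `X ⊗ 𝟙`; the inverse right unitor
    -- makes it a morphism out of `X`.
    let f : F.toFunctor.obj (ob 1) ⟶ H.toFunctor.obj (ob 1) :=
      (ρ_ (F.toFunctor.obj (ob 1))).inv ≫ β'.app PUnit.unit
    have hβ : β'.app PUnit.unit = tensOne (F.toFunctor.obj (ob 1)) ≫ f :=
      ((ρ_ (F.toFunctor.obj (ob 1))).hom_inv_id_assoc _).symm
    have hf := isMulHom_of_comparison f β' hβ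
    let α : SymMonoidalFunctor.Hom F H :=
      ⟨extendNatTrans hf, ⟨ε_extendApp f, fun a b => μ_extendApp a b⟩⟩
    refine ⟨α, Multifunctor.hom_ext fun a => ?_⟩
    exact (tensOne_extendApp f).trans hβ.symm

variable {C}

namespace MonoidIn

variable (A : MonoidIn C)

/-- The `G`-symmetric monoidal functor of a monoid. -/
noncomputable def symLift : SymMonoidalFunctor G G.Aug C where
  toFunctor := lift G A
  monoidal := liftMonoidal G A
  isSymmetric := (isSymmetric_multifunctorOf_iff (lift G A)).2 fun u a => μTens_lift_theta G A u a

/-- The lift takes the value `A ⊗ 𝟙` at `⟨1⟩`, so its multiplication agrees with that of `A` only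
through the right unitor. This is the naturality square of the isomorphism below. -/
theorem μTens_lift_muHom (n : ℕ) :
    (μTens (lift G A) (fun _ => ob 1) ≫ (lift G A).map (muHom (1 : G.Op n))) ≫ tensOne (carrier A) =
      tensHom (fun _ => tensOne (carrier A)) ≫ mulTens A n := by
  have h : (lift G A).map (muHom (1 : G.Op n)) ≫ tensOne (carrier A) =
      mulTens A (len (tens fun _ : Fin n => (ob 1 : G.Aug))) := by
    refine Eq.trans ?_ (mulTens_arity A (arity_fib (mp (muHom (1 : G.Op n))))).symm
    have e : liftMap A (muHom (1 : G.Op n)) = _ :=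
      liftMap_of_el_one A _ ((el_muHom (1 : G.Op n)).trans (G.γ_one_one _))
    refine (congrArg (· ≫ _) e).trans ((Category.assoc _ _ _).trans ?_)
    exact congrArg (fun t => _ ≫ _ ≫ t) (mulTens_one A).symm
  -- A second use of associativity, now with blocks of length one, produces the `blocks` that
  -- cancels the tensorator of the lift.
  have h' := mulTens_arity A (len_tens fun _ : Fin n => (ob 1 : G.Aug))
  refine (Category.assoc _ _ _).trans ((congrArg (_ ≫ ·) (h.trans h')).trans ?_)
  refine (Category.assoc _ _ _).symm.trans ((congrArg (· ≫ _) (μTens_lift_blocks G A _)).trans ?_)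
  refine (Category.id_comp _).trans (congrArg (fun t => tensHom t ≫ mulTens A n) ?_)
  exact funext fun _ => mulTens_one A

/-- The monoid of the `G`-symmetric monoidal functor of a monoid. -/
noncomputable def comparisonSymLift : (comparison G C).obj (symLift G A) ≅ A where
  hom := (show MultiNatTrans ((comparison G C).obj (symLift G A)) A from
    -- The second `tensOne` is the isomorphism `A ⊗ 𝟙 ≅ A`; the first only presents it as a unary
    -- multimorphism.
    { app _ := tensOne (tens fun _ : Fin 1 => carrier A) ≫ tensOne (carrier A)
      naturality {n a b} f := (multiNatTransOf_aux₂ _ (tensOne (carrier A))).trans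
        ((μTens_lift_muHom G A n).trans
          (multiNatTransOf_aux₃ (mulTens A n) fun _ => tensOne (carrier A)).symm) })
  inv := (show MultiNatTrans A ((comparison G C).obj (symLift G A)) from
    { app _ := tensOne (carrier A) ≫ (ρ_ (carrier A)).inv
      naturality {n a b} f := by
        -- Naturality of the inverse is naturality of the isomorphism with the right unitors moved
        -- to the other side.
        have h : mulTens A n ≫ (ρ_ (carrier A)).inv = tensHom (fun _ => (ρ_ (carrier A)).inv) ≫
            μTens (lift G A) (fun _ => ob 1) ≫ (lift G A).map (muHom (1 : G.Op n)) := by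
          have e : tensHom (fun _ : Fin n => (ρ_ (carrier A)).inv) ≫
              tensHom (fun _ => tensOne (carrier A)) = 𝟙 _ := by
            refine (tensHom_comp _ _).symm.trans (Eq.trans ?_ (tensHom_id _))
            exact congrArg tensHom (funext fun _ => (ρ_ (carrier A)).inv_hom_id)
          refine (Iso.comp_inv_eq (ρ_ (carrier A))).2 ?_
          refine Eq.trans ?_ (Category.assoc _ _ _).symm
          refine Eq.trans ?_ (congrArg (_ ≫ ·) (μTens_lift_muHom G A n)).symm
          refine Eq.trans ?_ (Category.assoc _ _ _)
          exact ((congrArg (· ≫ mulTens A n) e).trans (Category.id_comp _)).symm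
        exact (multiNatTransOf_aux₂ (mulTens A n) (ρ_ (carrier A)).inv).trans
          (h.trans (multiNatTransOf_aux₃ _ fun _ => (ρ_ (carrier A)).inv).symm) })
  hom_inv_id := Multifunctor.hom_ext fun a => by
    refine (multiNatTransOf_aux₂ (tensOne (tens fun _ : Fin 1 => carrier A) ≫ tensOne (carrier A))
      (ρ_ (carrier A)).inv).trans ?_
    exact (Category.assoc _ _ _).trans ((congrArg (_ ≫ ·) (ρ_ (carrier A)).hom_inv_id).trans
      (Category.comp_id _))
  inv_hom_id := Multifunctor.hom_ext fun a => by
    refine (multiNatTransOf_aux₂ (tensOne (carrier A) ≫ (ρ_ (carrier A)).inv)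
      (tensOne (carrier A))).trans ?_
    exact (Category.assoc _ _ _).trans ((congrArg (_ ≫ ·) (ρ_ (carrier A)).inv_hom_id).trans
      (Category.comp_id _))

end MonoidIn

variable (C)

theorem comparison_essSurj : (comparison G C).EssSurj where
  mem_essImage A := ⟨MonoidIn.symLift G A, ⟨MonoidIn.comparisonSymLift G A⟩⟩

theorem comparison_isEquivalence : (comparison G C).IsEquivalence where
  faithful := comparison_faithful G C
  full := comparison_full G C
  essSurj := comparison_essSurj G C

end Comparison

end GrpOpd

/-- The last three clauses together say that restriction along the units is an isomorphism of
categories: fully faithful and bijective on objects. -/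
theorem mainTheorem5 (G : GrpOpd.GroupOperad.{w}) (C : Type u) [Category.{v} C] [MonoidalCategory C]
    [GrpOpd.SymmetricMonoidal G C] :
    (GrpOpd.comparison G C).IsEquivalence ∧
      Function.Bijective (GrpOpd.restrictUnit G (GrpOpd.ofMonoidal C)).obj ∧
        (GrpOpd.restrictUnit G (GrpOpd.ofMonoidal C)).Full ∧
          (GrpOpd.restrictUnit G (GrpOpd.ofMonoidal C)).Faithful := by
  exact ⟨GrpOpd.comparison_isEquivalence G C, GrpOpd.restrictUnit_bijective G _,
    GrpOpd.restrictUnit_full G _, GrpOpd.restrictUnit_faithful G _⟩
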